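/- Let $F$ be a number field with adele ring $\mathbb{A}$, let $E=F(\sqrt{\varsigma})$ be a quadratic extension of $F$ ($\varsigma\in F$ not a square), with non-trivial Galois automorphism $\iota$ and $\mathbb{A}_E=E\otimes_F\mathbb{A}$. Let $V=\mathrm{Span}_E\{e_1,e_2,e_{-2},e_{-1}\}$ carry the Hermitian form $q$ (linear in the first variable) with $q(e_i,e_{-j})=\delta_{ij}$ and $q(e_i,e_j)=q(e_{-i},e_{-j})=0$ for $i,j\in\{1,2\}$, and let $\mathrm{U}_{2,2}=\mathrm{U}(V,q)$, written as matrices in the basis $e_1,e_2,e_{-2},e_{-1}$. Fix a non-trivial continuous unitary character $\psi$ of $F\backslash\mathbb{A}$ and a maximal compact subgroup $K_\infty$ of $\mathrm{U}_{2,2}(F\otimes_{\mathbb{Q}}\mathbb{R})$, whose Lie algebra is denoted by $\mathfrak{g}$. Let $N_0$ be the group of upper triangular unipotent matrices in $\mathrm{U}_{2,2}$, and let $N_1\subset N_0$ be the unipotent radical of the stabilizer of the line $Ee_1$. For $\beta\in E^\times$ and $\alpha\in F^\times$ let $\psi_{\beta,\alpha}$ be the character of $N_0(F)\backslash N_0(\mathbb{A})$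 given by $$\psi_{\beta,\alpha}(n)=\psi\bigl(\tfrac12\mathrm{tr}_{E/F}(\beta u)+\alpha y\bigr),\qquad n_{12}=u\in\mathbb{A}_E,\quad n_{23}=\sqrt{\varsigma}\,y,\ y\in\mathbb{A}.$$ For $v\in\mathrm{Span}_E\{e_2,e_{-2}\}$ let $\psi_{[31];v}$ be the character of $N_1(F)\backslash N_1(\mathbb{A})$ given by $$\psi_{[31];v}(n)=\psi\bigl(\tfrac12\mathrm{tr}_{E/F}\,q(ue_2+xe_{-2},v)\bigr),\qquad (u,x)=(n_{12},n_{13})\in\mathbb{A}_E^2.$$ Let $\pi$ be an irreducible cuspidal automorphic representation of $\mathrm{U}_{2,2}(\mathbb{A})$, realized as an irreducible $(\mathfrak{g},K_\infty)\times\mathrm{U}_{2,2}(\mathbb{A}_f)$-submodule of the space of cusp forms on $\mathrm{U}_{2,2}(F)\backslash\mathrm{U}_{2,2}(\mathbb{A})$. Assume that $\pi$ is generic, i.e. it has a non-zero Whittaker-Fourier coefficient: there are $\beta\in E^\times$, $\alpha\in F^\times$ and $\varphi\in\pi$ such that $$g\mapsto\int_{N_0(F)\backslash N_0(\mathbb{A})}\varphi(ng)\,\psi_{\beta,\alpha}(n)^{-1}\,dn$$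 is not identically zero on $\mathrm{U}_{2,2}(\mathbb{A})$. Then $\pi$ has a non-zero Fourier coefficient associated to the subregular partition $[31]$: there are $\alpha\in E$ with $\mathrm{tr}_{E/F}(\alpha)\neq0$, so that $v_\alpha=e_2+\alpha e_{-2}$ is anisotropic, and $\varphi\in\pi$ such that $$g\mapsto\int_{N_1(F)\backslash N_1(\mathbb{A})}\varphi(ng)\,\psi_{[31];v_\alpha}(n)^{-1}\,dn$$ is not identically zero on $\mathrm{U}_{2,2}(\mathbb{A})$. -/

import Mathlib

open MeasureTheory NumberField
open scoped NumberField.AdeleRing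

noncomputable section

/-! ### The quadratic extension

For a commutative ring `R` and `d : R`, `QuadraticAlgebra R d 0` is `R[√d] = R ⊕ R √d`; its
star operation is the involution `x + y √d ↦ x - y √d`.  For a number field `F` and a non-square
`d : F` this is the quadratic field `E = F(√d)` with the non-trivial element of `Gal(E/F)`, and
`QuadraticAlgebra 𝔸[F] d 0` is `𝔸_E = E ⊗_F 𝔸_F`. -/

namespace QuadExt

/-- The product topology on `R[√d] = R × R`. -/
instance instTopologicalSpaceQuad {R : Type*} [TopologicalSpace R] (a b : R) :
    TopologicalSpace (QuadraticAlgebra R a b) :=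
  TopologicalSpace.induced (QuadraticAlgebra.equivProd a b) inferInstance

/-- The base change `R[√d] → S[√(f d)]` of a ring homomorphism `f : R → S`. -/
def mapHom {R S : Type*} [CommRing R] [CommRing S] (f : R →+* S) (d : R) :
    QuadraticAlgebra R d 0 →+* QuadraticAlgebra S (f d) 0 where
  toFun z := ⟨f z.re, f z.im⟩
  map_one' := QuadraticAlgebra.ext (map_one f) (map_zero f)
  map_zero' := QuadraticAlgebra.ext (map_zero f) (map_zero f)
  map_add' x y := by ext <;> simp
  map_mul' x y := by ext <;> simp

theorem mapHom_star {R S : Type*} [CommRing R] [CommRing S] (f : R →+* S) (d : R)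
    (z : QuadraticAlgebra R d 0) : mapHom f d (star z) = star (mapHom f d z) := by
  ext <;> simp [mapHom]

/-- Half of the trace `R[√d] → R`, that is `x + y √d ↦ x`. -/
def halfTrace {R : Type*} [CommRing R] {d : R} (z : QuadraticAlgebra R d 0) : R := z.re

theorem trace_eq_two_mul_halfTrace {R : Type*} [CommRing R] {d : R}
    (z : QuadraticAlgebra R d 0) : QuadraticAlgebra.trace z = 2 * halfTrace z := by
  simp [QuadraticAlgebra.trace_def, halfTrace]

end QuadExt

/-! ### The quasi-split unitary group `U_{2,2}` and its unipotent subgroups -/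

namespace U22

open Matrix QuadExt

/-- The anti-diagonal matrix: the Gram matrix of the Hermitian form `q` in the basis
`e₁, e₂, e₋₂, e₋₁`, with `q(e_i, e_{-j}) = δ_{ij}` and all other products zero. -/
def antidiag (A : Type*) [CommRing A] : Matrix (Fin 4) (Fin 4) A :=
  Matrix.of fun i j => if i.rev = j then 1 else 0

theorem antidiag_mul {A : Type*} [CommRing A] (M : Matrix (Fin 4) (Fin 4) A) (i j : Fin 4) :
    (antidiag A * M) i j = M i.rev j := by
  simp [antidiag, Matrix.mul_apply]

theorem mul_antidiag {A : Type*} [CommRing A] (M : Matrix (Fin 4) (Fin 4) A) (i j : Fin 4) :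
    (M * antidiag A) i j = M i j.rev := by
  simp [antidiag, Matrix.mul_apply, Fin.rev_eq_iff]

theorem antidiag_mul_antidiag (A : Type*) [CommRing A] : antidiag A * antidiag A = 1 := by
  ext i j
  rw [antidiag_mul]
  simp [antidiag, Matrix.one_apply]

/-- The `R`-points of `U_{2,2}`, for `R[√d]` over `R`. -/
def group (R : Type*) [CommRing R] (d : R) : Subgroup (GL (Fin 4) (QuadraticAlgebra R d 0)) where
  carrier := {g | (g.val)ᴴ * antidiag _ * g.val = antidiag _}
  one_mem' := by simp
  mul_mem' := by
    intro a b ha hb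
    simp only [Set.mem_ofPred_eq] at ha hb ⊢
    rw [Units.val_mul, conjTranspose_mul]
    calc (b.val)ᴴ * (a.val)ᴴ * antidiag _ * (a.val * b.val)
        = (b.val)ᴴ * ((a.val)ᴴ * antidiag _ * a.val) * b.val := by simp only [Matrix.mul_assoc]
      _ = antidiag _ := by rw [ha, hb]
  inv_mem' := by
    intro a ha
    simp only [Set.mem_ofPred_eq] at ha ⊢
    have h1 : a.val * (a⁻¹).val = 1 := a.mul_inv
    have h2 : ((a⁻¹).val)ᴴ * (a.val)ᴴ = 1 := by
      rw [← conjTranspose_mul, h1, conjTranspose_one]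
    calc ((a⁻¹).val)ᴴ * antidiag _ * (a⁻¹).val
        = ((a⁻¹).val)ᴴ * ((a.val)ᴴ * antidiag _ * a.val) * (a⁻¹).val := by rw [ha]
      _ = (((a⁻¹).val)ᴴ * (a.val)ᴴ) * antidiag _ * (a.val * (a⁻¹).val) := by
          simp only [Matrix.mul_assoc]
      _ = antidiag _ := by rw [h1, h2, Matrix.one_mul, Matrix.mul_one]

/-- The matrix of an element of `U_{2,2}(R)`. -/
def mat {R : Type*} [CommRing R] {d : R} (g : group R d) :
    Matrix (Fin 4) (Fin 4) (QuadraticAlgebra R d 0) := g.1.val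

theorem mat_mul {R : Type*} [CommRing R] {d : R} (g h : group R d) :
    mat (g * h) = mat g * mat h := rfl

theorem mat_inv {R : Type*} [CommRing R] {d : R} (g : group R d) :
    mat g⁻¹ = antidiag _ * (mat g)ᴴ * antidiag _ := by
  have h : (antidiag _ * (mat g)ᴴ * antidiag _) * mat g = 1 := by
    have hg : (mat g)ᴴ * antidiag _ * mat g = antidiag _ := g.2
    rw [Matrix.mul_assoc, Matrix.mul_assoc, ← Matrix.mul_assoc _ (antidiag _) (mat g), hg, antidiag_mul_antidiag]
  have h' : mat g * mat g⁻¹ = 1 := g.1.mul_inv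
  calc mat g⁻¹ = (antidiag _ * (mat g)ᴴ * antidiag _) * mat g * mat g⁻¹ := by rw [h, Matrix.one_mul]
    _ = _ := by rw [Matrix.mul_assoc _ (mat g), h', Matrix.mul_one]

theorem mat_inv_apply {R : Type*} [CommRing R] {d : R} (g : group R d) (i j : Fin 4) :
    mat g⁻¹ i j = star (mat g j.rev i.rev) := by
  rw [mat_inv, mul_antidiag, antidiag_mul, conjTranspose_apply]

/-- Functoriality of `U_{2,2}(R)` in `R`. -/
def mapGroup {R S : Type*} [CommRing R] [CommRing S] (f : R →+* S) (d : R) :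
    group R d →* group S (f d) :=
  ((GeneralLinearGroup.map (mapHom f d)).comp (group R d).subtype).codRestrict _ (by
    intro g
    have hg : (mat g)ᴴ * antidiag _ * mat g = antidiag _ := g.2
    have h_antidiag : (antidiag (QuadraticAlgebra R d 0)).map (mapHom f d) = antidiag _ := by
      refine Matrix.ext fun i j => ?_
      simp only [antidiag, Matrix.map_apply, Matrix.of_apply]
      split_ifs <;> simp
    have hs : ((mat g)ᴴ).map (mapHom f d) = ((mat g).map (mapHom f d))ᴴ := by
      refine Matrix.ext fun i j => ?_
      simp only [Matrix.map_apply, conjTranspose_apply, mapHom_star]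
    change ((mat g).map (mapHom f d))ᴴ * antidiag _ * (mat g).map (mapHom f d) = antidiag _
    rw [← hs, ← h_antidiag, ← Matrix.map_mul, ← Matrix.map_mul, hg])

/-- For a weight `w` on the basis vectors, the unipotent radical of the corresponding standard
parabolic subgroup: the `g` whose entry at `(i, j)` is that of the identity matrix
unless `w i > w j`. -/
def unipotentRadical (R : Type*) [CommRing R] (d : R) (w : Fin 4 → ℕ)
    (hw : ∀ i j, w i ≤ w j → w j.rev ≤ w i.rev) : Subgroup (group R d) where
  carrier := {g | ∀ i j, w i ≤ w j → mat g i j = if i = j then 1 else 0}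
  one_mem' := fun i j _ => Matrix.one_apply
  mul_mem' := by
    intro a b ha hb i j hij
    rw [mat_mul, Matrix.mul_apply]
    have key : ∀ k, mat a i k * mat b k j = if i = k then (if i = j then 1 else 0) else 0 := by
      intro k
      by_cases hik : i = k
      · subst hik
        rw [ha i i le_rfl, hb i j hij]; simp
      · rw [if_neg hik]
        by_cases h : w i ≤ w k
        · rw [ha i k h, if_neg hik, zero_mul]
        · have hkj : w k ≤ w j := by omega
          have hne : k ≠ j := by rintro rfl; exact h hij
          rw [hb k j hkj, if_neg hne, mul_zero]
    simp [key]
  inv_mem' := by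
    intro a ha i j hij
    rw [mat_inv_apply, ha _ _ (hw i j hij)]
    by_cases h : i = j
    · subst h; simp
    · have : j.rev ≠ i.rev := fun e => h (Fin.rev_injective e).symm
      simp [h, this]

/-- `N₀`: the unipotent radical of the Borel subgroup of upper triangular matrices. -/
def N0 (R : Type*) [CommRing R] (d : R) : Subgroup (group R d) :=
  unipotentRadical R d ![3, 2, 1, 0] (by decide)

/-- `N₁`: the unipotent radical of the stabilizer of the isotropic line spanned by `e₁`. -/
def N1 (R : Type*) [CommRing R] (d : R) : Subgroup (group R d) :=
  unipotentRadical R d ![2, 1, 1, 0] (by decide)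

/-- `N₂`: the unipotent radical of the stabilizer of the isotropic plane spanned by `e₁, e₂`. -/
def N2 (R : Type*) [CommRing R] (d : R) : Subgroup (group R d) :=
  unipotentRadical R d ![1, 1, 0, 0] (by decide)

end U22

/-! ### Smooth functions and invariant differential operators

For a topological group `G`, the continuous homomorphisms `X : ℝ → G` are its one-parameter
subgroups.  For a Lie group they are the `t ↦ exp(tX)` with `X` in the Lie algebra.  For the adelic
points of an algebraic group they are those of the archimedean component, since the
finite-adelic component is totally disconnected. -/

namespace LieCalc

variable {G : Type*} [Group G] [TopologicalSpace G]

/-- The derivative of `f` along `X`: `(X f)(g) = d/dt f(g exp(tX))` at `t = 0`. -/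
def derivAlong (X : Multiplicative ℝ →ₜ* G) (f : G → ℂ) (g : G) : ℂ :=
  deriv (fun t : ℝ => f (g * X (Multiplicative.ofAdd t))) 0

/-- Iterated derivatives along one-parameter subgroups. -/
def iterDeriv : List (Multiplicative ℝ →ₜ* G) → (G → ℂ) → (G → ℂ)
  | [], f => f
  | X :: L, f => iterDeriv L (derivAlong X f)

/-- All iterated derivatives of `f` along one-parameter subgroups exist and are continuous. On a
Lie group this means that `f` is of class `C^∞`. -/
def IsSmooth (f : G → ℂ) : Prop :=
  ∀ L : List (Multiplicative ℝ →ₜ* G), Continuous (iterDeriv L f) ∧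
    ∀ (X : Multiplicative ℝ →ₜ* G) (g : G),
      DifferentiableAt ℝ (fun t : ℝ => iterDeriv L f (g * X (Multiplicative.ofAdd t))) 0

theorem IsSmooth.derivAlong {f : G → ℂ} (hf : IsSmooth f) (X : Multiplicative ℝ →ₜ* G) :
    IsSmooth (derivAlong X f) := fun L => hf (X :: L)

theorem derivAlong_add {f h : G → ℂ} (hf : IsSmooth f) (hh : IsSmooth h)
    (X : Multiplicative ℝ →ₜ* G) :
    derivAlong X (f + h) = derivAlong X f + derivAlong X h := by
  funext g
  exact deriv_add ((hf []).2 X g) ((hh []).2 X g)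

theorem derivAlong_smul {f : G → ℂ} (hf : IsSmooth f) (c : ℂ) (X : Multiplicative ℝ →ₜ* G) :
    derivAlong X (c • f) = c • derivAlong X f := by
  funext g
  exact deriv_const_smul c ((hf []).2 X g)

theorem iterDeriv_add (L : List (Multiplicative ℝ →ₜ* G)) :
    ∀ {f h : G → ℂ}, IsSmooth f → IsSmooth h →
      iterDeriv L (f + h) = iterDeriv L f + iterDeriv L h := by
  induction L with
  | nil => intro f h _ _; rfl
  | cons X L ih =>
    intro f h hf hh
    simp only [iterDeriv]
    rw [derivAlong_add hf hh, ih (hf.derivAlong X) (hh.derivAlong X)]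

theorem iterDeriv_smul (L : List (Multiplicative ℝ →ₜ* G)) (c : ℂ) :
    ∀ {f : G → ℂ}, IsSmooth f → iterDeriv L (c • f) = c • iterDeriv L f := by
  induction L with
  | nil => intro f _; rfl
  | cons X L ih =>
    intro f hf
    simp only [iterDeriv]
    rw [derivAlong_smul hf, ih (hf.derivAlong X)]

theorem IsSmooth.add {f h : G → ℂ} (hf : IsSmooth f) (hh : IsSmooth h) : IsSmooth (f + h) := by
  intro L
  rw [iterDeriv_add L hf hh]
  exact ⟨(hf L).1.add (hh L).1, fun X g => ((hf L).2 X g).add ((hh L).2 X g)⟩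

theorem IsSmooth.smul {f : G → ℂ} (hf : IsSmooth f) (c : ℂ) : IsSmooth (c • f) := by
  intro L
  rw [iterDeriv_smul L c hf]
  exact ⟨(hf L).1.const_smul c, fun X g => ((hf L).2 X g).const_smul c⟩

theorem iterDeriv_zero (L : List (Multiplicative ℝ →ₜ* G)) :
    iterDeriv L (0 : G → ℂ) = 0 := by
  induction L with
  | nil => rfl
  | cons X L ih =>
    have : LieCalc.derivAlong X (0 : G → ℂ) = 0 := by
      funext g
      simp [LieCalc.derivAlong]
    simp only [iterDeriv]
    rw [this, ih]

theorem isSmooth_zero : IsSmooth (0 : G → ℂ) := by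
  intro L
  rw [iterDeriv_zero]
  exact ⟨continuous_const, fun _ _ => differentiableAt_const _⟩

variable (G) in
/-- The space of smooth functions. -/
def smoothFunctions : Submodule ℂ (G → ℂ) where
  carrier := {f | IsSmooth f}
  zero_mem' := isSmooth_zero
  add_mem' := IsSmooth.add
  smul_mem' c _ hf := IsSmooth.smul hf c

/-- The left-invariant vector field of `X` as an operator on smooth functions. -/
def derivOp (X : Multiplicative ℝ →ₜ* G) : Module.End ℂ (smoothFunctions G) where
  toFun f := ⟨derivAlong X f.1, IsSmooth.derivAlong f.2 X⟩
  map_add' f h := Subtype.ext (derivAlong_add f.2 h.2 X)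
  map_smul' c f := Subtype.ext (derivAlong_smul f.2 c X)

variable (G) in
/-- The algebra of left-invariant differential operators generated by the vector fields; this is
the faithful image of the universal enveloping algebra of the complexified Lie algebra. -/
def invariantDiffOps : Subalgebra ℂ (Module.End ℂ (smoothFunctions G)) :=
  Algebra.adjoin ℂ (Set.range derivOp)

/-- `f` is smooth, and its images under the centre of the algebra of invariant differential
operators span a finite-dimensional space. -/
def IsCentreFinite (f : G → ℂ) : Prop :=
  ∃ hf : f ∈ smoothFunctions G,
    FiniteDimensional ℂ (Submodule.span ℂ
      (Set.range fun z : Subalgebra.center ℂ (invariantDiffOps G) => z.1.1 ⟨f, hf⟩))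

end LieCalc

/-! ### Integrals over `Γ \ V` -/

/-- Let `V` and `Γ` be subgroups of a topological group `G` and let `f` be a function on `V` that
is left invariant under `Γ ∩ V`.  This says that the integral of `f` over `(Γ ∩ V) \ V` with
respect to the invariant probability measure exists and is equal to `c`; the integral is
computed over a fundamental domain with respect to a Haar measure of `V`. -/
def HasPeriod {G : Type*} [Group G] [TopologicalSpace G] (Γ V : Subgroup G) (f : G → ℂ)
    (c : ℂ) : Prop :=
  letI : MeasurableSpace V := borel V
  ∃ (μ : Measure V) (D : Set V), μ.IsHaarMeasure ∧ IsFundamentalDomain (Γ.subgroupOf V) D μ ∧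
    μ D = 1 ∧ IntegrableOn (fun v : V => f v) D μ ∧ ∫ v in D, f v ∂μ = c

/-! ### Cuspidal automorphic representations of `U_{2,2}(𝔸)` -/

namespace U22

open Matrix QuadExt LieCalc

variable (F : Type*) [Field F] [NumberField F] (d : F)

/-- `U_{2,2}(𝔸)`, with `𝔸` the adele ring of `F`. It carries the topology induced from
`GL₄(𝔸_E)`. -/
abbrev Adelic : Type _ := group 𝔸[F] (algebraMap F 𝔸[F] d)

/-- The subgroup `U_{2,2}(F)` of `U_{2,2}(𝔸)`. -/
def rational : Subgroup (Adelic F d) := (mapGroup (algebraMap F 𝔸[F]) d).range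

/-- The archimedean component `U_{2,2}(𝔸_∞)`: the adelic points with trivial finite component. -/
def arch : Subgroup (Adelic F d) :=
  (mapGroup (RingHom.snd F∞ 𝔸ᶠ[F] : 𝔸[F] →+* 𝔸ᶠ[F]) (algebraMap F 𝔸[F] d)).ker

/-- The finite component `U_{2,2}(𝔸_f)`: the adelic points with trivial archimedean component. -/
def fin : Subgroup (Adelic F d) :=
  (mapGroup (RingHom.fst F∞ 𝔸ᶠ[F] : 𝔸[F] →+* F∞) (algebraMap F 𝔸[F] d)).ker

/-- `K` is a maximal compact subgroup of `U_{2,2}(𝔸_∞)`. -/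
def IsMaximalCompact (K : Subgroup (Adelic F d)) : Prop :=
  Maximal (fun K' : Subgroup (Adelic F d) => K' ≤ arch F d ∧ IsCompact (K' : Set (Adelic F d))) K

variable {F d}

/-- Right translation `(R_k φ)(g) = φ(g k)`. -/
def rightTranslate (k : Adelic F d) (φ : Adelic F d → ℂ) : Adelic F d → ℂ := fun g => φ (g * k)

/-- The sum of the archimedean absolute values of the coordinates of the entries of a matrix. -/
def archSize (M : Matrix (Fin 4) (Fin 4) (QuadraticAlgebra 𝔸[F] (algebraMap F 𝔸[F] d) 0)) : ℝ :=
  ∑ i, ∑ j, ∑ v : InfinitePlace F, (‖(M i j).re.1 v‖ + ‖(M i j).im.1 v‖)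

/-- The archimedean height `‖g‖` of `g`. -/
def archHeight (g : Adelic F d) : ℝ := archSize (mat g) + archSize (mat g⁻¹)

/-- Automorphic forms on `U_{2,2}(𝔸)` in the sense of Borel and Jacquet, with respect to a maximal
compact subgroup `K` of `U_{2,2}(𝔸_∞)`. -/
structure IsAutomorphicForm (K : Subgroup (Adelic F d)) (φ : Adelic F d → ℂ) : Prop where
  left_invariant : ∀ γ ∈ rational F d, ∀ g, φ (γ * g) = φ g
  smooth : IsSmooth φ
  /-- `φ` is right invariant under an open subgroup of `U_{2,2}(𝔸_f)`. -/
  level : ∃ U : Subgroup (Adelic F d), U ≤ fin F d ∧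
    IsOpen ((U.subgroupOf (fin F d) : Subgroup (fin F d)) : Set (fin F d)) ∧
    ∀ k ∈ U, rightTranslate k φ = φ
  finite_K : FiniteDimensional ℂ (Submodule.span ℂ ((fun k => rightTranslate k φ) '' K))
  finite_centre : IsCentreFinite φ
  moderate_growth : ∀ y ∈ fin F d, ∃ (C : ℝ) (m : ℕ), ∀ x ∈ arch F d,
    ‖φ (x * y)‖ ≤ C * archHeight x ^ m

/-- All constant terms of `φ` along the unipotent radicals of the standard proper parabolic
subgroups vanish. -/
def IsCuspidal (φ : Adelic F d → ℂ) : Prop :=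
  ∀ g : Adelic F d,
    HasPeriod (rational F d) (N0 _ _) (fun n => φ (n * g)) 0 ∧
    HasPeriod (rational F d) (N1 _ _) (fun n => φ (n * g)) 0 ∧
    HasPeriod (rational F d) (N2 _ _) (fun n => φ (n * g)) 0

/-- Stability of a space of functions on `U_{2,2}(𝔸)` under right translation by
`K × U_{2,2}(𝔸_f)` and under the Lie algebra of `U_{2,2}(𝔸_∞)`. -/
structure IsStable (K : Subgroup (Adelic F d)) (π : Submodule ℂ (Adelic F d → ℂ)) : Prop where
  right_K : ∀ k ∈ K, ∀ φ ∈ π, rightTranslate k φ ∈ π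
  right_fin : ∀ k ∈ fin F d, ∀ φ ∈ π, rightTranslate k φ ∈ π
  lie : ∀ X : Multiplicative ℝ →ₜ* Adelic F d, ∀ φ ∈ π, derivAlong X φ ∈ π

/-- `π` is (the space of) an irreducible cuspidal automorphic representation of `U_{2,2}(𝔸)`: an
irreducible `(𝔤, K) × U_{2,2}(𝔸_f)`-submodule of the space of cusp forms. -/
structure IsIrreducibleCuspidal (K : Subgroup (Adelic F d))
    (π : Submodule ℂ (Adelic F d → ℂ)) : Prop where
  automorphic : ∀ φ ∈ π, IsAutomorphicForm K φ
  cuspidal : ∀ φ ∈ π, IsCuspidal φ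
  stable : IsStable K π
  ne_bot : π ≠ ⊥
  irreducible : ∀ σ : Submodule ℂ (Adelic F d → ℂ), σ ≤ π → IsStable K σ → σ = ⊥ ∨ σ = π

/-! ### Fourier coefficients -/

/-- The inclusion `E → 𝔸_E`. -/
abbrev toAdele : QuadraticAlgebra F d 0 →+* QuadraticAlgebra 𝔸[F] (algebraMap F 𝔸[F] d) 0 :=
  mapHom (algebraMap F 𝔸[F]) d

/-- The character of `N₀(𝔸)` attached to `ψ`, `β ∈ E` and `α ∈ F`: its value at the unipotent
matrix with entries `u` at `(1, 2)` and `√d y` at `(2, 3)`, where `u ∈ 𝔸_E` and `y ∈ 𝔸`, is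
`ψ(½ tr(β u) + α y)`. -/
def whittakerCharacter (ψ : AddChar 𝔸[F] Circle) (β : QuadraticAlgebra F d 0) (α : F)
    (n : Adelic F d) : ℂ :=
  ψ (halfTrace (toAdele β * mat n 0 1) + algebraMap F 𝔸[F] α * (mat n 1 2).im)

/-- `π` is generic: for some non-degenerate character of `N₀(F) \ N₀(𝔸)`, some `φ ∈ π` has a
Whittaker-Fourier coefficient that does not vanish identically. -/
def IsGeneric (ψ : AddChar 𝔸[F] Circle) (π : Submodule ℂ (Adelic F d → ℂ)) : Prop :=
  ∃ (β : QuadraticAlgebra F d 0) (α : F), β ≠ 0 ∧ α ≠ 0 ∧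
    ∃ φ ∈ π, ∃ g : Adelic F d, ∃ c : ℂ, c ≠ 0 ∧
      HasPeriod (rational F d) (N0 _ _)
        (fun n => φ (n * g) * (whittakerCharacter ψ β α n)⁻¹) c

/-- The restriction of the Hermitian form `q` to the span of `e₂, e₋₂`, in coordinates. -/
def middleForm {A : Type*} [CommRing A] [StarRing A] (x v : A × A) : A :=
  x.1 * star v.2 + x.2 * star v.1

/-- The character of `N₁(𝔸)` attached to `ψ` and a vector `v = v₁ e₂ + v₂ e₋₂` with `v₁, v₂ ∈ E`:
its value at a unipotent matrix with first row `(1, u, x, z)` is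
`ψ(½ tr q(u e₂ + x e₋₂, v))`. -/
def besselCharacter (ψ : AddChar 𝔸[F] Circle)
    (v : QuadraticAlgebra F d 0 × QuadraticAlgebra F d 0) (n : Adelic F d) : ℂ :=
  ψ (halfTrace (middleForm (mat n 0 1, mat n 0 2) (toAdele v.1, toAdele v.2)))

/-- `π` has a nonzero Fourier coefficient for the partition `[31]`: for some `α ∈ E` such that
`v_α = e₂ + α e₋₂` is anisotropic, that is `q(v_α, v_α) = tr(α) ≠ 0`, some `φ ∈ π` has a Fourier
coefficient along `N₁` with respect to the character of `v_α` that does not vanish identically. -/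
def HasSubregularCoefficient (ψ : AddChar 𝔸[F] Circle) (π : Submodule ℂ (Adelic F d → ℂ)) : Prop :=
  ∃ α : QuadraticAlgebra F d 0, middleForm (1, α) (1, α) ≠ 0 ∧
    ∃ φ ∈ π, ∃ g : Adelic F d, ∃ c : ℂ, c ≠ 0 ∧
      HasPeriod (rational F d) (N1 _ _)
        (fun n => φ (n * g) * (besselCharacter ψ (1, α) n)⁻¹) c

end U22

end

/-! Suppose that every coefficient along N₁ attached to an anisotropic `v_α` vanishes; then all
Whittaker coefficients vanish, against genericity. Let x(b), u(a), z(e), y(c) denote the unipotent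
elements with entry b at (1,3), a at (1,2), e√d at (1,4) and c√d at (2,3), and y⁻(c) the transpose
of y(c).

Let f be the mean of φ over x(b)z(e) against ψ(-Re b) (`heisMean`). The Fourier coefficients of a ↦
f(u(a)g) on 𝔸_E/E are the N₁-coefficients of φ for the vectors `v_α`, α ∈ E. By assumption only
those with tr α = 0 survive, and their characters are trivial on 𝔸 ⊂ 𝔸_E. So f is left invariant
under u(r) for all r ∈ 𝔸 (`heisMean_rootU_ofBase`).

Averaging f over y(c) gives a coefficient along the Siegel radical N₂ (`siegelMean`). It keeps the
invariance under u(r) and is also invariant under a rational Weyl element of the Levi factor. It is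
therefore invariant under the copy of SL₂ generated by both, in particular under t = diag(T, T⁻¹, T,
T⁻¹) for every idele T (`siegelMean_torusT`).

This invariance is transferred to the coefficient for the isotropic vector e₂ (`isoMean`). The
function Z(c,s) = f(y(c)u(s√d)g) is F-periodic in c and quasi-periodic in s, like a Zak transform.
Its mean over c is a Siegel coefficient, as a function H of s ∈ 𝔸; unfolding shows that the Fourier
transform of H at 0 is the mean of Z(0,s) over s, which is the isotropic coefficient. Since t acts
on H by the dilation s ↦ T²s, it multiplies the isotropic coefficient by a positive constant
(`integral_mul_mean`, `exists_mean_eq`, `exists_isoMean_torusT`).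

The isotropic coefficient is also left invariant under y⁻(γ), γ ∈ F, hence, after conjugation by t,
under y⁻(T²γ). A rational change of variables writes a Whittaker coefficient as the Fourier
coefficient of c ↦ isoMean(y⁻(c)g') at the character ψ(αc) (`whittakerMean_eq`). It vanishes as soon
as ψ(αT²γ) ≠ 1 for some γ ∈ F. As F is its own annihilator in 𝔸 (`exists_eq_algebraMap`), such a γ
exists once T² ∉ F; T is taken to be 2 at the infinite places and 1 at the finite ones. -/

set_option linter.unusedSectionVars false

noncomputable section

/-! ### Completions at finite places -/

namespace AdeleTopology
open IsDedekindDomain HeightOneSpectrum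

variable (F : Type*) [Field F] [NumberField F]

/-- Every element of the completion at `v` is close to an element of the field. -/
theorem exists_valued_sub_coe_lt (v : HeightOneSpectrum (𝓞 F)) (x : v.adicCompletion F)
    (γ : (WithZero (Multiplicative ℤ))ˣ) :
    ∃ a : F, Valued.v (x - algebraMap F (v.adicCompletion F) a) < γ.1 := by
  -- The basic open balls are indexed by values of the restricted valuation, so γ is first realized
  -- as the value of an element.
  have hγ : γ.1 ∈ Set.range (Valued.v : Valuation (v.adicCompletion F) _) :=
    v.valuedAdicCompletion_surjective F _
  obtain ⟨y, hy⟩ := hγ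
  have hy0 : y ≠ 0 := by
    rintro rfl
    exact γ.ne_zero (by simpa using hy.symm)
  have hopen : IsOpen {z : v.adicCompletion F | Valued.v (x - z) < γ.1} := by
    have h := (Valued.isOpen_ball (v.adicCompletion F) (Valued.v.restrict y)).preimage
      (continuous_const.sub continuous_id : Continuous fun z : v.adicCompletion F => x - z)
    simpa [Valuation.restrict_lt_iff, hy] using h
  obtain ⟨z, hz, a, rfl⟩ := (denseRange_algebraMap F v).inter_open_nonempty _ hopen
    ⟨x, by simp [zero_lt_iff]⟩
  exact ⟨a, hz⟩

/-- Every integral element of the completion at `v` is close to an algebraic integer. -/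
theorem exists_valued_sub_int_lt (v : HeightOneSpectrum (𝓞 F)) (x : v.adicCompletion F)
    (hx : Valued.v x ≤ 1) (γ : (WithZero (Multiplicative ℤ))ˣ) :
    ∃ a : 𝓞 F, Valued.v (x - algebraMap F (v.adicCompletion F) (algebraMap (𝓞 F) F a)) < γ.1 := by
  -- Precision at most 1 forces a to be v-integral by the ultrametric inequality; a v-integral
  -- element of F is then approximated by an algebraic integer.
  obtain ⟨a, ha⟩ := exists_valued_sub_coe_lt F v x (min γ 1)
  have hmin : ((min γ 1 : (WithZero (Multiplicative ℤ))ˣ) : WithZero (Multiplicative ℤ)) =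
      min γ.1 1 := by
    rcases le_total γ 1 with h | h
    · rw [min_eq_left h, min_eq_left (by exact_mod_cast h)]
    · rw [min_eq_right h, min_eq_right (by exact_mod_cast h)]; rfl
  rw [hmin] at ha
  have ha1 : v.valuation F a ≤ 1 := by
    rw [← valuedAdicCompletion_eq_valuation']
    have : algebraMap F (v.adicCompletion F) a = x - (x - algebraMap F (v.adicCompletion F) a) := by
      ring
    change Valued.v (algebraMap F (v.adicCompletion F) a) ≤ 1
    rw [this]
    exact (Valuation.map_sub _ _ _).trans (max_le hx (ha.trans_le (min_le_right _ _)).le)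
  obtain ⟨r, hr⟩ := v.exists_valuation_sub_lt_of_integer ha1 γ
  refine ⟨r, ?_⟩
  have : x - algebraMap F (v.adicCompletion F) (algebraMap (𝓞 F) F r) =
      (x - algebraMap F (v.adicCompletion F) a) -
        algebraMap F (v.adicCompletion F) (algebraMap (𝓞 F) F r - a) := by
    rw [map_sub]; ring
  rw [this]
  refine (Valuation.map_sub _ _ _).trans_lt (max_lt (ha.trans_le (min_le_left _ _)) ?_)
  exact (valuedAdicCompletion_eq_valuation' v _).trans_lt hr

/-- By density of 𝓞 F in the local integers, the residue field is a quotient of the finite ring 𝓞 F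
/ v. -/
instance finite_residueField (v : HeightOneSpectrum (𝓞 F)) :
    Finite (Valued.ResidueField (v.adicCompletion F)) := by
  let f : 𝓞 F →+* Valued.integer (v.adicCompletion F) :=
    ((algebraMap F (v.adicCompletion F)).comp (algebraMap (𝓞 F) F)).codRestrict _
      (fun r => coe_mem_adicCompletionIntegers v r)
  let g := (IsLocalRing.residue (Valued.integer (v.adicCompletion F))).comp f
  have hg : Function.Surjective g := by
    intro y
    obtain ⟨x, rfl⟩ := IsLocalRing.residue_surjective y
    obtain ⟨r, hr⟩ := exists_valued_sub_int_lt F v x.1 x.2 1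
    refine ⟨r, ?_⟩
    refine (Ideal.Quotient.mk_eq_mk_iff_sub_mem _ _).2 ?_
    rw [← neg_sub, neg_mem_iff]
    rw [IsLocalRing.mem_maximalIdeal, mem_nonunits_iff,
      Valuation.Integer.not_isUnit_iff_valuation_lt_one]
    exact hr
  have hker : v.asIdeal ≤ RingHom.ker g := by
    intro r hr
    rw [RingHom.mem_ker]
    refine Ideal.Quotient.eq_zero_iff_mem.2 ?_
    rw [IsLocalRing.mem_maximalIdeal, mem_nonunits_iff,
      Valuation.Integer.not_isUnit_iff_valuation_lt_one]
    change Valued.v (algebraMap F (v.adicCompletion F) (algebraMap (𝓞 F) F r)) < 1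
    exact (valuedAdicCompletion_eq_valuation' v _).trans_lt ((v.valuation_lt_one_iff_mem r).2 hr)
  have : Finite (𝓞 F ⧸ v.asIdeal) := Ideal.finiteQuotientOfFreeOfNeBot _ v.ne_bot
  exact Finite.of_surjective (Ideal.Quotient.lift v.asIdeal g hker)
    (Ideal.Quotient.lift_surjective_of_surjective _ _ hg)

instance compactSpace_integers (v : HeightOneSpectrum (𝓞 F)) :
    CompactSpace (v.adicCompletionIntegers F) := by
  have h : CompactSpace (Valued.integer (v.adicCompletion F)) := by
    rw [Valued.integer.compactSpace_iff_completeSpace_and_isDiscreteValuationRing_and_finite_residueField]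
    refine ⟨?_, inferInstanceAs (IsDiscreteValuationRing (v.adicCompletionIntegers F)),
      inferInstance⟩
    exact (Valued.isClosed_valuationSubring (v.adicCompletion F)).completeSpace_coe
  exact h

instance secondCountable_adicCompletion (v : HeightOneSpectrum (𝓞 F)) :
    SecondCountableTopology (v.adicCompletion F) := by
  have : Countable F := Finsupp.Countable.of_moduleFinite (R := ℚ)
  have : TopologicalSpace.SeparableSpace (v.adicCompletion F) :=
    ⟨⟨_, Set.countable_range _, denseRange_algebraMap F v⟩⟩
  have : (uniformity (v.adicCompletion F)).IsCountablyGenerated := by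
    let := (Valued.toNormedField (v.adicCompletion F) (WithZero (Multiplicative ℤ)))
    exact EMetric.instIsCountablyGeneratedUniformity
  exact UniformSpace.secondCountable_of_separable _

instance countable_heightOneSpectrum : Countable (HeightOneSpectrum (𝓞 F)) := by
  have : Countable F := Finsupp.Countable.of_moduleFinite (R := ℚ)
  have : Countable (𝓞 F) := (FaithfulSMul.algebraMap_injective (𝓞 F) F).countable
  have : Countable (Ideal (𝓞 F)) := by
    refine Function.Surjective.countable (f := fun s : Finset (𝓞 F) => Ideal.span (s : Set (𝓞 F)))
      fun I => ?_
    exact IsNoetherian.noetherian I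
  exact Function.Injective.countable (f := HeightOneSpectrum.asIdeal)
    fun _ _ h => HeightOneSpectrum.ext h

/-! ### The finite adeles and strong approximation -/

/-- The integral finite adeles. -/
def integralAdeles : Set 𝔸ᶠ[F] := {x | ∀ v, x v ∈ v.adicCompletionIntegers F}

theorem isOpenEmbedding_structureMap :
    Topology.IsOpenEmbedding (RestrictedProduct.structureMap
      (fun v : HeightOneSpectrum (𝓞 F) => v.adicCompletion F)
      (fun v => (v.adicCompletionIntegers F : Set (v.adicCompletion F))) Filter.cofinite) :=
  RestrictedProduct.isOpenEmbedding_structureMap fun _ => Valued.isOpen_valuationSubring _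

theorem range_structureMap : (Set.range (RestrictedProduct.structureMap
      (fun v : HeightOneSpectrum (𝓞 F) => v.adicCompletion F)
      (fun v => (v.adicCompletionIntegers F : Set (v.adicCompletion F))) Filter.cofinite)) =
      integralAdeles F := RestrictedProduct.range_structureMap _ _

theorem isOpen_integralAdeles : IsOpen (integralAdeles F) :=
  range_structureMap F ▸ (isOpenEmbedding_structureMap F).isOpen_range

theorem isCompact_integralAdeles : IsCompact (integralAdeles F) := by
  rw [← range_structureMap F]
  have (v : HeightOneSpectrum (𝓞 F)) :
      CompactSpace ((v.adicCompletionIntegers F : Set (v.adicCompletion F))) :=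
    compactSpace_integers F v
  exact isCompact_range (isOpenEmbedding_structureMap F).continuous

instance secondCountable_integralAdeles : SecondCountableTopology (integralAdeles F) := by
  have h := (isOpenEmbedding_structureMap F).isEmbedding.toHomeomorph
  rw [range_structureMap F] at h
  exact h.symm.secondCountableTopology

instance t2Space_finiteAdeleRing : T2Space 𝔸ᶠ[F] :=
  inferInstanceAs (T2Space (RestrictedProduct (fun v : HeightOneSpectrum (𝓞 F) => v.adicCompletion F)
      (fun v => (v.adicCompletionIntegers F : Set (v.adicCompletion F))) Filter.cofinite))

instance locallyCompact_finiteAdeleRing : LocallyCompactSpace 𝔸ᶠ[F] :=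
  (isCompact_integralAdeles F).locallyCompactSpace_of_mem_nhds_of_addGroup
    ((isOpen_integralAdeles F).mem_nhds (x := 0) fun _ => zero_mem _)

/-- Strong approximation for the ring of integers: every finite adele is the sum of an element of
the field and an integral adele. -/
theorem exists_sub_mem_integralAdeles (x : 𝔸ᶠ[F]) :
    ∃ a : F, x - algebraMap F 𝔸ᶠ[F] a ∈ integralAdeles F := by
  classical
  have hfin : {v | x v ∉ v.adicCompletionIntegers F}.Finite := x.2
  choose b hb0 hb using fun v : HeightOneSpectrum (𝓞 F) =>
    adicCompletion.mul_nonZeroDivisor_mem_adicCompletionIntegers v (x v)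
  -- The product of local denominators at the finitely many bad places makes m x integral
  -- everywhere. It remains to find y ∈ 𝓞 F with m x - y divisible by m at every place; then y / m
  -- is the required element.
  set m : 𝓞 F := ∏ v ∈ hfin.toFinset, b v with hm
  have hm0 : m ≠ 0 := Finset.prod_ne_zero_iff.2 fun v _ => nonZeroDivisors.ne_zero (hb0 v)
  have hmx : ∀ v, x v * algebraMap F (v.adicCompletion F) (algebraMap (𝓞 F) F m) ∈
      v.adicCompletionIntegers F := by
    intro v
    by_cases hv : x v ∈ v.adicCompletionIntegers F
    · exact mul_mem hv (coe_mem_adicCompletionIntegers v m)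
    · rw [hm, ← Finset.mul_prod_erase _ _ (hfin.mem_toFinset.2 hv), map_mul, map_mul, ← mul_assoc]
      exact mul_mem (hb v) (coe_mem_adicCompletionIntegers v _)
  have hsupp : {v : HeightOneSpectrum (𝓞 F) | v.asIdeal ∣ Ideal.span {m}}.Finite :=
    Ideal.finite_factors (by simpa using hm0)
  have hγ (v : HeightOneSpectrum (𝓞 F)) : v.valuation F (algebraMap (𝓞 F) F m) ≠ 0 := by
    simpa using hm0
  choose r hr using fun v : HeightOneSpectrum (𝓞 F) =>
    exists_valued_sub_int_lt F v _ (hmx v) (Units.mk0 _ (hγ v))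
  have hexp (v : HeightOneSpectrum (𝓞 F)) : ∃ n : ℕ, ∀ c ∈ v.asIdeal ^ n,
      v.intValuation c ≤ v.intValuation m := by
    refine ⟨(Associates.mk v.asIdeal).count (Associates.mk (Ideal.span {m})).factors, fun c hc => ?_⟩
    rw [v.intValuation_if_neg hm0]
    exact (v.intValuation_le_pow_iff_mem c _).2 hc
  choose e he using hexp
  -- Chinese remainder theorem at the primes dividing m, with exponents the multiplicities of these
  -- primes in m. At all other places m is a unit and any integral y works.
  obtain ⟨y, hy⟩ := exists_forall_sub_mem_ideal (s := hsupp.toFinset)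
    (fun v : HeightOneSpectrum (𝓞 F) => v.asIdeal) e (fun v _ => v.prime)
    (fun v _ w _ h h' => h (HeightOneSpectrum.ext h')) (fun v => r v.1)
  refine ⟨algebraMap (𝓞 F) F y / algebraMap (𝓞 F) F m, fun v => ?_⟩
  have hmF : algebraMap (𝓞 F) F m ≠ 0 := by simpa using hm0
  have hmv : algebraMap F (v.adicCompletion F) (algebraMap (𝓞 F) F m) ≠ 0 := by simpa using hm0
  have hval (c : 𝓞 F) : Valued.v (algebraMap F (v.adicCompletion F) (algebraMap (𝓞 F) F c)) =
      v.intValuation c :=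
    (valuedAdicCompletion_eq_valuation' v _).trans (v.valuation_of_algebraMap c)
  have key : Valued.v (x v * algebraMap F (v.adicCompletion F) (algebraMap (𝓞 F) F m) -
      algebraMap F (v.adicCompletion F) (algebraMap (𝓞 F) F y)) ≤ v.intValuation m := by
    by_cases hv : v ∈ hsupp.toFinset
    · have h1 : x v * algebraMap F (v.adicCompletion F) (algebraMap (𝓞 F) F m) -
          algebraMap F (v.adicCompletion F) (algebraMap (𝓞 F) F y) =
          (x v * algebraMap F (v.adicCompletion F) (algebraMap (𝓞 F) F m) -
          algebraMap F (v.adicCompletion F) (algebraMap (𝓞 F) F (r v))) -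
          algebraMap F (v.adicCompletion F) (algebraMap (𝓞 F) F (y - r v)) := by
        simp only [map_sub]; ring
      rw [h1]
      refine (Valuation.map_sub _ _ _).trans (max_le ?_ ?_)
      · refine (hr v).le.trans ?_
        simp [valuation_of_algebraMap]
      · rw [hval]
        exact he v _ (hy v hv)
    · have h1 : v.intValuation m = 1 := by
        refine le_antisymm (v.intValuation_le_one m) (not_lt.1 fun h => hv ?_)
        exact hsupp.mem_toFinset.2 ((v.intValuation_lt_one_iff_dvd m).1 h)
      rw [h1]
      exact (Valuation.map_sub _ _ _).trans (max_le (hmx v) (coe_mem_adicCompletionIntegers v y))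
  have h2 : (x - algebraMap F 𝔸ᶠ[F] (algebraMap (𝓞 F) F y / algebraMap (𝓞 F) F m)) v =
      (x v * algebraMap F (v.adicCompletion F) (algebraMap (𝓞 F) F m) -
      algebraMap F (v.adicCompletion F) (algebraMap (𝓞 F) F y)) /
      algebraMap F (v.adicCompletion F) (algebraMap (𝓞 F) F m) := by
    change x v - algebraMap F (v.adicCompletion F) (_ / _) = _
    rw [map_div₀]
    field_simp
  rw [h2, mem_adicCompletionIntegers, map_div₀, hval]
  refine div_le_one_of_le₀ key zero_le

/-- By strong approximation, countably many translates of the second countable open set of integral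
adeles cover the finite adeles. -/
instance secondCountable_finiteAdeleRing : SecondCountableTopology 𝔸ᶠ[F] := by
  have : Countable F := Finsupp.Countable.of_moduleFinite (R := ℚ)
  let U (a : F) : Set 𝔸ᶠ[F] := (fun x => x - algebraMap F 𝔸ᶠ[F] a) ⁻¹' integralAdeles F
  have (a : F) : SecondCountableTopology (U a) := by
    have h : Topology.IsInducing (fun x : U a => (⟨x.1 - algebraMap F 𝔸ᶠ[F] a, x.2⟩ :
        integralAdeles F)) := by
      refine Topology.IsInducing.of_comp (g := Subtype.val) ?_ continuous_subtype_val ?_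
      · exact Continuous.subtype_mk (by fun_prop) _
      · exact (Homeomorph.subRight (algebraMap F 𝔸ᶠ[F] a)).isInducing.comp
          Topology.IsInducing.subtypeVal
    exact h.secondCountableTopology
  refine TopologicalSpace.secondCountableTopology_of_countable_cover (U := U) (fun a => ?_) ?_
  · exact (isOpen_integralAdeles F).preimage (by fun_prop)
  · exact Set.eq_univ_of_forall fun x => Set.mem_iUnion.2 (exists_sub_mem_integralAdeles F x)

/-! ### Infinite places; discreteness and cocompactness of the field -/

instance secondCountable_completion (v : InfinitePlace F) :
    SecondCountableTopology v.Completion := by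
  have : Countable F := Finsupp.Countable.of_moduleFinite (R := ℚ)
  have : Countable (WithAbs v.1) := (WithAbs.equiv v.1).injective.countable
  have : TopologicalSpace.SeparableSpace v.Completion :=
    ⟨⟨_, Set.countable_range _, InfinitePlace.Completion.denseRange_coe v⟩⟩
  exact UniformSpace.secondCountable_of_separable _

instance secondCountable_infiniteAdeleRing : SecondCountableTopology F∞ :=
  inferInstanceAs (SecondCountableTopology (∀ v : InfinitePlace F, v.Completion))

instance t2Space_infiniteAdeleRing : T2Space F∞ :=
  inferInstanceAs (T2Space (∀ v : InfinitePlace F, v.Completion))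

instance t2Space_adeleRing : T2Space 𝔸[F] := inferInstanceAs (T2Space (F∞ × 𝔸ᶠ[F]))

instance secondCountable_adeleRing : SecondCountableTopology 𝔸[F] :=
  inferInstanceAs (SecondCountableTopology (F∞ × 𝔸ᶠ[F]))

instance locallyCompact_adeleRing : LocallyCompactSpace 𝔸[F] :=
  inferInstanceAs (LocallyCompactSpace (F∞ × 𝔸ᶠ[F]))

-- Each coordinate of the isomorphism with the mixed space is an isometry and that space carries the
-- sup norm. This transports lattice estimates to F∞.
open scoped Classical in
theorem norm_apply_le_norm_mixedSpace (z : F∞) (v : InfinitePlace F) :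
    ‖z v‖ ≤ ‖InfiniteAdeleRing.ringEquiv_mixedSpace F z‖ := by
  rw [InfiniteAdeleRing.ringEquiv_mixedSpace_apply]
  by_cases hv : v.IsReal
  · have h := (InfinitePlace.Completion.isometry_extensionEmbeddingOfIsReal hv).norm_map_of_map_zero
      (map_zero _) (z v)
    rw [← h]
    exact (norm_le_pi_norm (fun v : {w : InfinitePlace F // w.IsReal} =>
      InfinitePlace.Completion.extensionEmbeddingOfIsReal v.2 (z v)) ⟨v, hv⟩).trans
      (norm_fst_le (_, _))
  · have hv' := InfinitePlace.not_isReal_iff_isComplex.1 hv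
    have h := (InfinitePlace.Completion.isometry_extensionEmbedding v).norm_map_of_map_zero
      (map_zero _) (z v)
    rw [← h]
    exact (norm_le_pi_norm (fun v : {w : InfinitePlace F // w.IsComplex} =>
      InfinitePlace.Completion.extensionEmbedding v.1 (z v)) ⟨v, hv'⟩).trans
      (norm_snd_le (_, _))

/-- The integers form a full lattice in the mixed space, so subtracting the floor in a lattice basis
leaves a fractional part bounded by the sum of the norms of the basis vectors. -/
theorem exists_sub_int_bounded : ∃ B : ℝ, ∀ x : F∞, ∃ r : 𝓞 F, ∀ v : InfinitePlace F,
    ‖(x - algebraMap F F∞ (algebraMap (𝓞 F) F r)) v‖ ≤ B := by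
  classical
  refine ⟨∑ i, ‖mixedEmbedding.latticeBasis F i‖, fun x => ?_⟩
  set y := InfiniteAdeleRing.ringEquiv_mixedSpace F x with hy
  have hfl := (ZSpan.floor (mixedEmbedding.latticeBasis F) y).2
  rw [mixedEmbedding.mem_span_latticeBasis] at hfl
  obtain ⟨r, hr⟩ := hfl
  refine ⟨r, fun v => (norm_apply_le_norm_mixedSpace F _ v).trans ?_⟩
  rw [map_sub, ← InfiniteAdeleRing.mixedEmbedding_eq_algebraMap_comp]
  have : mixedEmbedding F (algebraMap (𝓞 F) F r) =
      ZSpan.floor (mixedEmbedding.latticeBasis F) y := by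
    rw [← hr]; rfl
  rw [this, ← hy, ← ZSpan.fract_apply]
  exact ZSpan.norm_fract_le _ _

theorem isCompact_infinite_box (B : ℝ) : IsCompact {x : F∞ | ∀ v, ‖x v‖ ≤ B} := by
  have h : {x : F∞ | ∀ v, ‖x v‖ ≤ B} =
      Set.univ.pi fun v : InfinitePlace F => (Metric.closedBall (0 : v.Completion) B) := by
    ext x
    exact ⟨fun h v _ => by simpa using h v, fun h v => by simpa using h v trivial⟩
  rw [h]
  refine isCompact_univ_pi fun v => ?_
  have h := (InfinitePlace.Completion.isometry_extensionEmbedding v)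
  have h2 := h.isClosedEmbedding.isCompact_preimage (isCompact_closedBall (0 : ℂ) B)
  have h3 : InfinitePlace.Completion.extensionEmbedding v ⁻¹' Metric.closedBall (0 : ℂ) B =
      Metric.closedBall 0 B := by
    ext x
    simp [h.norm_map_of_map_zero (map_zero _) x]
  rwa [h3] at h2

/-- The quotient of the adeles by the field is compact. -/
theorem exists_isCompact_add_field :
    ∃ C : Set 𝔸[F], IsCompact C ∧ ∀ x, ∃ a : F, x - algebraMap F 𝔸[F] a ∈ C := by
  obtain ⟨B, hB⟩ := exists_sub_int_bounded F
  refine ⟨{x : F∞ | ∀ v, ‖x v‖ ≤ B} ×ˢ integralAdeles F,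
    (isCompact_infinite_box F B).prod (isCompact_integralAdeles F), fun x => ?_⟩
  -- The finite part is made integral first; the later correction of the infinite part is by an
  -- element of 𝓞 F and so does not spoil integrality.
  obtain ⟨a, ha⟩ := exists_sub_mem_integralAdeles F x.2
  obtain ⟨r, hr⟩ := hB (x.1 - algebraMap F F∞ a)
  refine ⟨a + algebraMap (𝓞 F) F r, fun v => ?_, fun v => ?_⟩
  · have h := hr v
    rw [sub_sub, ← map_add] at h
    exact h
  · have h := sub_mem (ha v) (coe_mem_adicCompletionIntegers v r)
    have e : x.2 v - algebraMap F (v.adicCompletion F) (a + algebraMap (𝓞 F) F r) =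
        x.2 v - algebraMap F (v.adicCompletion F) a -
          algebraMap F (v.adicCompletion F) (algebraMap (𝓞 F) F r) := by
      rw [map_add, sub_sub]
    change x.2 v - algebraMap F (v.adicCompletion F) (a + algebraMap (𝓞 F) F r) ∈ _
    rw [e]
    exact h

/-- The field is discrete in the adeles. -/
theorem exists_nhds_field_discrete :
    ∃ U : Set 𝔸[F], IsOpen U ∧ 0 ∈ U ∧ ∀ a : F, algebraMap F 𝔸[F] a ∈ U → a = 0 := by
  refine ⟨{x : F∞ | ∀ v, ‖x v‖ < 1} ×ˢ integralAdeles F, ?_, ?_, ?_⟩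
  · refine IsOpen.prod ?_ (isOpen_integralAdeles F)
    simp only [Set.ofPred_forall]
    refine isOpen_iInter_of_finite fun v => ?_
    exact isOpen_lt (continuous_norm.comp (continuous_apply v)) continuous_const
  · exact ⟨fun v => (norm_zero (E := v.Completion)).trans_lt one_pos, fun v => zero_mem _⟩
  -- An element of F in this neighbourhood is an algebraic integer with all archimedean absolute
  -- values below 1, which is impossible unless it is zero.
  · rintro a ⟨h1, h2⟩
    have h3 : ∀ v : HeightOneSpectrum (𝓞 F), v.valuation F a ≤ 1 := fun v => by
      rw [← valuedAdicCompletion_eq_valuation']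
      exact h2 v
    obtain ⟨r, rfl⟩ := mem_integers_of_valuation_le_one F a h3
    by_contra hr
    have hr' : r ≠ 0 := by rintro rfl; exact hr (map_zero _)
    obtain ⟨w⟩ : Nonempty (InfinitePlace F) := inferInstance
    have h4 : ∀ v : InfinitePlace F, v (algebraMap (𝓞 F) F r) < 1 := fun v => by
      have := h1 v
      rwa [AdeleRing.algebraMap_fst_apply, InfinitePlace.Completion.norm_coe] at this
    exact absurd (InfinitePlace.one_le_of_lt_one (w := w) hr' fun v _ => h4 v) (not_le.2 (h4 w))

/-- The balls {|y| < |z|} form a chain that covers the completion, as some value exceeds 1.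
Compactness would make one of them everything, but z is not in its own ball. -/
theorem not_isCompact_univ_adicCompletion (v : HeightOneSpectrum (𝓞 F)) :
    ¬ IsCompact (Set.univ : Set (v.adicCompletion F)) := by
  intro h
  have hcov : (Set.univ : Set (v.adicCompletion F)) ⊆
      ⋃ z, {y | Valued.v.restrict y < Valued.v.restrict z} := by
    intro y _
    obtain ⟨p, hp⟩ := v.valuedAdicCompletion_surjective F (WithZero.exp (1 : ℤ))
    have hp1 : 1 < Valued.v p := by rw [hp, ← WithZero.exp_zero]; exact WithZero.exp_lt_exp.2 one_pos
    by_cases hy : y = 0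
    · refine Set.mem_iUnion.2 ⟨1, ?_⟩
      simp [hy]
    · refine Set.mem_iUnion.2 ⟨p * y, ?_⟩
      rw [Set.mem_ofPred_eq, Valuation.restrict_lt_iff, map_mul]
      have hy0 : 0 < Valued.v y := by rw [zero_lt_iff]; simpa using hy
      exact lt_mul_of_one_lt_left hy0 hp1
  have hdir : Directed (· ⊆ ·) fun z : v.adicCompletion F =>
      {y | Valued.v.restrict y < Valued.v.restrict z} := by
    intro z w
    rcases le_total (Valued.v.restrict z) (Valued.v.restrict w) with h | h
    · exact ⟨w, fun y hy => lt_of_lt_of_le hy h, fun y hy => hy⟩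
    · exact ⟨z, fun y hy => hy, fun y hy => lt_of_lt_of_le hy h⟩
  obtain ⟨z, hz⟩ := h.elim_directed_cover _ (fun z => Valued.isOpen_ball _ _) hcov hdir
  exact lt_irrefl (Valued.v.restrict z) (hz (Set.mem_univ z))

theorem not_isCompact_univ_completion (v : InfinitePlace F) :
    ¬ IsCompact (Set.univ : Set v.Completion) := by
  intro h
  obtain ⟨B, hB⟩ := h.isBounded.exists_norm_le
  obtain ⟨n, hn⟩ := exists_nat_gt B
  have h1 := hB ((n : F) : v.Completion) (Set.mem_univ _)
  rw [InfinitePlace.Completion.norm_coe] at h1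
  simp at h1
  linarith

/-- A nonzero principal ideal of the adele ring is not contained in a compact set. -/
theorem not_mul_subset_compact {x : 𝔸[F]} (hx : x ≠ 0) {C : Set 𝔸[F]} (hC : IsCompact C) :
    ∃ y : F, x * algebraMap F 𝔸[F] y ∉ C := by
  by_contra! h
  have h1 : (∃ v, x.1 v ≠ 0) ∨ ∃ v, x.2 v ≠ 0 := by
    by_contra! h'
    exact hx (Prod.ext (funext h'.1) (FiniteAdeleRing.ext _ h'.2))
  -- At a place where x is nonzero, the map z ↦ x_v⁻¹ z_v sends C to a compact, hence closed, set
  -- that contains the dense image of F. The whole completion would then be compact.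
  rcases h1 with ⟨v, hv⟩ | ⟨v, hv⟩
  · have hc : Continuous fun z : 𝔸[F] => (x.1 v)⁻¹ * z.1 v :=
      continuous_const.mul ((continuous_apply v).comp continuous_fst)
    have h2 := hC.image hc
    apply not_isCompact_univ_completion F v
    convert h2
    symm
    refine Set.eq_univ_of_univ_subset ?_
    have hd := InfinitePlace.Completion.denseRange_coe v
    rw [← hd.closure_range]
    refine closure_minimal ?_ h2.isClosed
    rintro _ ⟨y, rfl⟩
    exact ⟨_, h ((WithAbs.equiv v.1) y), inv_mul_cancel_left₀ hv _⟩
  · have hc : Continuous fun z : 𝔸[F] => (x.2 v)⁻¹ * z.2 v :=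
      continuous_const.mul ((RestrictedProduct.continuous_eval v).comp continuous_snd)
    have h2 := hC.image hc
    apply not_isCompact_univ_adicCompletion F v
    convert h2
    symm
    refine Set.eq_univ_of_univ_subset ?_
    have hd := denseRange_algebraMap F v
    rw [← hd.closure_range]
    refine closure_minimal ?_ h2.isClosed
    rintro _ ⟨y, rfl⟩
    exact ⟨_, h y, inv_mul_cancel_left₀ hv _⟩

end AdeleTopology

/-! ### Fields that are discrete and cocompact in a topological ring -/

/-- `F` is a discrete and cocompact subfield of the topological ring `A`, and no nonzero multiple of
`F` in `A` is relatively compact. -/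
structure IsGlobalField (F A : Type*) [Field F] [CommRing A] [TopologicalSpace A] [Algebra F A] :
    Prop where
  discrete : ∃ U : Set A, IsOpen U ∧ 0 ∈ U ∧ ∀ a : F, algebraMap F A a ∈ U → a = 0
  cocompact : ∃ C : Set A, IsCompact C ∧ ∀ x, ∃ a : F, x - algebraMap F A a ∈ C
  not_compact : ∀ x : A, x ≠ 0 → ∀ C : Set A, IsCompact C → ∃ y : F, x * algebraMap F A y ∉ C

theorem isGlobalField_adeleRing (F : Type*) [Field F] [NumberField F] : IsGlobalField F 𝔸[F] :=
  ⟨AdeleTopology.exists_nhds_field_discrete F, AdeleTopology.exists_isCompact_add_field F,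
    fun _ hx _ hC => AdeleTopology.not_mul_subset_compact F hx hC⟩

/-- The circle has no small subgroups. -/
theorem Circle.eq_one_of_forall_pow_near_one (z : Circle)
    (h : ∀ n : ℕ, ‖((z ^ n : Circle) : ℂ) - 1‖ ≤ 1 / 2) : z = 1 := by
  -- Since w² - 1 = (w - 1)(w + 1) and |w + 1| ≥ 3/2 whenever |w - 1| ≤ 1/2, each squaring
  -- multiplies the distance to 1 by at least 3/2.
  have key : ∀ k : ℕ, (3 / 2 : ℝ) ^ k * ‖(z : ℂ) - 1‖ ≤ ‖((z ^ 2 ^ k : Circle) : ℂ) - 1‖ := by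
    intro k
    induction k with
    | zero => simp
    | succ k ih =>
      set w : ℂ := ((z ^ 2 ^ k : Circle) : ℂ) with hw
      have h1 : ((z ^ 2 ^ (k + 1) : Circle) : ℂ) - 1 = (w - 1) * (w + 1) := by
        rw [pow_succ 2 k, pow_mul, Circle.coe_pow, ← hw]; ring
      have h2 : (3 / 2 : ℝ) ≤ ‖w + 1‖ := by
        have h3 := h (2 ^ k)
        rw [← hw] at h3
        have h4 : ‖(2 : ℂ)‖ ≤ ‖w + 1‖ + ‖w - 1‖ := by
          have : (2 : ℂ) = (w + 1) - (w - 1) := by ring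
          rw [this]; exact norm_sub_le _ _
        rw [Complex.norm_ofNat] at h4
        linarith
      rw [h1, norm_mul, pow_succ, mul_right_comm]
      exact mul_le_mul ih h2 (by norm_num) (norm_nonneg _)
  by_contra hz
  have hpos : 0 < ‖(z : ℂ) - 1‖ := by
    rw [norm_pos_iff, sub_ne_zero]
    exact fun e => hz (Circle.ext e)
  obtain ⟨k, hk⟩ := pow_unbounded_of_one_lt (1 / ‖(z : ℂ) - 1‖) (by norm_num : (1 : ℝ) < 3 / 2)
  have h5 := (key k).trans (h (2 ^ k))
  rw [div_lt_iff₀ hpos] at hk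
  linarith

namespace IsGlobalField

variable {F A : Type*} [Field F] [CommRing A] [TopologicalSpace A] [IsTopologicalRing A]
  [Algebra F A]

/-- A compact set of `A` is covered by finitely many translates of any neighbourhood of zero. -/
theorem exists_finite_cover {C Ω : Set A} (hC : IsCompact C) (hΩ : IsOpen Ω) (h0 : (0 : A) ∈ Ω) :
    ∃ t : Finset A, ∀ x ∈ C, ∃ c ∈ t, x - c ∈ Ω := by
  obtain ⟨t, ht⟩ := hC.elim_finite_subcover (fun c : A => (fun x => x - c) ⁻¹' Ω)
    (fun c => hΩ.preimage (by fun_prop)) fun x _ => Set.mem_iUnion.2 ⟨x, by simpa using h0⟩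
  refine ⟨t, fun x hx => ?_⟩
  simpa using ht hx

theorem exists_open_sub_subset {Ω : Set A} (hΩ : IsOpen Ω) (h0 : (0 : A) ∈ Ω) :
    ∃ Ω' : Set A, IsOpen Ω' ∧ 0 ∈ Ω' ∧ ∀ x ∈ Ω', ∀ y ∈ Ω', x - y ∈ Ω := by
  have h : (fun p : A × A => p.1 - p.2) ⁻¹' Ω ∈ nhds ((0, 0) : A × A) :=
    (hΩ.preimage (by fun_prop)).mem_nhds (by simpa using h0)
  rw [mem_nhds_prod_iff'] at h
  obtain ⟨u, v, hu, hu0, hv, hv0, huv⟩ := h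
  exact ⟨u ∩ v, hu.inter hv, ⟨hu0, hv0⟩, fun x hx y hy => huv (Set.mk_mem_prod hx.1 hy.2)⟩

theorem exists_open_mul_subset {C W : Set A} (hC : IsCompact C) (hW : IsOpen W)
    (h0 : (0 : A) ∈ W) : ∃ Ω : Set A, IsOpen Ω ∧ 0 ∈ Ω ∧ ∀ x ∈ Ω, ∀ c ∈ C, x * c ∈ W := by
  obtain ⟨u, v, hu, hv, h0u, hCv, huv⟩ := generalized_tube_lemma (isCompact_singleton (x := (0 : A)))
    hC (hW.preimage (continuous_mul : Continuous fun p : A × A => p.1 * p.2)) (by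
      rintro ⟨x, c⟩ ⟨hx, -⟩
      simp only [Set.mem_singleton_iff] at hx
      simpa [hx] using h0)
  exact ⟨u, hu, h0u rfl, fun x hx c hc => huv (Set.mk_mem_prod hx (hCv hc))⟩

/-- Minkowski's theorem for the ideal `x A`, by the pigeonhole principle. -/
theorem exists_ne_zero_sub_mul_mem [LocallyCompactSpace A] (h : IsGlobalField F A) {x : A}
    (hx : x ≠ 0) {Ω : Set A} (hΩ : IsOpen Ω) (h0 : (0 : A) ∈ Ω) :
    ∃ l : F, l ≠ 0 ∧ ∃ y : A, algebraMap F A l - x * y ∈ Ω := by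
  by_contra! hcon
  obtain ⟨C, hC, hCF⟩ := h.cocompact
  obtain ⟨K, hK, hK0⟩ := exists_compact_mem_nhds (0 : A)
  obtain ⟨Ω', hΩ', h0', hsub⟩ := exists_open_sub_subset (hΩ.inter isOpen_interior)
    ⟨h0, mem_interior_iff_mem_nhds.2 hK0⟩
  obtain ⟨t, ht⟩ := exists_finite_cover hC hΩ' h0'
  -- Here a y ∈ F moves x y into the compact set C and c y labels the small box that contains the
  -- remainder. Two y in one box with different a y would produce the desired l.
  choose a ha using fun y : F => hCF (x * algebraMap F A y)
  choose c hct hc using fun y : F => ht _ (ha y)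
  have hsame : ∀ y y' : F, c y = c y' → x * algebraMap F A y - x * algebraMap F A y' ∈ K := by
    intro y y' hyy
    have h1 := hsub _ (hc y) _ (hc y')
    have h1' := hsub _ (hc y') _ (hc y)
    rw [hyy] at h1 h1'
    have h2 : a y = a y' := by
      by_contra hne
      refine hcon (a y' - a y) (sub_ne_zero.2 (Ne.symm hne)) (algebraMap F A y' - algebraMap F A y) ?_
      convert h1.1 using 1
      rw [map_sub]; ring
    rw [h2] at h1
    refine interior_subset ?_
    convert h1.2 using 1
    ring
  classical
  -- Elements y of one box now share the same a y, so the x y lie in a single translate of K.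
  -- Finitely many such translates would contain all of x F, contrary to `not_compact`.
  let rep : A → A := fun e => if he : ∃ y : F, c y = e then x * algebraMap F A he.choose else 0
  have hcomp : IsCompact (⋃ e ∈ t, (fun z => rep e + z) '' K) :=
    t.finite_toSet.isCompact_biUnion fun e _ => hK.image (by fun_prop)
  obtain ⟨y, hy⟩ := h.not_compact x hx _ hcomp
  refine hy (Set.mem_biUnion (hct y) ?_)
  have hex : ∃ y' : F, c y' = c y := ⟨y, rfl⟩
  refine ⟨x * algebraMap F A y - x * algebraMap F A hex.choose, hsame _ _ hex.choose_spec.symm, ?_⟩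
  simp only [rep, dif_pos hex]
  ring

variable [LocallyCompactSpace A]

/-- Strong approximation: a continuous character that is trivial on `F` and on a nonzero ideal is
trivial. -/
theorem eq_zero_of_forall_mul (h : IsGlobalField F A) (ψ : AddChar A Circle) (hψ : Continuous ψ)
    (hF : ∀ a : F, ψ (algebraMap F A a) = 1) (hne : ψ ≠ 1) {x : A} (hx : ∀ y, ψ (x * y) = 1) :
    x = 0 := by
  by_contra hx0
  apply hne
  ext1 z
  obtain ⟨C, hC, hCF⟩ := h.cocompact
  by_contra hz
  have hz1 : ψ z ≠ 1 := hz
  have hW : IsOpen (ψ ⁻¹' {ψ z}ᶜ) := isOpen_compl_singleton.preimage hψ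
  -- On products of Ω with C the character avoids the value ψ z; the argument exhibits such a
  -- product at which it equals ψ z.
  obtain ⟨Ω, hΩ, h0, hmul⟩ := exists_open_mul_subset hC hW (by simpa using Ne.symm hz1)
  obtain ⟨l, hl, y, hy⟩ := h.exists_ne_zero_sub_mul_mem hx0 hΩ h0
  obtain ⟨a, ha⟩ := hCF (algebraMap F A l⁻¹ * z)
  have h1 := hmul _ hy _ ha
  apply h1
  have hll : algebraMap F A l * algebraMap F A l⁻¹ = 1 := by
    rw [← map_mul, mul_inv_cancel₀ hl, map_one]
  -- Write z = l (l⁻¹ z), replace l by l - x y and l⁻¹ z by its representative in C. The discarded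
  -- terms lie in F and in x A, where ψ is trivial.
  have h2 : z = (algebraMap F A l - x * y) * (algebraMap F A l⁻¹ * z - algebraMap F A a) +
      (algebraMap F A (l * a) + x * (y * (algebraMap F A l⁻¹ * z - algebraMap F A a))) := by
    rw [map_mul]
    linear_combination (-z) * hll
  change ψ _ = ψ z
  conv_rhs => rw [h2]
  rw [AddChar.map_add_eq_mul ψ _ (_ + _), AddChar.map_add_eq_mul ψ (algebraMap F A (l * a)), hF, hx,
    mul_one, mul_one]

/-- The field is its own annihilator under the pairing defined by a nontrivial character of
`A / F`. -/
theorem exists_eq_algebraMap [Infinite F] (h : IsGlobalField F A) (ψ : AddChar A Circle)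
    (hψ : Continuous ψ) (hF : ∀ a : F, ψ (algebraMap F A a) = 1) (hne : ψ ≠ 1) {x : A}
    (hx : ∀ a : F, ψ (x * algebraMap F A a) = 1) : ∃ q : F, algebraMap F A q = x := by
  obtain ⟨C, hC, hCF⟩ := h.cocompact
  have hW : IsOpen {y : A | ‖((ψ y : Circle) : ℂ) - 1‖ < 1 / 2} := by
    refine isOpen_lt ?_ continuous_const
    exact (continuous_norm.comp ((continuous_induced_dom.comp hψ).sub continuous_const))
  obtain ⟨Ω, hΩ, h0, hmul⟩ := exists_open_mul_subset hC hW (by simp)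
  -- The annihilator of F is discrete: for small v in it, every power of ψ(v y) is ψ(v c) for some c
  -- ∈ C, hence near 1. As the circle has no small subgroups, ψ is trivial on v A, so v = 0.
  have hdisc : ∀ v ∈ Ω, (∀ a : F, ψ (v * algebraMap F A a) = 1) → v = 0 := by
    intro v hv hvF
    refine h.eq_zero_of_forall_mul ψ hψ hF hne fun y => ?_
    refine Circle.eq_one_of_forall_pow_near_one _ fun n => ?_
    obtain ⟨a, ha⟩ := hCF (n * y)
    have h1 := hmul v hv _ ha
    have h2 : ψ (v * y) ^ n = ψ (v * (n * y - algebraMap F A a)) := by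
      rw [mul_sub, AddChar.map_sub_eq_div, hvF, div_one, ← AddChar.map_nsmul_eq_pow, nsmul_eq_mul]
      congr 1; ring
    rw [h2]
    exact le_of_lt h1
  obtain ⟨Ω', hΩ', h0', hsub⟩ := exists_open_sub_subset hΩ h0
  obtain ⟨t, ht⟩ := exists_finite_cover hC hΩ' h0'
  choose q hq using fun a : F => hCF (x * algebraMap F A a)
  choose c hct hc using fun a : F => ht _ (hq a)
  -- Pigeonhole on the infinite field F: the difference x(a - a') - (q a - q a') is a small element
  -- of the annihilator, hence zero, and x is a quotient of elements of F.
  obtain ⟨a, a', hne', heq⟩ := Finite.exists_ne_map_eq_of_infinite fun a : F => (⟨c a, hct a⟩ : t)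
  have heq' : c a = c a' := congrArg Subtype.val heq
  have h1 := hsub _ (hc a) _ (hc a')
  rw [heq'] at h1
  have h2 := hdisc _ h1 fun b => by
    have e : (x * algebraMap F A a - algebraMap F A (q a) - c a' -
        (x * algebraMap F A a' - algebraMap F A (q a') - c a')) * algebraMap F A b =
        x * algebraMap F A ((a - a') * b) + algebraMap F A ((q a' - q a) * b) := by
      simp only [map_mul, map_sub]; ring
    rw [e, AddChar.map_add_eq_mul, hx, hF, one_mul]
  have haa : a - a' ≠ 0 := sub_ne_zero.2 hne'
  refine ⟨(q a - q a') / (a - a'), ?_⟩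
  have h3 : algebraMap F A (a - a') * algebraMap F A (a - a')⁻¹ = 1 := by
    rw [← map_mul, mul_inv_cancel₀ haa, map_one]
  rw [div_eq_mul_inv, map_mul]
  simp only [map_sub] at h3 ⊢
  linear_combination (-(algebraMap F A (a - a')⁻¹)) * h2 + x * h3

end IsGlobalField

/-! ### Invariant means of periodic functions -/

/-- A compactly supported probability measure on `M` whose integral is translation invariant on
continuous functions with period group `Γ`. -/
structure IsPeriodMeasure {M : Type*} [AddCommGroup M] [TopologicalSpace M] [MeasurableSpace M]
    (Γ : AddSubgroup M) (ν : Measure M) : Prop where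
  isProb : IsProbabilityMeasure ν
  compact : ∃ C, IsCompact C ∧ ν Cᶜ = 0
  integral_add : ∀ k : M → ℂ, Continuous k → (∀ x, ∀ γ ∈ Γ, k (x + γ) = k x) →
    ∀ b, ∫ x, k (x + b) ∂ν = ∫ x, k x ∂ν

section General

variable {M : Type*} [TopologicalSpace M] [MeasurableSpace M] [BorelSpace M]

theorem Continuous.integrable_of_compact_support {ν : Measure M} [IsFiniteMeasure ν]
    {C : Set M} (hC : IsCompact C) (hν : ν Cᶜ = 0) {k : M → ℂ} (hk : Continuous k) :
    Integrable k ν := by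
  obtain ⟨B, hB⟩ := (hC.image hk).isBounded.exists_norm_le
  refine Integrable.of_bound hk.aestronglyMeasurable B ?_
  rw [ae_iff]
  exact measure_mono_null (fun x hx hxC => hx (hB _ ⟨x, hxC, rfl⟩)) hν

theorem continuous_integral_of_compact_support {ν : Measure M} [IsFiniteMeasure ν]
    {C : Set M} (hC : IsCompact C) (hν : ν Cᶜ = 0) {X : Type*} [TopologicalSpace X]
    [FirstCountableTopology X] [LocallyCompactSpace X] {k : X → M → ℂ}
    (hk : Continuous (Function.uncurry k)) : Continuous fun x => ∫ y, k x y ∂ν := by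
  have h := continuous_parametric_integral_of_continuous (μ := ν) hk hC
  have hr : ν.restrict C = ν := Measure.restrict_eq_self_of_ae_mem
    (measure_mono_null (fun x hx hxC => hx hxC) hν)
  rwa [hr] at h

theorem integral_swap_of_compact_support {M' : Type*} [TopologicalSpace M'] [MeasurableSpace M']
    [BorelSpace M'] [SecondCountableTopology M] [SecondCountableTopology M']
    {ν : Measure M} [IsFiniteMeasure ν] {C : Set M} (hC : IsCompact C) (hν : ν Cᶜ = 0)
    {ν' : Measure M'} [IsFiniteMeasure ν'] {C' : Set M'} (hC' : IsCompact C') (hν' : ν' C'ᶜ = 0)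
    {k : M → M' → ℂ} (hk : Continuous (Function.uncurry k)) :
    ∫ x, ∫ y, k x y ∂ν' ∂ν = ∫ y, ∫ x, k x y ∂ν ∂ν' := by
  refine integral_integral_swap (hk.integrable_of_compact_support (hC.prod hC') ?_)
  rw [Set.compl_prod_eq_union]
  simp [Measure.prod_prod, hν, hν']

end General

namespace IsPeriodMeasure

variable {M : Type*} [AddCommGroup M] [TopologicalSpace M] [IsTopologicalAddGroup M]
  [MeasurableSpace M] [BorelSpace M] {Γ : AddSubgroup M} {ν : Measure M}
  {M' : Type*} [AddCommGroup M'] [TopologicalSpace M'] [IsTopologicalAddGroup M']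
  [MeasurableSpace M'] [BorelSpace M'] {Γ' : AddSubgroup M'} {ν' : Measure M'}

theorem integrable (h : IsPeriodMeasure Γ ν) {k : M → ℂ} (hk : Continuous k) :
    Integrable k ν := by
  have := h.isProb
  obtain ⟨C, hC, hν⟩ := h.compact
  exact hk.integrable_of_compact_support hC hν

theorem continuous_integral (h : IsPeriodMeasure Γ ν) {X : Type*} [TopologicalSpace X]
    [FirstCountableTopology X] [LocallyCompactSpace X] {k : X → M → ℂ}
    (hk : Continuous (Function.uncurry k)) : Continuous fun x => ∫ y, k x y ∂ν := by
  have := h.isProb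
  obtain ⟨C, hC, hν⟩ := h.compact
  exact continuous_integral_of_compact_support hC hν hk

theorem integral_swap [SecondCountableTopology M] [SecondCountableTopology M']
    (h : IsPeriodMeasure Γ ν) (h' : IsPeriodMeasure Γ' ν') {k : M → M' → ℂ}
    (hk : Continuous (Function.uncurry k)) :
    ∫ x, ∫ y, k x y ∂ν' ∂ν = ∫ y, ∫ x, k x y ∂ν ∂ν' := by
  have := h.isProb
  have := h'.isProb
  obtain ⟨C, hC, hν⟩ := h.compact
  obtain ⟨C', hC', hν'⟩ := h'.compact
  exact integral_swap_of_compact_support hC hν hC' hν' hk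

theorem integral_const (h : IsPeriodMeasure Γ ν) (c : ℂ) : ∫ _, c ∂ν = c := by
  have := h.isProb
  simp

/-- The mean is invariant under surjective endomorphisms that preserve the periods. -/
theorem integral_comp [SecondCountableTopology M] (h : IsPeriodMeasure Γ ν) (σ : M →+ M)
    (hσ : Continuous σ) (hsurj : Function.Surjective σ) (hΓ : ∀ γ ∈ Γ, σ γ ∈ Γ) {k : M → ℂ}
    (hk : Continuous k) (hper : ∀ x, ∀ γ ∈ Γ, k (x + γ) = k x) :
    ∫ x, k (σ x) ∂ν = ∫ x, k x ∂ν := by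
  have h1 : ∀ r, ∫ x, k (σ x + r) ∂ν = ∫ x, k (σ x) ∂ν := by
    intro r
    obtain ⟨r', rfl⟩ := hsurj r
    simp_rw [← map_add]
    exact h.integral_add (fun x => k (σ x)) (hk.comp hσ)
      (fun x γ hγ => by rw [map_add, hper _ _ (hΓ γ hγ)]) r'
  -- Average over an extra translate r, which changes nothing by surjectivity of σ; after exchanging
  -- the integrals the inner mean over r is that of k.
  calc ∫ x, k (σ x) ∂ν = ∫ r, ∫ x, k (σ x + r) ∂ν ∂ν := by
        simp_rw [h1, h.integral_const]
    _ = ∫ x, ∫ r, k (σ x + r) ∂ν ∂ν :=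
        h.integral_swap h (k := fun r x => k (σ x + r)) (by unfold Function.uncurry; fun_prop)
    _ = ∫ _, ∫ r, k r ∂ν ∂ν := by
        congr 1; funext x
        simp_rw [add_comm (σ x)]
        exact h.integral_add k hk hper (σ x)
    _ = ∫ x, k x ∂ν := h.integral_const _

/-- The product of two period measures. -/
theorem prod [SecondCountableTopology M] [SecondCountableTopology M']
    [LocallyCompactSpace M] [LocallyCompactSpace M']
    (h : IsPeriodMeasure Γ ν) (h' : IsPeriodMeasure Γ' ν') :
    IsPeriodMeasure (Γ.prod Γ') (ν.prod ν') := by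
  have := h.isProb
  have := h'.isProb
  obtain ⟨C, hC, hν⟩ := h.compact
  obtain ⟨C', hC', hν'⟩ := h'.compact
  have hnull : (ν.prod ν') (C ×ˢ C')ᶜ = 0 := by
    rw [Set.compl_prod_eq_union]
    simp [Measure.prod_prod, hν, hν']
  refine ⟨inferInstance, ⟨C ×ˢ C', hC.prod hC', hnull⟩, fun k hk hper b => ?_⟩
  rw [integral_prod _ (hk.integrable_of_compact_support (hC.prod hC') hnull), integral_prod _
    (Continuous.integrable_of_compact_support (hC.prod hC') hnull (by fun_prop))]
  have h1 : ∀ x, ∫ y, k ((x, y) + b) ∂ν' = ∫ y, k (x + b.1, y) ∂ν' := fun x =>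
    h'.integral_add (fun y => k (x + b.1, y)) (by fun_prop) (fun y γ hγ => by
      have := hper (x + b.1, y) (0, γ) ⟨Γ.zero_mem, hγ⟩
      simpa using this) b.2
  simp_rw [h1]
  refine h.integral_add (fun x => ∫ y, k (x, y) ∂ν') ?_ (fun x γ hγ => ?_) b.1
  · exact h'.continuous_integral (k := fun x y => k (x, y)) (by simpa [Function.uncurry_def])
  · congr 1; funext y
    have := hper (x, y) (γ, 0) ⟨hγ, Γ'.zero_mem⟩
    simpa using this

/-- Transport of a period measure along an isomorphism of topological groups. -/
theorem map [T2Space M'] (h : IsPeriodMeasure Γ ν) (e : M ≃+ M') (he : Continuous e)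
    (hΓ : ∀ γ ∈ Γ, e γ ∈ Γ') : IsPeriodMeasure Γ' (ν.map e) := by
  have := h.isProb
  obtain ⟨C, hC, hν⟩ := h.compact
  refine ⟨Measure.isProbabilityMeasure_map he.aemeasurable, ⟨e '' C, hC.image he, ?_⟩, ?_⟩
  · rw [Measure.map_apply he.measurable (hC.image he).measurableSet.compl]
    exact measure_mono_null (fun x hx hxC => hx ⟨x, hxC, rfl⟩) hν
  · intro k hk hper b
    rw [integral_map he.aemeasurable (Continuous.aestronglyMeasurable (by fun_prop)),
      integral_map he.aemeasurable hk.aestronglyMeasurable]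
    obtain ⟨b', rfl⟩ := e.surjective b
    simp_rw [← map_add]
    exact h.integral_add (fun x => k (e x)) (by fun_prop)
      (fun x γ hγ => by rw [map_add, hper _ _ (hΓ γ hγ)]) b'

/-- A nonnegative continuous periodic function with zero mean is zero. -/
theorem eq_zero_of_integral_eq_zero (h : IsPeriodMeasure Γ ν)
    (hcpt : ∃ C : Set M, IsCompact C ∧ ∀ x, ∃ γ ∈ Γ, x - γ ∈ C)
    {k : M → ℝ} (hk : Continuous k) (hper : ∀ x, ∀ γ ∈ Γ, k (x + γ) = k x) (hpos : ∀ x, 0 ≤ k x)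
    (h0 : ∫ x, (k x : ℂ) ∂ν = 0) (x₀ : M) : k x₀ = 0 := by
  have := h.isProb
  by_contra hx₀
  have hx : 0 < k x₀ := lt_of_le_of_ne (hpos _) (Ne.symm hx₀)
  obtain ⟨C, hC, hCΓ⟩ := hcpt
  -- Finitely many translates of the set where k exceeds k x₀ / 2 cover a compact set of
  -- representatives. The sum of these translates of k has mean zero but is at least k x₀ / 2
  -- everywhere.
  obtain ⟨t, ht⟩ := hC.elim_finite_subcover (fun b : M => {x | k x₀ / 2 < k (x + b)})
    (fun b => isOpen_lt continuous_const (by fun_prop))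
    fun x _ => Set.mem_iUnion.2 ⟨x₀ - x, by simp [hx]⟩
  have hbound : ∀ x, k x₀ / 2 ≤ ∑ b ∈ t, k (x + b) := by
    intro x
    obtain ⟨γ, hγ, hxC⟩ := hCΓ x
    have h1 := ht hxC
    simp only [Set.mem_iUnion, Set.mem_ofPred_eq, exists_prop] at h1
    obtain ⟨b, hb, hb'⟩ := h1
    have h2 : k (x + b) = k (x - γ + b) := by
      rw [← hper (x - γ + b) γ hγ]; congr 1; abel
    refine le_trans ?_ (Finset.single_le_sum (f := fun b => k (x + b)) (fun b _ => hpos _) hb)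
    simp only [h2]
    exact hb'.le
  have hint : ∀ b, ∫ x, k (x + b) ∂ν = 0 := by
    intro b
    have h1 := h.integral_add (fun x => (k x : ℂ)) (by fun_prop)
      (fun x γ hγ => by rw [hper x γ hγ]) b
    rw [h0] at h1
    have h2 : ((∫ x, k (x + b) ∂ν : ℝ) : ℂ) = 0 := by rw [← h1]; exact integral_ofReal.symm
    exact_mod_cast h2
  have hkint : ∀ b, Integrable (fun x => k (x + b)) ν := fun b => by
    have h1 := (h.integrable (k := fun x => (k (x + b) : ℂ)) (by fun_prop)).re
    simpa using h1
  have h3 : ∫ x, ∑ b ∈ t, k (x + b) ∂ν = 0 := by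
    rw [integral_finsetSum _ fun b _ => hkint b]
    simp [hint]
  have h4 : ∫ _, k x₀ / 2 ∂ν ≤ ∫ x, ∑ b ∈ t, k (x + b) ∂ν :=
    integral_mono (integrable_const _) (integrable_finsetSum _ fun b _ => hkint b) hbound
  rw [h3] at h4
  simp at h4
  linarith

end IsPeriodMeasure

/-! ### Fourier series on compact quotients -/

/-- A group of continuous characters of `M` that separates the points of `M / Γ`. -/
structure IsDualFamily {M ι : Type*} [AddCommGroup M] [TopologicalSpace M] [AddCommGroup ι]
    (Γ : AddSubgroup M) (χ : ι → AddChar M Circle) : Prop where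
  continuous : ∀ i, Continuous (χ i)
  map_add : ∀ i j x, χ (i + j) x = χ i x * χ j x
  period : ∀ i, ∀ γ ∈ Γ, χ i γ = 1
  separates : ∀ x, (∀ i, χ i x = 1) → x ∈ Γ
  faithful : ∀ i, (∀ x, χ i x = 1) → i = 0

namespace IsDualFamily

variable {M ι : Type*} [AddCommGroup M] [TopologicalSpace M] [IsTopologicalAddGroup M]
  [AddCommGroup ι] {Γ : AddSubgroup M} {χ : ι → AddChar M Circle}

theorem map_zero (h : IsDualFamily Γ χ) (x : M) : χ 0 x = 1 := by
  have := h.map_add 0 0 x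
  rw [add_zero] at this
  exact (mul_eq_left.1 this.symm)

theorem map_neg (h : IsDualFamily Γ χ) (i : ι) (x : M) : χ (-i) x = (χ i x)⁻¹ := by
  refine eq_inv_of_mul_eq_one_left ?_
  rw [← h.map_add, neg_add_cancel, h.map_zero]

/-- A character as a continuous function on the quotient. -/
def quotientChar (h : IsDualFamily Γ χ) (i : ι) : C(M ⧸ Γ, ℂ) where
  toFun := Quotient.lift (fun x => ((χ i x : Circle) : ℂ)) fun x y hxy => by
    have h1 : -x + y ∈ Γ := QuotientAddGroup.leftRel_apply.1 hxy
    have h2 := h.period i _ h1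
    rw [AddChar.map_add_eq_mul, AddChar.map_neg_eq_inv, inv_mul_eq_one] at h2
    simp only [h2]
  continuous_toFun := by
    refine Continuous.quotient_lift ?_ _
    exact continuous_induced_dom.comp (h.continuous i)

@[simp] theorem quotientChar_mk (h : IsDualFamily Γ χ) (i : ι) (x : M) :
    h.quotientChar i (x : M ⧸ Γ) = ((χ i x : Circle) : ℂ) := rfl

/-- The span of the characters is a star subalgebra. -/
def trigPolynomials (h : IsDualFamily Γ χ) : StarSubalgebra ℂ C(M ⧸ Γ, ℂ) where
  carrier := Submodule.span ℂ (Set.range h.quotientChar)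
  mul_mem' := by
    intro a b ha hb
    have hmul : Submodule.span ℂ (Set.range h.quotientChar) *
        Submodule.span ℂ (Set.range h.quotientChar) ≤
        Submodule.span ℂ (Set.range h.quotientChar) := by
      rw [Submodule.span_mul_span]
      refine Submodule.span_mono ?_
      rintro _ ⟨_, ⟨i, rfl⟩, _, ⟨j, rfl⟩, rfl⟩
      refine ⟨i + j, ?_⟩
      ext x
      obtain ⟨x, rfl⟩ := QuotientAddGroup.mk_surjective x
      simp [h.map_add]
    exact hmul (Submodule.mul_mem_mul ha hb)
  add_mem' := fun ha hb => Submodule.add_mem _ ha hb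
  algebraMap_mem' := fun r => by
    have h1 : (algebraMap ℂ C(M ⧸ Γ, ℂ)) r = r • h.quotientChar 0 := by
      ext x
      obtain ⟨x, rfl⟩ := QuotientAddGroup.mk_surjective x
      simp [h.map_zero]
    rw [h1]
    exact Submodule.smul_mem _ _ (Submodule.subset_span ⟨0, rfl⟩)
  star_mem' := by
    intro a ha
    induction ha using Submodule.span_induction with
    | mem x hx =>
      obtain ⟨i, rfl⟩ := hx
      refine Submodule.subset_span ⟨-i, ?_⟩
      ext x
      obtain ⟨x, rfl⟩ := QuotientAddGroup.mk_surjective x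
      simp only [quotientChar_mk, h.map_neg, Circle.coe_inv_eq_conj, ContinuousMap.star_apply]
      rfl
    | zero => rw [star_zero]; exact Submodule.zero_mem _
    | add x y _ _ hx hy => rw [star_add]; exact Submodule.add_mem _ hx hy
    | smul c x _ hx => rw [star_smul]; exact Submodule.smul_mem _ _ hx

theorem compactSpace_quotient (hcpt : ∃ C : Set M, IsCompact C ∧ ∀ x, ∃ γ ∈ Γ, x - γ ∈ C) :
    CompactSpace (M ⧸ Γ) := by
  obtain ⟨C, hC, hCΓ⟩ := hcpt
  refine ⟨?_⟩
  have : (Set.univ : Set (M ⧸ Γ)) = (fun x : M => (x : M ⧸ Γ)) '' C := by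
    symm
    refine Set.eq_univ_of_forall fun x => ?_
    obtain ⟨x, rfl⟩ := QuotientAddGroup.mk_surjective x
    obtain ⟨γ, hγ, hx⟩ := hCΓ x
    refine ⟨x - γ, hx, ?_⟩
    rw [QuotientAddGroup.eq]
    simpa using hγ
  rw [this]
  exact hC.image continuous_quotient_mk'

/-- Stone–Weierstrass; the axiom `separates` says exactly that the characters separate the points of
the quotient. -/
theorem closure_span_eq_top (h : IsDualFamily Γ χ) [CompactSpace (M ⧸ Γ)] :
    (Submodule.span ℂ (Set.range h.quotientChar)).topologicalClosure = ⊤ := by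
  have h1 := ContinuousMap.starSubalgebra_topologicalClosure_eq_top_of_separatesPoints
    h.trigPolynomials (by
      intro x y hxy
      obtain ⟨x, rfl⟩ := QuotientAddGroup.mk_surjective x
      obtain ⟨y, rfl⟩ := QuotientAddGroup.mk_surjective y
      by_contra! hcon
      apply hxy
      rw [QuotientAddGroup.eq]
      refine h.separates _ fun i => ?_
      have h2 := hcon (h.quotientChar i) ⟨h.quotientChar i, Submodule.subset_span ⟨i, rfl⟩, rfl⟩
      simp only [quotientChar_mk] at h2
      rw [AddChar.map_add_eq_mul, AddChar.map_neg_eq_inv, inv_mul_eq_one]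
      exact Circle.ext h2)
  rw [eq_top_iff]
  intro f _
  have h3 : f ∈ h.trigPolynomials.topologicalClosure := h1 ▸ StarSubalgebra.mem_top
  exact h3

/-- A continuous periodic function as a continuous function on the quotient. -/
def _root_.quotientLift {k : M → ℂ} (hk : Continuous k) (hper : ∀ x, ∀ γ ∈ Γ, k (x + γ) = k x) :
    C(M ⧸ Γ, ℂ) where
  toFun := Quotient.lift k fun x y hxy => by
    have h1 : -x + y ∈ Γ := QuotientAddGroup.leftRel_apply.1 hxy
    rw [← hper x _ h1]; congr 1; abel
  continuous_toFun := hk.quotient_lift _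

/-- Continuous periodic functions are uniformly approximated by trigonometric polynomials. -/
theorem exists_approx (h : IsDualFamily Γ χ)
    (hcpt : ∃ C : Set M, IsCompact C ∧ ∀ x, ∃ γ ∈ Γ, x - γ ∈ C)
    {k : M → ℂ} (hk : Continuous k) (hper : ∀ x, ∀ γ ∈ Γ, k (x + γ) = k x) {ε : ℝ} (hε : 0 < ε) :
    ∃ p : M → ℂ, p ∈ Submodule.span ℂ (Set.range fun (i : ι) (x : M) => ((χ i x : Circle) : ℂ)) ∧
      ∀ x, ‖k x - p x‖ < ε := by
  have := compactSpace_quotient hcpt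
  have h1 : quotientLift hk hper ∈
      (Submodule.span ℂ (Set.range h.quotientChar)).topologicalClosure :=
    h.closure_span_eq_top ▸ Submodule.mem_top
  obtain ⟨p, hp, hpd⟩ := Metric.mem_closure_iff.1 h1 ε hε
  refine ⟨fun x => p (x : M ⧸ Γ), ?_, fun x => ?_⟩
  · let L : C(M ⧸ Γ, ℂ) →ₗ[ℂ] (M → ℂ) :=
      { toFun := fun p x => p (x : M ⧸ Γ)
        map_add' := fun _ _ => rfl
        map_smul' := fun _ _ => rfl }
    have h2 : L p ∈ (Submodule.span ℂ (Set.range h.quotientChar)).map L :=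
      Submodule.mem_map_of_mem hp
    rw [Submodule.map_span, ← Set.range_comp] at h2
    exact h2
  · rw [dist_eq_norm] at hpd
    exact lt_of_le_of_lt (ContinuousMap.norm_coe_le_norm
      (quotientLift hk hper - p) (x : M ⧸ Γ)) hpd

variable [MeasurableSpace M] [BorelSpace M] {ν : Measure M}

/-- A continuous periodic function is determined by its Fourier coefficients. -/
theorem eq_zero_of_coeff (h : IsDualFamily Γ χ) (hν : IsPeriodMeasure Γ ν)
    (hcpt : ∃ C : Set M, IsCompact C ∧ ∀ x, ∃ γ ∈ Γ, x - γ ∈ C)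
    {k : M → ℂ} (hk : Continuous k) (hper : ∀ x, ∀ γ ∈ Γ, k (x + γ) = k x)
    (h0 : ∀ i, ∫ x, k x * (χ i x : Circle) ∂ν = 0) (x : M) : k x = 0 := by
  have := hν.isProb
  have hstar : Continuous fun x => star (k x) := hk.star
  have hχc : ∀ i, Continuous fun x => ((χ i x : Circle) : ℂ) := fun i =>
    continuous_induced_dom.comp (h.continuous i)
  have hint : ∀ p : M → ℂ, Continuous p → Integrable (fun x => k x * p x) ν := fun p hp =>
    hν.integrable (by fun_prop)
  have hspan : ∀ p ∈ Submodule.span ℂ (Set.range fun (i : ι) (x : M) => ((χ i x : Circle) : ℂ)),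
      Continuous p ∧ ∫ x, k x * p x ∂ν = 0 := by
    intro p hp
    induction hp using Submodule.span_induction with
    | mem p hp =>
      obtain ⟨i, rfl⟩ := hp
      exact ⟨hχc i, h0 i⟩
    | zero => exact ⟨continuous_const, by simp⟩
    | add p q _ _ hp hq =>
      refine ⟨hp.1.add hq.1, ?_⟩
      simp only [Pi.add_apply, mul_add]
      rw [integral_add (hint p hp.1) (hint q hq.1), hp.2, hq.2, add_zero]
    | smul c p _ hp =>
      refine ⟨hp.1.const_smul c, ?_⟩
      simp only [Pi.smul_apply, smul_eq_mul, mul_left_comm]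
      rw [integral_const_mul, hp.2, mul_zero]
  -- The function k is orthogonal to all trigonometric polynomials, and these approximate its
  -- complex conjugate uniformly.
  have hI : ∫ x, k x * star (k x) ∂ν = 0 := by
    have hB : ∀ ε > 0, ‖∫ x, k x * star (k x) ∂ν‖ ≤ ε * ∫ x, ‖k x‖ ∂ν := by
      intro ε hε
      obtain ⟨p, hp, hpk⟩ := h.exists_approx hcpt hstar
        (fun x γ hγ => by rw [hper x γ hγ]) hε
      obtain ⟨hpc, hp0⟩ := hspan p hp
      have h1 : ∫ x, k x * star (k x) ∂ν = ∫ x, k x * (star (k x) - p x) ∂ν := by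
        simp only [mul_sub]
        rw [integral_sub (hint _ hstar) (hint p hpc), hp0, sub_zero]
      rw [h1, ← integral_const_mul]
      refine norm_integral_le_of_norm_le ((hν.integrable hk).norm.const_mul ε) ?_
      refine Filter.Eventually.of_forall fun x => ?_
      rw [norm_mul, mul_comm]
      exact mul_le_mul_of_nonneg_right (hpk x).le (norm_nonneg _)
    by_contra hne
    have hpos : 0 < ‖∫ x, k x * star (k x) ∂ν‖ := norm_pos_iff.2 hne
    have hnn : 0 ≤ ∫ x, ‖k x‖ ∂ν := integral_nonneg fun x => norm_nonneg _
    have h2 := hB (‖∫ x, k x * star (k x) ∂ν‖ / (2 * (∫ x, ‖k x‖ ∂ν + 1))) (by positivity)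
    rw [div_mul_eq_mul_div, le_div_iff₀ (by positivity)] at h2
    nlinarith
  have h2 := hν.eq_zero_of_integral_eq_zero hcpt (k := fun x => ‖k x‖ ^ 2) (by fun_prop)
    (fun x γ hγ => by rw [hper x γ hγ]) (fun x => by positivity) (by
      rw [← hI]
      congr 1; funext x
      rw [← starRingEnd_apply, Complex.mul_conj, Complex.normSq_eq_norm_sq]) x
  simpa using h2

/-- Orthogonality of characters. -/
theorem integral_eq_zero (h : IsDualFamily Γ χ) (hν : IsPeriodMeasure Γ ν) {i : ι} (hi : i ≠ 0) :
    ∫ x, ((χ i x : Circle) : ℂ) ∂ν = 0 := by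
  obtain ⟨b, hb⟩ : ∃ b, χ i b ≠ 1 := by
    by_contra! hcon
    exact hi (h.faithful i hcon)
  have h1 := hν.integral_add (fun x => ((χ i x : Circle) : ℂ))
    (continuous_induced_dom.comp (h.continuous i))
    (fun x γ hγ => by simp [AddChar.map_add_eq_mul, h.period i γ hγ]) b
  simp only [AddChar.map_add_eq_mul, Circle.coe_mul, integral_mul_const] at h1
  by_contra hne
  exact hb (Circle.ext (by simpa using mul_left_cancel₀ hne (h1.trans (mul_one _).symm)))

end IsDualFamily

open scoped Pointwise

/-! ### Fundamental domains of discrete cocompact subgroups -/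

section FundamentalDomain

variable {A : Type*} [CommRing A] [TopologicalSpace A] [IsTopologicalRing A]
  [LocallyCompactSpace A] [MeasurableSpace A] [BorelSpace A] {Γ : AddSubgroup A}

/-- Cover C by finitely many translates of a set W whose differences contain no nonzero element of
Γ. The domain D takes from each box the points whose Γ-orbit misses all earlier boxes: every orbit
meets D in the first box that it visits, and only once because W is small. -/
theorem exists_relativelyCompact_fundamentalDomain [T2Space A] [Countable Γ]
    (hdisc : ∃ U : Set A, IsOpen U ∧ 0 ∈ U ∧ ∀ γ ∈ Γ, γ ∈ U → γ = 0)
    (hcpt : ∃ C : Set A, IsCompact C ∧ ∀ x, ∃ γ ∈ Γ, x - γ ∈ C) :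
    ∃ D C : Set A, IsCompact C ∧ D ⊆ C ∧ MeasurableSet D ∧ ∀ x, ∃! γ : Γ, γ +ᵥ x ∈ D := by
  obtain ⟨U, hU, hU0, hUΓ⟩ := hdisc
  obtain ⟨C, hC, hCΓ⟩ := hcpt
  obtain ⟨K, hK, hK0⟩ := exists_compact_mem_nhds (0 : A)
  obtain ⟨W', hW', hW0', hsub⟩ := IsGlobalField.exists_open_sub_subset hU hU0
  set W := W' ∩ interior K with hWdef
  have hW : IsOpen W := hW'.inter isOpen_interior
  have hW0 : (0 : A) ∈ W := ⟨hW0', mem_interior_iff_mem_nhds.2 hK0⟩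
  obtain ⟨t, ht⟩ := IsGlobalField.exists_finite_cover hC hW hW0
  obtain ⟨n, c, hc⟩ : ∃ (n : ℕ) (c : ℕ → A), ∀ x ∈ C, ∃ i < n, x - c i ∈ W := by
    refine ⟨t.toList.length, fun i => t.toList.getD i 0, fun x hx => ?_⟩
    obtain ⟨b, hb, hbx⟩ := ht x hx
    obtain ⟨i, hi, rfl⟩ := List.mem_iff_getElem.1 (Finset.mem_toList.2 hb)
    exact ⟨i, hi, by simpa [List.getElem?_eq_getElem hi] using hbx⟩
  let V : ℕ → Set A := fun i => {x | ∃ γ : Γ, (γ : A) + x - c i ∈ W}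
  have hV : ∀ i, IsOpen (V i) := fun i => by
    have : V i = ⋃ γ : Γ, (fun x => (γ : A) + x - c i) ⁻¹' W := by ext; simp [V]
    rw [this]
    exact isOpen_iUnion fun γ => hW.preimage (by fun_prop)
  have hVinv : ∀ i (γ : Γ) x, γ +ᵥ x ∈ V i ↔ x ∈ V i := by
    intro i γ x
    constructor
    · rintro ⟨γ', h⟩
      refine ⟨γ' + γ, ?_⟩
      rw [AddSubgroup.vadd_def, vadd_eq_add] at h
      simpa [add_assoc] using h
    · rintro ⟨γ', h⟩
      refine ⟨γ' - γ, ?_⟩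
      rw [AddSubgroup.vadd_def, vadd_eq_add]
      convert h using 2
      push_cast; ring
  let D : Set A := ⋃ i ∈ Finset.range n, {x | x - c i ∈ W} ∩ ⋂ j ∈ Finset.range i, (V j)ᶜ
  have hmem : ∀ x, x ∈ D ↔ ∃ i < n, x - c i ∈ W ∧ ∀ j < i, x ∉ V j := by
    intro x
    simp [D, and_left_comm]
  refine ⟨D, ⋃ i ∈ Finset.range n, (fun x => c i + x) '' K,
    (Finset.range n).isCompact_biUnion fun i _ => hK.image (by fun_prop), ?_, ?_, ?_⟩
  · intro x hx
    obtain ⟨i, hi, hxi, -⟩ := (hmem x).1 hx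
    simp only [Finset.mem_range, Set.mem_iUnion, exists_prop]
    exact ⟨i, hi, x - c i, interior_subset hxi.2, by ring⟩
  · refine Finset.measurableSet_biUnion _ fun i _ => ?_
    refine ((hW.preimage (by fun_prop : Continuous fun x => x - c i)).measurableSet).inter ?_
    exact Finset.measurableSet_biInter _ fun j _ => (hV j).measurableSet.compl
  · intro x
    have hex : ∃ i, i < n ∧ x ∈ V i := by
      obtain ⟨γ, hγ, hx⟩ := hCΓ x
      obtain ⟨i, hi, hxi⟩ := hc _ hx
      exact ⟨i, hi, ⟨-γ, Γ.neg_mem hγ⟩, by simpa [sub_eq_add_neg, add_comm] using hxi⟩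
    classical
    obtain ⟨hin, γ, hγ⟩ := Nat.find_spec hex
    have hmin : ∀ j < Nat.find hex, x ∉ V j := fun j hj hx =>
      Nat.find_min hex hj ⟨hj.trans hin, hx⟩
    refine ⟨γ, (hmem _).2 ⟨Nat.find hex, hin, hγ, fun j hj => ?_⟩, ?_⟩
    · rw [hVinv]; exact hmin j hj
    · intro γ' hγ'
      obtain ⟨i, hi, hxi, hmi⟩ := (hmem _).1 hγ'
      have h1 : i = Nat.find hex := by
        refine le_antisymm ?_ (Nat.find_min' hex ⟨hi, γ', hxi⟩)
        by_contra! hlt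
        exact hmi _ hlt ((hVinv _ _ _).2 ⟨γ, hγ⟩)
      subst h1
      have h2 := hsub _ hxi.1 _ hγ.1
      have h3 : ((γ' - γ : Γ) : A) ∈ U := by
        rw [AddSubgroup.vadd_def, vadd_eq_add] at h2
        convert h2 using 1
        push_cast; ring
      have h4 := hUΓ _ (γ' - γ).2 h3
      exact sub_eq_zero.1 (Subtype.ext h4)

/-- A Haar measure together with a relatively compact fundamental domain of measure one. -/
structure IsUnitDomain (Γ : AddSubgroup A) (μ : Measure A) (D : Set A) : Prop where
  haar : μ.IsAddHaarMeasure
  domain : IsAddFundamentalDomain Γ D μ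
  compact : ∃ C, IsCompact C ∧ D ⊆ C
  measurable : MeasurableSet D
  measure_eq_one : μ D = 1

theorem exists_isUnitDomain [T2Space A] [SecondCountableTopology A] [Countable Γ]
    (hdisc : ∃ U : Set A, IsOpen U ∧ 0 ∈ U ∧ ∀ γ ∈ Γ, γ ∈ U → γ = 0)
    (hcpt : ∃ C : Set A, IsCompact C ∧ ∀ x, ∃ γ ∈ Γ, x - γ ∈ C) :
    ∃ (μ : Measure A) (D : Set A), IsUnitDomain Γ μ D := by
  obtain ⟨D, C, hC, hDC, hD, hex⟩ := exists_relativelyCompact_fundamentalDomain hdisc hcpt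
  let μ : Measure A := Measure.addHaar
  have hne : μ D ≠ 0 :=
    (IsAddFundamentalDomain.mk' (G := Γ) hD.nullMeasurableSet hex :
      IsAddFundamentalDomain Γ D μ).measure_ne_zero
      (by simpa using Measure.measure_univ_ne_zero.1 (isOpen_univ.measure_ne_zero μ Set.univ_nonempty))
  have htop : μ D ≠ ⊤ := (lt_of_le_of_lt (measure_mono hDC) hC.measure_lt_top).ne
  refine ⟨(μ D)⁻¹ • μ, D, ?_, IsAddFundamentalDomain.mk' hD.nullMeasurableSet hex, ⟨C, hC, hDC⟩, hD,
    ?_⟩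
  · exact Measure.IsAddHaarMeasure.smul μ (ENNReal.inv_ne_zero.2 htop) (ENNReal.inv_ne_top.2 hne)
  · rw [Measure.smul_apply, smul_eq_mul, ENNReal.inv_mul_cancel hne htop]

/-- Translates of a fundamental domain are fundamental domains, and periodic functions have the same
integral over all of them. -/
theorem IsUnitDomain.isPeriodMeasure [T2Space A] [SecondCountableTopology A] [Countable Γ]
    {μ : Measure A} {D : Set A}
    (h : IsUnitDomain Γ μ D) : IsPeriodMeasure Γ (μ.restrict D) := by
  have := h.haar
  obtain ⟨C, hC, hDC⟩ := h.compact
  refine ⟨⟨by rw [Measure.restrict_apply_univ, h.measure_eq_one]⟩, ⟨C, hC, ?_⟩, ?_⟩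
  · rw [Measure.restrict_apply hC.measurableSet.compl]
    convert measure_empty (μ := μ)
    rw [← Set.disjoint_iff_inter_eq_empty, Set.disjoint_compl_left_iff_subset]
    exact hDC
  · intro k hk hper b
    have h1 : IsAddFundamentalDomain Γ (b +ᵥ D) μ := h.domain.vadd_of_comm b
    have h2 : ∫ x in D, k (x + b) ∂μ = ∫ x in b +ᵥ D, k x ∂μ := by
      have he : MeasurableEmbedding fun x : A => b + x := measurableEmbedding_addLeft b
      have h4 := he.setIntegral_map (μ := μ) k (b +ᵥ D)
      rw [map_add_left_eq_self μ b] at h4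
      have h3 : (fun x => b + x) ⁻¹' (b +ᵥ D) = D := by
        ext x
        simp [Set.mem_vadd_set]
      rw [h4, h3]
      simp_rw [add_comm b]
    rw [h2]
    refine h1.setIntegral_eq h.domain fun γ x => ?_
    rw [AddSubgroup.vadd_def, vadd_eq_add, add_comm, hper _ _ γ.2]

end FundamentalDomain

/-! ### Parseval's identity -/

namespace IsDualFamily

variable {M ι : Type*} [AddCommGroup M] [TopologicalSpace M] [IsTopologicalAddGroup M]
  [AddCommGroup ι] {Γ : AddSubgroup M} {χ : ι → AddChar M Circle}
  [MeasurableSpace M] [BorelSpace M] {ν : Measure M}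

theorem _root_.IsPeriodMeasure.memLp (h : IsPeriodMeasure Γ ν) {k : M → ℂ} (hk : Continuous k) :
    MemLp k 2 ν := by
  have := h.isProb
  obtain ⟨C, hC, hν⟩ := h.compact
  obtain ⟨B, hB⟩ := (hC.image hk).isBounded.exists_norm_le
  refine MemLp.of_bound hk.aestronglyMeasurable B ?_
  rw [ae_iff]
  exact measure_mono_null (fun x hx hxC => hx (hB _ ⟨x, hxC, rfl⟩)) hν

theorem _root_.MeasureTheory.MemLp.inner_toLp_toLp {α : Type*} [MeasurableSpace α]
    {ν : Measure α} {f g : α → ℂ}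
    (hf : MemLp f 2 ν) (hg : MemLp g 2 ν) :
    inner ℂ (hf.toLp f) (hg.toLp g) = ∫ x, g x * star (f x) ∂ν := by
  rw [L2.inner_def]
  refine integral_congr_ae ?_
  filter_upwards [hf.coeFn_toLp, hg.coeFn_toLp] with x h1 h2
  rw [h1, h2]
  simp

/-- Parseval's identity for a continuous periodic function `k` and a continuous function `y`. -/
theorem hasSum_integral (h : IsDualFamily Γ χ) (hν : IsPeriodMeasure Γ ν)
    (hcpt : ∃ C : Set M, IsCompact C ∧ ∀ x, ∃ γ ∈ Γ, x - γ ∈ C)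
    {k y : M → ℂ} (hk : Continuous k) (hper : ∀ x, ∀ γ ∈ Γ, k (x + γ) = k x) (hy : Continuous y) :
    HasSum (fun i => (∫ x, y x * (χ i x : Circle) ∂ν) * ∫ x, k x * (χ (-i) x : Circle) ∂ν)
      (∫ x, y x * k x ∂ν) ∧
    ∀ s : Finset ι, ∑ i ∈ s,
      ‖(∫ x, y x * (χ i x : Circle) ∂ν) * ∫ x, k x * (χ (-i) x : Circle) ∂ν‖ ≤
      (∫ x, ‖y x‖ ^ 2 ∂ν) + ∫ x, ‖k x‖ ^ 2 ∂ν := by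
  have := hν.isProb
  have hχc : ∀ i, Continuous fun x => ((χ i x : Circle) : ℂ) := fun i =>
    continuous_induced_dom.comp (h.continuous i)
  have hstar : ∀ i x, star ((χ i x : Circle) : ℂ) = (χ (-i) x : Circle) := fun i x => by
    rw [h.map_neg, Circle.coe_inv_eq_conj]; rfl
  have hyc : Continuous fun x => star (y x) := hy.star
  let e : ι → Lp ℂ 2 ν := fun i => (hν.memLp (hχc i)).toLp _
  let Y : Lp ℂ 2 ν := (hν.memLp hyc).toLp _
  let Kk : Lp ℂ 2 ν := (hν.memLp hk).toLp _
  have hY : ∀ i, inner ℂ Y (e i) = ∫ x, y x * (χ i x : Circle) ∂ν := fun i => by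
    simp only [Y, e, MemLp.inner_toLp_toLp, star_star, mul_comm]
  have hK : ∀ i, inner ℂ (e i) Kk = ∫ x, k x * (χ (-i) x : Circle) ∂ν := fun i => by
    simp only [Kk, e, MemLp.inner_toLp_toLp, hstar]
  have hYK : inner ℂ Y Kk = ∫ x, y x * k x ∂ν := by
    simp only [Kk, Y, MemLp.inner_toLp_toLp, star_star, mul_comm]
  have hon : Orthonormal ℂ e := by
    classical
    rw [orthonormal_iff_ite]
    intro i j
    simp only [e, MemLp.inner_toLp_toLp, hstar]
    have h1 : ∀ x, ((χ j x : Circle) : ℂ) * (χ (-i) x : Circle) = (χ (j + -i) x : Circle) :=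
      fun x => by rw [h.map_add]; simp
    simp_rw [h1]
    split_ifs with hij
    · subst hij
      simp [h.map_zero]
    · exact h.integral_eq_zero hν fun h0 => hij (add_neg_eq_zero.1 h0).symm
  -- Uniform approximation puts k in the closed span of the characters, so whatever is orthogonal to
  -- the characters is orthogonal to k.
  have horth : ∀ v : Lp ℂ 2 ν, (∀ i, inner ℂ v (e i) = 0) → inner ℂ v Kk = 0 := by
    intro v hv
    have hle : ∀ ε > 0, ‖inner ℂ v Kk‖ ≤ ‖v‖ * ε := by
      intro ε hε
      obtain ⟨p, hp, hpk⟩ := h.exists_approx hcpt hk hper hε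
      obtain ⟨hpc, hp0⟩ : ∃ hpc : Continuous p, inner ℂ v ((hν.memLp hpc).toLp p) = 0 := by
        clear hpk
        induction hp using Submodule.span_induction with
        | mem p hp =>
          obtain ⟨i, rfl⟩ := hp
          exact ⟨hχc i, hv i⟩
        | zero => exact ⟨continuous_const, by
            rw [MemLp.toLp_zero, inner_zero_right]⟩
        | add p q _ _ hp hq =>
          obtain ⟨hp, hp'⟩ := hp
          obtain ⟨hq, hq'⟩ := hq
          refine ⟨hp.add hq, ?_⟩
          rw [MemLp.toLp_add (hν.memLp hp) (hν.memLp hq), inner_add_right, hp', hq', add_zero]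
        | smul c p _ hp =>
          obtain ⟨hp, hp'⟩ := hp
          refine ⟨hp.const_smul c, ?_⟩
          rw [MemLp.toLp_const_smul c (hν.memLp hp), inner_smul_right, hp', mul_zero]
      have h1 : inner ℂ v Kk = inner ℂ v (Kk - (hν.memLp hpc).toLp p) := by
        rw [inner_sub_right, hp0, sub_zero]
      rw [h1]
      refine (norm_inner_le_norm _ _).trans (mul_le_mul_of_nonneg_left ?_ (norm_nonneg _))
      rw [← MemLp.toLp_sub]
      have h2 := Lp.norm_le_of_ae_bound (p := 2) (μ := ν)
        (f := ((hν.memLp hk).sub (hν.memLp hpc)).toLp _) hε.le (by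
          filter_upwards [((hν.memLp hk).sub (hν.memLp hpc)).coeFn_toLp] with x hx
          rw [hx]
          exact (hpk x).le)
      simpa [measureUnivNNReal] using h2
    by_contra hne
    have hpos : 0 < ‖inner ℂ v Kk‖ := norm_pos_iff.2 hne
    have h2 := hle (‖inner ℂ v Kk‖ / (2 * (‖v‖ + 1))) (by positivity)
    rw [mul_div_assoc', le_div_iff₀ (by positivity)] at h2
    nlinarith [norm_nonneg v]
  have hinj : Function.Injective e := hon.linearIndependent.injective
  constructor
  -- Completeness of the characters in L² is not needed. They are extended to a Hilbert basis, and
  -- the added vectors contribute nothing as they are orthogonal to k.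
  · have hon' : Orthonormal ℂ ((↑) : Set.range e → Lp ℂ 2 ν) := hon.toSubtypeRange
    obtain ⟨w, b, hw, hb⟩ := hon'.exists_hilbertBasis_extension
    have hs := b.hasSum_inner_mul_inner Y Kk
    rw [hb] at hs
    let g : ι → w := fun i => ⟨e i, hw ⟨i, rfl⟩⟩
    have hg : Function.Injective g := fun i j hij => hinj (congrArg Subtype.val hij)
    have hz : ∀ v ∉ Set.range g, inner ℂ Y (v : Lp ℂ 2 ν) * inner ℂ (v : Lp ℂ 2 ν) Kk = 0 := by
      intro v hv
      rw [horth v fun i => ?_, mul_zero]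
      have hvi : v ≠ g i := fun hvi => hv ⟨i, hvi.symm⟩
      have h1 := b.orthonormal.2 hvi
      rwa [hb] at h1
    have h3 := (hg.hasSum_iff hz).2 hs
    rw [hYK] at h3
    convert h3 using 1
    funext i
    rw [← hY, ← hK]
    rfl
  · intro s
    have hnY : ‖Y‖ ^ 2 = ∫ x, ‖y x‖ ^ 2 ∂ν := by
      have h1 : inner ℂ Y Y = ∫ x, ((‖y x‖ ^ 2 : ℝ) : ℂ) ∂ν := by
        simp only [Y, MemLp.inner_toLp_toLp, star_star]
        congr 1; funext x
        rw [mul_comm, ← starRingEnd_apply, Complex.mul_conj, Complex.normSq_eq_norm_sq]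
      rw [inner_self_eq_norm_sq_to_K, integral_complex_ofReal] at h1
      exact Complex.ofReal_injective (by rw [← h1]; simp)
    have hnK : ‖Kk‖ ^ 2 = ∫ x, ‖k x‖ ^ 2 ∂ν := by
      have h1 : inner ℂ Kk Kk = ∫ x, ((‖k x‖ ^ 2 : ℝ) : ℂ) ∂ν := by
        simp only [Kk, MemLp.inner_toLp_toLp]
        congr 1; funext x
        rw [← starRingEnd_apply, Complex.mul_conj, Complex.normSq_eq_norm_sq]
      rw [inner_self_eq_norm_sq_to_K, integral_complex_ofReal] at h1
      exact Complex.ofReal_injective (by rw [← h1]; simp)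
    rw [← hnY, ← hnK]
    have h1 := hon.sum_inner_products_le (x := Y) (s := s)
    have h2 := hon.sum_inner_products_le (x := Kk) (s := s)
    refine le_trans ?_ (add_le_add h1 h2)
    rw [← Finset.sum_add_distrib]
    refine Finset.sum_le_sum fun i _ => ?_
    rw [← hY, ← hK, norm_mul, ← norm_inner_symm]
    nlinarith [sq_nonneg (‖inner ℂ (e i) Y‖ - ‖inner ℂ (e i) Kk‖), sq_nonneg (‖inner ℂ (e i) Y‖),
      sq_nonneg (‖inner ℂ (e i) Kk‖)]

end IsDualFamily

/-! ### Fourier transforms of constant terms by unfolding -/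

section Unfolding

variable {A : Type*} [CommRing A] [TopologicalSpace A] [IsTopologicalRing A]
  [LocallyCompactSpace A] [T2Space A] [SecondCountableTopology A]
  [MeasurableSpace A] [BorelSpace A] {Γ : AddSubgroup A} {μ : Measure A} {D : Set A}

theorem finite_inter_of_discrete
    (hdisc : ∃ U : Set A, IsOpen U ∧ 0 ∈ U ∧ ∀ γ ∈ Γ, γ ∈ U → γ = 0) {K : Set A}
    (hK : IsCompact K) : Set.Finite {γ : Γ | (γ : A) ∈ K} := by
  obtain ⟨U, hU, hU0, hUΓ⟩ := hdisc
  obtain ⟨W, hW, hW0, hsub⟩ := IsGlobalField.exists_open_sub_subset hU hU0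
  obtain ⟨t, ht⟩ := IsGlobalField.exists_finite_cover hK hW hW0
  choose! c hct hcW using ht
  refine Set.Finite.of_injOn (f := fun γ : Γ => c γ) (t := (t : Set A)) (fun γ hγ => hct _ hγ) ?_
    t.finite_toSet
  intro γ hγ γ' hγ' h
  have h1 := hsub _ (hcW _ hγ) _ (hcW _ hγ')
  simp only at h
  rw [h] at h1
  refine sub_eq_zero.1 (Subtype.ext (hUΓ _ (γ - γ').2 ?_))
  convert h1 using 1
  push_cast; ring

/-- The integral over `A` of a function that is supported on a fixed compact set, as a finite sum
of translates over the fundamental domain. -/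
theorem IsUnitDomain.exists_finset_integral [Countable Γ] (hD : IsUnitDomain Γ μ D)
    (hdisc : ∃ U : Set A, IsOpen U ∧ 0 ∈ U ∧ ∀ γ ∈ Γ, γ ∈ U → γ = 0) {S : Set A}
    (hS : IsCompact S) : ∃ T : Finset Γ, ∀ h : A → ℂ, Continuous h → (∀ x ∉ S, h x = 0) →
      ∫ x, h x ∂μ = ∫ x in D, ∑ γ ∈ T, h (x + γ) ∂μ := by
  obtain ⟨C, hC, hDC⟩ := hD.compact
  have := hD.haar
  -- A translate of D meets S only for γ in the compact set S - C, and the discrete group Γ has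
  -- finitely many elements there.
  have hfin := finite_inter_of_discrete hdisc
    ((hS.prod hC).image (continuous_fst.sub continuous_snd))
  refine ⟨hfin.toFinset, fun h hh hhS => ?_⟩
  have hint : Integrable h μ := hh.integrable_of_hasCompactSupport
    (HasCompactSupport.intro hS hhS)
  rw [hD.domain.integral_eq_tsum'' h hint, tsum_eq_sum (s := hfin.toFinset)]
  · rw [integral_finsetSum]
    · simp_rw [AddSubgroup.vadd_def, vadd_eq_add, add_comm]
    · intro γ _
      exact (hint.comp_add_right (γ : A)).integrableOn
  · intro γ hγ
    refine setIntegral_eq_zero_of_forall_eq_zero fun x hx => hhS _ fun hxS => hγ ?_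
    rw [Set.Finite.mem_toFinset]
    refine ⟨(_, x), ⟨hxS, hDC hx⟩, ?_⟩
    simp [AddSubgroup.vadd_def]

/-- If `Z` is periodic in the first variable and quasi-periodic in the second, the Fourier
transform of `s ↦ ∫ Z(c, s) dc` is the mean of `ψ(c s) Z(c, s)` over `s`, in the sense of
distributions. -/
theorem IsUnitDomain.integral_mul_mean [Countable Γ] (hD : IsUnitDomain Γ μ D)
    (hdisc : ∃ U : Set A, IsOpen U ∧ 0 ∈ U ∧ ∀ γ ∈ Γ, γ ∈ U → γ = 0)
    (hcpt : ∃ C : Set A, IsCompact C ∧ ∀ x, ∃ γ ∈ Γ, x - γ ∈ C)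
    {ψ : AddChar A Circle} (hψ : Continuous ψ)
    (hdual : IsDualFamily Γ fun γ : Γ => ψ.mulShift (γ : A))
    {Z : A → A → ℂ} (hZ : Continuous (Function.uncurry Z))
    (hc : ∀ c s, ∀ γ ∈ Γ, Z (c + γ) s = Z c s)
    (hs : ∀ c s, ∀ γ ∈ Γ, Z c (s + γ) = (ψ (-(γ * c)) : Circle) * Z c s)
    {ρ : A → ℂ} (hρ : Continuous ρ) (hρc : HasCompactSupport ρ) :
    ∫ c, ρ c * ∫ s in D, (ψ (c * s) : Circle) * Z c s ∂μ ∂μ =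
      ∫ s, (∫ c, ρ c * (ψ (c * s) : Circle) ∂μ) * ∫ c in D, Z c s ∂μ ∂μ := by
  have := hD.haar
  have hν := hD.isPeriodMeasure
  have hprob := hν.isProb
  obtain ⟨T, hT⟩ := hD.exists_finset_integral hdisc hρc.isCompact
  have hψc : Continuous fun x : A => ((ψ x : Circle) : ℂ) := continuous_induced_dom.comp hψ
  have hZ' : ∀ s, Continuous fun x => Z x s := fun s =>
    hZ.comp (continuous_id.prodMk continuous_const)
  -- The periodization over Γ of c ↦ ρ(c) ψ(c s), which on D is a finite sum.
  let r : A → A → ℂ := fun s x => ∑ γ ∈ T, ρ (x + γ) * (ψ ((x + γ) * s) : Circle)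
  have hr : Continuous (Function.uncurry r) := by
    simp only [r, Function.uncurry_def]
    refine continuous_finsetSum _ fun γ _ => ?_
    exact (hρ.comp (by fun_prop)).mul (hψc.comp (by fun_prop))
  have hr' : ∀ s, Continuous (r s) := fun s => hr.comp (continuous_const.prodMk continuous_id)
  have hzero : ∀ x ∉ tsupport ρ, ρ x = 0 := fun x hx => image_eq_zero_of_notMem_tsupport hx
  have hψΓ : ∀ γ ∈ Γ, ∀ γ' ∈ Γ, ψ (γ * γ') = 1 := fun γ hγ γ' hγ' =>
    hdual.period ⟨γ, hγ⟩ γ' hγ'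
  let B : A → ℂ := fun c => ∫ s in D, (ψ (c * s) : Circle) * Z c s ∂μ
  let H : A → ℂ := fun s => ∫ c in D, Z c s ∂μ
  let R : A → ℂ := fun s => ∫ c, ρ c * (ψ (c * s) : Circle) ∂μ
  have hH : Continuous H := hν.continuous_integral (k := fun s c => Z c s)
    (hZ.comp continuous_swap)
  have hB : Continuous B := by
    refine hν.continuous_integral (k := fun c s => (ψ (c * s) : Circle) * Z c s) ?_
    exact (hψc.comp (by fun_prop)).mul hZ
  have hRr : ∀ s, R s = ∫ x in D, r s x ∂μ := fun s =>
    hT _ (hρ.mul (hψc.comp (by fun_prop))) fun x hx => by rw [hzero x hx, zero_mul]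
  have hR : Continuous R := by
    rw [funext hRr]
    exact hν.continuous_integral hr
  have hBper : ∀ c, ∀ γ ∈ Γ, B (c + γ) = ∫ s in D, (ψ ((c + γ) * s) : Circle) * Z c s ∂μ := by
    intro c γ hγ
    simp only [B, hc _ _ γ hγ]
  have hleft : ∫ c, ρ c * B c ∂μ = ∫ s in D, ∫ x in D, r s x * Z x s ∂μ ∂μ := by
    rw [hT (fun c => ρ c * B c) (hρ.mul hB) fun x hx => by rw [hzero x hx, zero_mul]]
    rw [hν.integral_swap hν (k := fun s x => r s x * Z x s)
      (hr.mul (hZ.comp continuous_swap))]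
    congr 1; funext x
    simp only [r, Finset.sum_mul]
    rw [integral_finsetSum]
    · refine Finset.sum_congr rfl fun γ _ => ?_
      rw [hBper _ _ γ.2, ← integral_const_mul]
      congr 1; funext s
      ring
    · intro γ _
      refine hν.integrable ?_
      exact (continuous_const.mul (hψc.comp (by fun_prop))).mul
        (hZ.comp (continuous_const.prodMk continuous_id))
  have hpars := fun s => hdual.hasSum_integral hν hcpt (hZ' s) (fun x γ hγ => hc x s γ hγ) (hr' s)
  -- Quasi-periodicity turns the Fourier coefficients in x of r(s, x) and Z(x, s) into the values of
  -- R and H at s + γ. Parseval then gives the sum of R H over s + Γ, and integrating over D unfolds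
  -- it to an integral over A.
  have hcoef : ∀ s (γ : Γ), (∫ x in D, r s x * (ψ.mulShift (γ : A) x : Circle) ∂μ) *
      ∫ x in D, Z x s * (ψ.mulShift ((-γ : Γ) : A) x : Circle) ∂μ = R (s + γ) * H (s + γ) := by
    intro s γ
    congr 1
    · rw [hRr]
      congr 1; funext x
      simp only [r, Finset.sum_mul]
      refine Finset.sum_congr rfl fun γ' _ => ?_
      rw [mul_assoc, ← Circle.coe_mul, AddChar.mulShift_apply, ← AddChar.map_add_eq_mul]
      have h1 : (x + (γ' : A)) * (s + γ) = (x + γ') * s + γ * x + γ' * γ := by ring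
      rw [h1, AddChar.map_add_eq_mul _ _ ((γ' : A) * γ), hψΓ _ γ'.2 _ γ.2, mul_one]
    · simp only [H]
      congr 1; funext x
      rw [hs x s γ γ.2, AddChar.mulShift_apply, mul_comm]
      congr 3
      push_cast; ring
  simp_rw [hcoef] at hpars
  let G : A → ℂ := fun s => R s * H s
  have hG : Continuous G := hR.mul hH
  have hvadd : ∀ (γ : Γ) (s : A), G (γ +ᵥ s) = R (s + γ) * H (s + γ) := fun γ s => by
    rw [AddSubgroup.vadd_def, vadd_eq_add, add_comm]
  -- Absolute convergence: the uniform bound on finite sums in Parseval's identity is a continuous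
  -- function of s, integrable over the relatively compact D.
  have hfin : ∑' γ : Γ, ∫⁻ s in D, ‖G (γ +ᵥ s)‖ₑ ∂μ ≠ ⊤ := by
    rw [← lintegral_tsum]
    · have hq : Continuous fun s => ‖∫ x in D, ((‖r s x‖ ^ 2 : ℝ) : ℂ) ∂μ‖ +
          ‖∫ x in D, ((‖Z x s‖ ^ 2 : ℝ) : ℂ) ∂μ‖ := by
        refine (hν.continuous_integral (k := fun s x => ((‖r s x‖ ^ 2 : ℝ) : ℂ)) ?_).norm.add
          (hν.continuous_integral (k := fun s x => ((‖Z x s‖ ^ 2 : ℝ) : ℂ)) ?_).norm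
        · exact Complex.continuous_ofReal.comp (hr.norm.pow 2)
        · exact Complex.continuous_ofReal.comp ((hZ.comp continuous_swap).norm.pow 2)
      have hqi : Integrable (fun s => (((‖∫ x in D, ((‖r s x‖ ^ 2 : ℝ) : ℂ) ∂μ‖ +
          ‖∫ x in D, ((‖Z x s‖ ^ 2 : ℝ) : ℂ) ∂μ‖ : ℝ)) : ℂ)) (μ.restrict D) :=
        hν.integrable (Complex.continuous_ofReal.comp hq)
      refine ne_top_of_le_ne_top hqi.2.ne (lintegral_mono fun s => ?_)
      rw [ENNReal.tsum_eq_iSup_sum]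
      refine iSup_le fun t => ?_
      have h1 := (hpars s).2 t
      have h2 : ∀ f : A → ℂ, ‖∫ x in D, ((‖f x‖ ^ 2 : ℝ) : ℂ) ∂μ‖ = ∫ x in D, ‖f x‖ ^ 2 ∂μ := by
        intro f
        rw [integral_complex_ofReal, Complex.norm_real, Real.norm_of_nonneg]
        exact integral_nonneg fun x => by positivity
      rw [← h2, ← h2] at h1
      simp_rw [hvadd, ← ofReal_norm]
      rw [← ENNReal.ofReal_sum_of_nonneg fun _ _ => norm_nonneg _]
      refine ENNReal.ofReal_le_ofReal (h1.trans ?_)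
      rw [Complex.norm_real]
      exact le_abs_self _
    · intro γ
      exact ((hG.comp (continuous_const_vadd γ)).enorm.measurable).aemeasurable
  have hGint : Integrable G μ := by
    refine ⟨hG.aestronglyMeasurable, ?_⟩
    rw [HasFiniteIntegral, hD.domain.lintegral_eq_tsum'']
    exact hfin.lt_top
  calc ∫ c, ρ c * B c ∂μ = ∫ s in D, ∫ x in D, r s x * Z x s ∂μ ∂μ := hleft
    _ = ∫ s in D, ∑' γ : Γ, G (γ +ᵥ s) ∂μ := by
        congr 1; funext s
        simp_rw [hvadd]
        exact (hpars s).1.tsum_eq.symm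
    _ = ∑' γ : Γ, ∫ s in D, G (γ +ᵥ s) ∂μ :=
        integral_tsum (fun γ => (hG.comp (continuous_const_vadd γ)).aestronglyMeasurable) hfin
    _ = ∫ s, G s ∂μ := (hD.domain.integral_eq_tsum'' G hGint).symm

theorem exists_integral_comp_mul (μ : Measure A) [μ.IsAddHaarMeasure] {τ τ' : A}
    (hτ : τ * τ' = 1) : ∃ κ : ℝ, 0 < κ ∧ ∀ f : A → ℂ, ∫ x, f (τ * x) ∂μ = κ * ∫ x, f x ∂μ := by
  let e : A ≃+ A :=
    { toFun := fun x => τ * x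
      invFun := fun x => τ' * x
      left_inv := fun x => by linear_combination x * hτ
      right_inv := fun x => by linear_combination x * hτ
      map_add' := fun x y => mul_add _ _ _ }
  have he : Continuous e := continuous_const_mul τ
  have hes : Continuous e.symm := continuous_const_mul τ'
  have := e.isAddHaarMeasure_map μ he hes
  have hc := Measure.isAddLeftInvariant_eq_smul (μ.map e) μ
  refine ⟨Measure.addHaarScalarFactor (μ.map e) μ,
    Measure.addHaarScalarFactor_pos_of_isAddHaarMeasure _ _, fun f => ?_⟩
  have hm : MeasurableEmbedding e :=
    (Homeomorph.mk e.toEquiv he hes).toMeasurableEquiv.measurableEmbedding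
  have h1 := hm.integral_map (μ := μ) f
  rw [hc, integral_smul_nnreal_measure] at h1
  rw [← Complex.real_smul]
  exact h1.symm

theorem eq_zero_of_forall_integral_mul (μ : Measure A) [μ.IsAddHaarMeasure] {f : A → ℂ}
    (hf : Continuous f)
    (h : ∀ ρ : A → ℂ, Continuous ρ → HasCompactSupport ρ → ∫ x, ρ x * f x ∂μ = 0) (x : A) :
    f x = 0 := by
  obtain ⟨b, hbc, hb0, hbx⟩ := exists_continuous_nonneg_pos x
  have hb : Continuous b := b.continuous
  by_contra hx
  have hbc' : HasCompactSupport fun x => (b x : ℂ) * star (f x) := by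
    exact HasCompactSupport.mul_right (f := fun x => (b x : ℂ)) (f' := fun x => star (f x))
      (hbc.comp_left (g := fun t : ℝ => (t : ℂ)) Complex.ofReal_zero)
  have h1 := h (fun x => (b x : ℂ) * star (f x))
    (by fun_prop) hbc'
  have h2 : ∀ x, (b x : ℂ) * star (f x) * f x = ((b x * ‖f x‖ ^ 2 : ℝ) : ℂ) := fun x => by
    have h3 := Complex.conj_mul' (f x)
    rw [starRingEnd_apply] at h3
    rw [mul_assoc, h3, Complex.ofReal_mul, Complex.ofReal_pow]
  simp_rw [h2] at h1
  rw [integral_complex_ofReal] at h1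
  have h3 := Continuous.integral_pos_of_hasCompactSupport_nonneg_nonzero (μ := μ)
    (f := fun x => b x * ‖f x‖ ^ 2) (x := x) (by fun_prop)
    (hbc.mono fun y hy => left_ne_zero_of_mul hy)
    (fun y => mul_nonneg (hb0 y) (by positivity)) (mul_ne_zero hbx (by simpa using hx))
  exact h3.ne' (Complex.ofReal_injective h1)

/-- If the constant terms `∫ Z(c, s) dc` of two quasi-periodic functions agree up to a dilation,
the means over the second variable agree up to a positive factor. -/
theorem IsUnitDomain.exists_mean_eq [Countable Γ] (hD : IsUnitDomain Γ μ D)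
    (hdisc : ∃ U : Set A, IsOpen U ∧ 0 ∈ U ∧ ∀ γ ∈ Γ, γ ∈ U → γ = 0)
    (hcpt : ∃ C : Set A, IsCompact C ∧ ∀ x, ∃ γ ∈ Γ, x - γ ∈ C)
    {ψ : AddChar A Circle} (hψ : Continuous ψ)
    (hdual : IsDualFamily Γ fun γ : Γ => ψ.mulShift (γ : A)) {τ τ' : A} (hτ : τ * τ' = 1) :
    ∃ κ : ℝ, 0 < κ ∧ ∀ Z Z' : A → A → ℂ, Continuous (Function.uncurry Z) →
      Continuous (Function.uncurry Z') →
      (∀ c s, ∀ γ ∈ Γ, Z (c + γ) s = Z c s) → (∀ c s, ∀ γ ∈ Γ, Z' (c + γ) s = Z' c s) →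
      (∀ c s, ∀ γ ∈ Γ, Z c (s + γ) = (ψ (-(γ * c)) : Circle) * Z c s) →
      (∀ c s, ∀ γ ∈ Γ, Z' c (s + γ) = (ψ (-(γ * c)) : Circle) * Z' c s) →
      (∀ s, ∫ c in D, Z' c (τ * s) ∂μ = ∫ c in D, Z c s ∂μ) →
      ∫ s in D, Z' 0 s ∂μ = κ * ∫ s in D, Z 0 s ∂μ := by
  have := hD.haar
  have hν := hD.isPeriodMeasure
  obtain ⟨κ, hκ, hκi⟩ := exists_integral_comp_mul μ hτ
  refine ⟨κ⁻¹, inv_pos.2 hκ, fun Z Z' hZ hZ' hc hc' hs hs' hH => ?_⟩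
  have hψc : Continuous fun x : A => ((ψ x : Circle) : ℂ) := continuous_induced_dom.comp hψ
  let B : A → ℂ := fun c => ∫ s in D, (ψ (c * s) : Circle) * Z c s ∂μ
  let B' : A → ℂ := fun c => ∫ s in D, (ψ (c * s) : Circle) * Z' c s ∂μ
  have hB : Continuous B :=
    hν.continuous_integral (k := fun c s => (ψ (c * s) : Circle) * Z c s)
      ((hψc.comp (by fun_prop)).mul hZ)
  have hB' : Continuous B' :=
    hν.continuous_integral (k := fun c s => (ψ (c * s) : Circle) * Z' c s)
      ((hψc.comp (by fun_prop)).mul hZ')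
  have hBτ : Continuous fun c => B (τ * c) := hB.comp (continuous_const_mul τ)
  -- Distributionally, B and B' are the Fourier transforms of the constant terms H and H'. From H'(τ
  -- s) = H(s) follows B'(c) = κ⁻¹ B(τ c), where κ⁻¹ is the module of τ; by continuity this holds
  -- pointwise, and c = 0 gives the claim.
  have key := eq_zero_of_forall_integral_mul μ (f := fun c => B' c - ((κ⁻¹ : ℝ) : ℂ) * B (τ * c))
    (hB'.sub (continuous_const.mul hBτ)) (fun ρ hρ hρc => by
      have e1 := hD.integral_mul_mean hdisc hcpt hψ hdual hZ' hc' hs' hρ hρc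
      have hρ' : Continuous fun c => ρ (τ' * c) := hρ.comp (continuous_const_mul τ')
      have hρc' : HasCompactSupport fun c => ρ (τ' * c) := by
        have hτu : IsUnit τ' := IsUnit.of_mul_eq_one τ (by rw [mul_comm, hτ])
        exact hρc.comp_homeomorph (Homeomorph.mk ⟨fun c => τ' * c, fun c => τ * c,
          fun x => by linear_combination x * hτ, fun x => by linear_combination x * hτ⟩
          (continuous_const_mul τ') (continuous_const_mul τ))
      have e2 := hD.integral_mul_mean hdisc hcpt hψ hdual hZ hc hs hρ' hρc'
      have e3 := hκi fun s => (∫ c, ρ c * (ψ (c * s) : Circle) ∂μ) * ∫ c in D, Z' c s ∂μ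
      have e4 : ∀ s, ∫ c, ρ c * (ψ (c * (τ * s)) : Circle) ∂μ =
          κ * ∫ c, ρ (τ' * c) * (ψ (c * s) : Circle) ∂μ := fun s => by
        rw [← hκi fun c => ρ (τ' * c) * (ψ (c * s) : Circle)]
        congr 1; funext c
        rw [show τ' * (τ * c) = c by linear_combination c * hτ,
          show τ * c * s = c * (τ * s) by ring]
      simp_rw [hH, e4, mul_assoc] at e3
      rw [integral_const_mul, ← e1, ← e2] at e3
      have e5 := hκi fun c => ρ (τ' * c) * B c
      simp_rw [show ∀ c, τ' * (τ * c) = c from fun c => by linear_combination c * hτ] at e5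
      have hκ' : (κ : ℂ) ≠ 0 := by exact_mod_cast hκ.ne'
      have e6 := mul_left_cancel₀ hκ' e3
      have hi1 : Integrable (fun c => ρ c * B' c) μ :=
        (hρ.mul hB').integrable_of_hasCompactSupport hρc.mul_right
      have hi2 : Integrable (fun c => ρ c * B (τ * c)) μ :=
        (hρ.mul hBτ).integrable_of_hasCompactSupport hρc.mul_right
      have e7 : ∀ c, ρ c * (B' c - ((κ⁻¹ : ℝ) : ℂ) * B (τ * c)) =
          ρ c * B' c - (κ⁻¹ : ℝ) * (ρ c * B (τ * c)) := fun c => by ring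
      simp_rw [e7]
      rw [integral_sub hi1 (hi2.const_mul _), integral_const_mul, e5, ← e6]
      push_cast
      rw [inv_mul_cancel_left₀ hκ', sub_self]) 0
  simpa [B, B', sub_eq_zero] using key

end Unfolding

/-! ### Root subgroups of `U_{2,2}` -/

namespace U22
open Matrix QuadExt

section Roots

variable {R : Type*} [CommRing R] {δ : R}

/-- The element of `U_{2,2}(R)` with a given matrix. -/
def ofMatrix (M : Matrix (Fin 4) (Fin 4) (QuadraticAlgebra R δ 0))
    (hM : Mᴴ * antidiag _ * M = antidiag _) : group R δ :=
  have h : antidiag _ * Mᴴ * antidiag _ * M = 1 := by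
    rw [Matrix.mul_assoc, Matrix.mul_assoc, ← Matrix.mul_assoc _ (antidiag _) M, hM,
      antidiag_mul_antidiag]
  ⟨⟨M, antidiag _ * Mᴴ * antidiag _, mul_eq_one_comm.1 h, h⟩, hM⟩

@[simp] theorem mat_ofMatrix (M : Matrix (Fin 4) (Fin 4) (QuadraticAlgebra R δ 0))
    (hM : Mᴴ * antidiag _ * M = antidiag _) : mat (ofMatrix M hM) = M := rfl

theorem mat_injective : Function.Injective (mat : group R δ → _) := fun _ _ h =>
  Subtype.ext (Units.ext h)

theorem mat_one : mat (1 : group R δ) = 1 := rfl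

/-- The element `c √δ`. -/
def sqrtMul (c : R) : QuadraticAlgebra R δ 0 := ⟨0, c⟩

/-- The element `c` of the base ring. -/
def ofBase (c : R) : QuadraticAlgebra R δ 0 := ⟨c, 0⟩

@[simp] theorem re_sqrtMul (c : R) : (sqrtMul c : QuadraticAlgebra R δ 0).re = 0 := rfl
@[simp] theorem im_sqrtMul (c : R) : (sqrtMul c : QuadraticAlgebra R δ 0).im = c := rfl
@[simp] theorem re_ofBase (c : R) : (ofBase c : QuadraticAlgebra R δ 0).re = c := rfl
@[simp] theorem im_ofBase (c : R) : (ofBase c : QuadraticAlgebra R δ 0).im = 0 := rfl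

/-- The root element with entry `a` at `(0, 1)`. -/
def rootU (a : QuadraticAlgebra R δ 0) : group R δ :=
  ofMatrix !![1, a, 0, 0; 0, 1, 0, 0; 0, 0, 1, -star a; 0, 0, 0, 1] (by
    ext i j
    all_goals
      rw [Matrix.mul_apply, Fin.sum_univ_four]
      simp only [mul_antidiag]
      fin_cases i <;> fin_cases j <;> simp [antidiag, conjTranspose_apply])

/-- The root element with entry `b` at `(0, 2)`. -/
def rootX (b : QuadraticAlgebra R δ 0) : group R δ :=
  ofMatrix !![1, 0, b, 0; 0, 1, 0, -star b; 0, 0, 1, 0; 0, 0, 0, 1] (by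
    ext i j
    all_goals
      rw [Matrix.mul_apply, Fin.sum_univ_four]
      simp only [mul_antidiag]
      fin_cases i <;> fin_cases j <;> simp [antidiag, conjTranspose_apply])

/-- The root element with entry `e √δ` at `(0, 3)`. -/
def rootZ (e : R) : group R δ :=
  ofMatrix !![1, 0, 0, sqrtMul e; 0, 1, 0, 0; 0, 0, 1, 0; 0, 0, 0, 1] (by
    ext i j
    all_goals
      rw [Matrix.mul_apply, Fin.sum_univ_four]
      simp only [mul_antidiag]
      fin_cases i <;> fin_cases j <;> simp [antidiag, conjTranspose_apply])

/-- The root element with entry `c √δ` at `(1, 2)`. -/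
def rootY (c : R) : group R δ :=
  ofMatrix !![1, 0, 0, 0; 0, 1, sqrtMul c, 0; 0, 0, 1, 0; 0, 0, 0, 1] (by
    ext i j
    all_goals
      rw [Matrix.mul_apply, Fin.sum_univ_four]
      simp only [mul_antidiag]
      fin_cases i <;> fin_cases j <;> simp [antidiag, conjTranspose_apply])

/-- The root element with entry `c √δ` at `(2, 1)`. -/
def rootYNeg (c : R) : group R δ :=
  ofMatrix !![1, 0, 0, 0; 0, 1, 0, 0; 0, sqrtMul c, 1, 0; 0, 0, 0, 1] (by
    ext i j
    all_goals
      rw [Matrix.mul_apply, Fin.sum_univ_four]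
      simp only [mul_antidiag]
      fin_cases i <;> fin_cases j <;> simp [antidiag, conjTranspose_apply])

/-- The root element with entry `b` in the base ring at `(1, 0)`. -/
def rootUNeg (b : R) : group R δ :=
  ofMatrix !![1, 0, 0, 0; ofBase b, 1, 0, 0; 0, 0, 1, 0; 0, 0, -ofBase b, 1] (by
    ext i j
    all_goals
      rw [Matrix.mul_apply, Fin.sum_univ_four]
      simp only [mul_antidiag]
      fin_cases i <;> fin_cases j <;> simp [antidiag, conjTranspose_apply])

/-- A Weyl element in the Levi factor of the stabilizer of the plane spanned by `e₁, e₂`. -/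
def weylU : group R δ :=
  ofMatrix !![0, 1, 0, 0; -1, 0, 0, 0; 0, 0, 0, -1; 0, 0, 1, 0] (by
    ext i j
    all_goals
      rw [Matrix.mul_apply, Fin.sum_univ_four]
      simp only [mul_antidiag]
      fin_cases i <;> fin_cases j <;> simp [antidiag, conjTranspose_apply])

/-- The Weyl element that interchanges `e₂` and `e₋₂`. -/
def weylY : group R δ :=
  ofMatrix !![1, 0, 0, 0; 0, 0, 1, 0; 0, 1, 0, 0; 0, 0, 0, 1] (by
    ext i j
    all_goals
      rw [Matrix.mul_apply, Fin.sum_univ_four]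
      simp only [mul_antidiag]
      fin_cases i <;> fin_cases j <;> simp [antidiag, conjTranspose_apply])

/-- The diagonal element `diag(T, T⁻¹, T, T⁻¹)`. -/
def torusT (T T' : R) (h : T * T' = 1) : group R δ :=
  ofMatrix !![ofBase T, 0, 0, 0; 0, ofBase T', 0, 0; 0, 0, ofBase T, 0; 0, 0, 0, ofBase T'] (by
    have h' : T' * T = 1 := by rw [mul_comm, h]
    ext i j
    all_goals
      rw [Matrix.mul_apply, Fin.sum_univ_four]
      simp only [mul_antidiag]
      fin_cases i <;> fin_cases j <;> simp [antidiag, conjTranspose_apply, h, h',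
        QuadraticAlgebra.re_one, QuadraticAlgebra.im_one])

/-- The diagonal element `diag(β, 1, 1, star β⁻¹)`. -/
def torusM (β β' : QuadraticAlgebra R δ 0) (h : β * β' = 1) : group R δ :=
  ofMatrix !![β, 0, 0, 0; 0, 1, 0, 0; 0, 0, 1, 0; 0, 0, 0, star β'] (by
    have h' : β' * β = 1 := by rw [mul_comm, h]
    have h1 : star β * star β' = 1 := by rw [← star_mul', h, star_one]
    refine Matrix.ext fun i j => ?_
    rw [Matrix.mul_apply, Fin.sum_univ_four]
    simp only [mul_antidiag]
    fin_cases i <;> fin_cases j <;> simp [antidiag, conjTranspose_apply, h', h1])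

theorem mat_rootU (a : QuadraticAlgebra R δ 0) :
    mat (rootU a : group R δ) =
      !![1, a, 0, 0; 0, 1, 0, 0; 0, 0, 1, -star a; 0, 0, 0, 1] := rfl

theorem mat_rootX (b : QuadraticAlgebra R δ 0) :
    mat (rootX b : group R δ) =
      !![1, 0, b, 0; 0, 1, 0, -star b; 0, 0, 1, 0; 0, 0, 0, 1] := rfl

theorem mat_rootZ (e : R) :
    mat (rootZ e : group R δ) =
      !![1, 0, 0, sqrtMul e; 0, 1, 0, 0; 0, 0, 1, 0; 0, 0, 0, 1] := rfl

theorem mat_rootY (c : R) :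
    mat (rootY c : group R δ) =
      !![1, 0, 0, 0; 0, 1, sqrtMul c, 0; 0, 0, 1, 0; 0, 0, 0, 1] := rfl

theorem mat_rootYNeg (c : R) :
    mat (rootYNeg c : group R δ) =
      !![1, 0, 0, 0; 0, 1, 0, 0; 0, sqrtMul c, 1, 0; 0, 0, 0, 1] := rfl

theorem mat_rootUNeg (b : R) :
    mat (rootUNeg b : group R δ) =
      !![1, 0, 0, 0; ofBase b, 1, 0, 0; 0, 0, 1, 0; 0, 0, -ofBase b, 1] := rfl

theorem mat_weylU :
    mat (weylU : group R δ) =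
      !![0, 1, 0, 0; -1, 0, 0, 0; 0, 0, 0, -1; 0, 0, 1, 0] := rfl

theorem mat_weylY :
    mat (weylY : group R δ) =
      !![1, 0, 0, 0; 0, 0, 1, 0; 0, 1, 0, 0; 0, 0, 0, 1] := rfl

theorem mat_torusT (T T' : R) (h : T * T' = 1) :
    mat (torusT T T' h : group R δ) =
      !![ofBase T, 0, 0, 0; 0, ofBase T', 0, 0; 0, 0, ofBase T, 0; 0, 0, 0, ofBase T'] := rfl

theorem mat_torusM (β β' : QuadraticAlgebra R δ 0) (h : β * β' = 1) :
    mat (torusM β β' h : group R δ) =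
      !![β, 0, 0, 0; 0, 1, 0, 0; 0, 0, 1, 0; 0, 0, 0, star β'] := rfl

/-! ### Relations between root, Weyl and torus elements -/

theorem rootU_add (a a' : QuadraticAlgebra R δ 0) : rootU (a + a') = rootU a * rootU a' := by
  refine mat_injective (Matrix.ext fun i j => ?_)
  rw [mat_mul, Matrix.mul_apply, Fin.sum_univ_four]
  fin_cases i <;> fin_cases j <;> simp [mat_rootU, add_comm]

theorem rootX_add (a a' : QuadraticAlgebra R δ 0) : rootX (a + a') = rootX a * rootX a' := by
  refine mat_injective (Matrix.ext fun i j => ?_)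
  rw [mat_mul, Matrix.mul_apply, Fin.sum_univ_four]
  fin_cases i <;> fin_cases j <;> simp [mat_rootX, add_comm]

theorem rootZ_add (a a' : R) : (rootZ (a + a') : group R δ) = rootZ a * rootZ a' := by
  refine mat_injective (Matrix.ext fun i j => ?_)
  rw [mat_mul, Matrix.mul_apply, Fin.sum_univ_four]
  fin_cases i <;> fin_cases j <;> simp [mat_rootZ] <;> ext <;> simp [add_comm]

theorem rootY_add (a a' : R) : (rootY (a + a') : group R δ) = rootY a * rootY a' := by
  refine mat_injective (Matrix.ext fun i j => ?_)
  rw [mat_mul, Matrix.mul_apply, Fin.sum_univ_four]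
  fin_cases i <;> fin_cases j <;> simp [mat_rootY] <;> ext <;> simp [add_comm]

theorem rootYNeg_add (a a' : R) : (rootYNeg (a + a') : group R δ) = rootYNeg a * rootYNeg a' := by
  refine mat_injective (Matrix.ext fun i j => ?_)
  rw [mat_mul, Matrix.mul_apply, Fin.sum_univ_four]
  fin_cases i <;> fin_cases j <;> simp [mat_rootYNeg] <;> ext <;> simp

theorem rootX_mul_rootZ (b : QuadraticAlgebra R δ 0) (e : R) :
    rootX b * rootZ e = rootZ e * rootX b := by
  refine mat_injective (Matrix.ext fun i j => ?_)
  rw [mat_mul, mat_mul, Matrix.mul_apply, Matrix.mul_apply, Fin.sum_univ_four, Fin.sum_univ_four]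
  fin_cases i <;> fin_cases j <;> simp [mat_rootX, mat_rootZ]

theorem rootX_mul_rootY (b : QuadraticAlgebra R δ 0) (c : R) :
    rootX b * rootY c = rootY c * rootX b := by
  refine mat_injective (Matrix.ext fun i j => ?_)
  rw [mat_mul, mat_mul, Matrix.mul_apply, Matrix.mul_apply, Fin.sum_univ_four, Fin.sum_univ_four]
  fin_cases i <;> fin_cases j <;> simp [mat_rootX, mat_rootY]

theorem rootZ_mul_rootY (e c : R) :
    (rootZ e * rootY c : group R δ) = rootY c * rootZ e := by
  refine mat_injective (Matrix.ext fun i j => ?_)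
  rw [mat_mul, mat_mul, Matrix.mul_apply, Matrix.mul_apply, Fin.sum_univ_four, Fin.sum_univ_four]
  fin_cases i <;> fin_cases j <;> simp [mat_rootZ, mat_rootY]

theorem rootZ_mul_rootU (e : R) (a : QuadraticAlgebra R δ 0) :
    rootZ e * rootU a = rootU a * rootZ e := by
  refine mat_injective (Matrix.ext fun i j => ?_)
  rw [mat_mul, mat_mul, Matrix.mul_apply, Matrix.mul_apply, Fin.sum_univ_four, Fin.sum_univ_four]
  fin_cases i <;> fin_cases j <;> simp [mat_rootZ, mat_rootU]

theorem mat_rootX_mul_rootZ (b : QuadraticAlgebra R δ 0) (e : R) :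
    mat (rootX b * rootZ e) =
      !![1, 0, b, sqrtMul e; 0, 1, 0, -star b; 0, 0, 1, 0; 0, 0, 0, 1] := by
  refine Matrix.ext fun i j => ?_
  rw [mat_mul, Matrix.mul_apply, Fin.sum_univ_four]
  fin_cases i <;> fin_cases j <;> simp [mat_rootX, mat_rootZ]

theorem mat_rootX_mul_rootZ_mul_rootU (b a : QuadraticAlgebra R δ 0) (e : R) :
    mat (rootX b * rootZ e * rootU a) =
      !![1, a, b, sqrtMul e - b * star a; 0, 1, 0, -star b; 0, 0, 1, -star a; 0, 0, 0, 1] := by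
  refine Matrix.ext fun i j => ?_
  rw [mat_mul, mat_rootX_mul_rootZ, Matrix.mul_apply, Fin.sum_univ_four]
  fin_cases i <;> fin_cases j <;> simp [mat_rootU]
  ring

theorem mat_rootX_mul_rootZ_mul_rootU_mul_rootY (b a : QuadraticAlgebra R δ 0) (e c : R) :
    mat (rootX b * rootZ e * rootU a * rootY c) =
      !![1, a, b + a * sqrtMul c, sqrtMul e - b * star a; 0, 1, sqrtMul c, -star b;
        0, 0, 1, -star a; 0, 0, 0, 1] := by
  refine Matrix.ext fun i j => ?_
  rw [mat_mul, mat_rootX_mul_rootZ_mul_rootU, Matrix.mul_apply, Fin.sum_univ_four]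
  fin_cases i <;> fin_cases j <;> simp [mat_rootY]
  ring

/-- Heisenberg relation: u and x commute up to the central root subgroup z, which is always averaged
out. -/
theorem rootU_mul_rootX (a b : QuadraticAlgebra R δ 0) :
    rootU a * rootX b = rootX b * rootZ (2 * (b * star a).im) * rootU a := by
  refine mat_injective (Matrix.ext fun i j => ?_)
  rw [mat_rootX_mul_rootZ_mul_rootU, mat_mul, Matrix.mul_apply, Fin.sum_univ_four]
  fin_cases i <;> fin_cases j <;> simp [mat_rootX, mat_rootU]
  ext <;> simp <;> ring

/-- The commutator contains x(-a c√δ); evaluating the character Re b on it yields the cocycle -δ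
Im(a) c behind the quasi-periodicity used later. -/
theorem rootY_mul_rootU (c : R) (a : QuadraticAlgebra R δ 0) :
    rootY c * rootU a =
      rootX (-(a * sqrtMul c)) * rootZ (-((a * star a).re * c)) * rootU a * rootY c := by
  refine mat_injective (Matrix.ext fun i j => ?_)
  rw [mat_rootX_mul_rootZ_mul_rootU_mul_rootY, mat_mul, Matrix.mul_apply, Fin.sum_univ_four]
  fin_cases i <;> fin_cases j <;> simp [mat_rootU, mat_rootY] <;> ext <;> simp <;> ring

theorem rootX_mul_weylU (b : QuadraticAlgebra R δ 0) :
    rootX b * weylU = weylU * rootX (star b) := by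
  refine mat_injective (Matrix.ext fun i j => ?_)
  rw [mat_mul, mat_mul, Matrix.mul_apply, Matrix.mul_apply, Fin.sum_univ_four, Fin.sum_univ_four]
  fin_cases i <;> fin_cases j <;> simp [mat_rootX, mat_weylU]

theorem rootZ_mul_weylU (e : R) : (rootZ e * weylU : group R δ) = weylU * rootY e := by
  refine mat_injective (Matrix.ext fun i j => ?_)
  rw [mat_mul, mat_mul, Matrix.mul_apply, Matrix.mul_apply, Fin.sum_univ_four, Fin.sum_univ_four]
  fin_cases i <;> fin_cases j <;> simp [mat_rootZ, mat_rootY, mat_weylU]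

theorem rootY_mul_weylU (c : R) : (rootY c * weylU : group R δ) = weylU * rootZ c := by
  refine mat_injective (Matrix.ext fun i j => ?_)
  rw [mat_mul, mat_mul, Matrix.mul_apply, Matrix.mul_apply, Fin.sum_univ_four, Fin.sum_univ_four]
  fin_cases i <;> fin_cases j <;> simp [mat_rootZ, mat_rootY, mat_weylU]

/-- On the Siegel radical this Weyl element exchanges the two diagonal coordinates and conjugates
the off-diagonal one, so it preserves Re b. -/
theorem rootX_mul_rootZ_mul_rootY_mul_weylU (b : QuadraticAlgebra R δ 0) (e c : R) :
    rootX b * rootZ e * rootY c * weylU = weylU * (rootX (star b) * rootZ c * rootY e) := by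
  rw [mul_assoc, rootY_mul_weylU, ← mul_assoc, mul_assoc (rootX b), rootZ_mul_weylU, ← mul_assoc,
    rootX_mul_weylU, mul_assoc _ (rootY e), ← rootZ_mul_rootY, mul_assoc, mul_assoc]

theorem weylU_mul_rootU (b : R) :
    (weylU * rootU (ofBase b) : group R δ) = rootUNeg (-b) * weylU := by
  refine mat_injective (Matrix.ext fun i j => ?_)
  simp only [mat_mul, Matrix.mul_apply, Fin.sum_univ_four]
  fin_cases i <;> fin_cases j <;> simp [mat_rootU, mat_weylU, mat_rootUNeg] <;> ext <;> simp

theorem mat_rootU_mul_rootUNeg (T T' : R) :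
    (mat (rootU (ofBase T) * rootUNeg T' : group R δ)) =
      !![ofBase (1 + T * T'), ofBase T, 0, 0; ofBase T', 1, 0, 0;
        0, 0, ofBase (1 + T * T'), -ofBase T; 0, 0, -ofBase T', 1] := by
  refine Matrix.ext fun i j => ?_
  rw [mat_mul, Matrix.mul_apply, Fin.sum_univ_four]
  fin_cases i <;> fin_cases j <;> simp [mat_rootU, mat_rootUNeg] <;> ext <;>
    simp [QuadraticAlgebra.re_one, QuadraticAlgebra.im_one]

theorem mat_rootU_mul_rootUNeg_mul_rootU (T T' : R) (h : T * T' = 1) :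
    (mat (rootU (ofBase T) * rootUNeg (-T') * rootU (ofBase T) : group R δ)) =
      !![0, ofBase T, 0, 0; -ofBase T', 0, 0, 0; 0, 0, 0, -ofBase T; 0, 0, ofBase T', 0] := by
  have h' : T' * T = 1 := by rw [mul_comm, h]
  refine Matrix.ext fun i j => ?_
  rw [mat_mul, mat_rootU_mul_rootUNeg, Matrix.mul_apply, Fin.sum_univ_four]
  fin_cases i <;> fin_cases j <;> simp [mat_rootU] <;> ext <;>
    simp [QuadraticAlgebra.re_one, QuadraticAlgebra.im_one, h, h']

/-- The SL₂ identity h(T) = w(T) w(-1), with w(T) = u(T) u⁻(-T⁻¹) u(T). -/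
theorem torusT_eq (T T' : R) (h : T * T' = 1) :
    (torusT T T' h : group R δ) = rootU (ofBase T) * rootUNeg (-T') * rootU (ofBase T) *
      (rootU (ofBase (-1)) * rootUNeg (-(-1)) * rootU (ofBase (-1))) := by
  refine mat_injective (Matrix.ext fun i j => ?_)
  rw [mat_mul, mat_rootU_mul_rootUNeg_mul_rootU T T' h,
    mat_rootU_mul_rootUNeg_mul_rootU (-1) (-1) (by ring), Matrix.mul_apply, Fin.sum_univ_four]
  fin_cases i <;> fin_cases j <;> simp [mat_torusT] <;> ext <;> simp

theorem torusT_mul_rootU (T T' : R) (h : T * T' = 1) (s : R) :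
    (torusT T T' h * rootU (sqrtMul s) : group R δ) =
      rootU (sqrtMul (T * T * s)) * torusT T T' h := by
  refine mat_injective (Matrix.ext fun i j => ?_)
  simp only [mat_mul, Matrix.mul_apply, Fin.sum_univ_four]
  fin_cases i <;> fin_cases j <;> simp [mat_rootU, mat_torusT] <;> ext <;> simp <;>
    linear_combination (-T * s) * h

theorem torusT_mul_rootYNeg (T T' : R) (h : T * T' = 1) (c : R) :
    (torusT T T' h * rootYNeg c : group R δ) = rootYNeg (T * T * c) * torusT T T' h := by
  refine mat_injective (Matrix.ext fun i j => ?_)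
  simp only [mat_mul, Matrix.mul_apply, Fin.sum_univ_four]
  fin_cases i <;> fin_cases j <;> simp [mat_rootYNeg, mat_torusT] <;> ext <;> simp <;>
    linear_combination (-T * c) * h

/-- Moving y⁻ to the left changes a and e but not b. Hence it preserves the character Re b of N₁,
which belongs to the isotropic vector e₂. -/
theorem rootX_mul_rootZ_mul_rootU_mul_rootYNeg (b a : QuadraticAlgebra R δ 0) (e c : R) :
    rootX b * rootZ e * rootU a * rootYNeg c = rootYNeg c *
      (rootX b * rootZ (-((b * star b).re * c) + e) * rootU (a + b * sqrtMul c)) := by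
  refine mat_injective (Matrix.ext fun i j => ?_)
  rw [mat_mul _ (rootYNeg c), mat_mul (rootYNeg c), mat_rootX_mul_rootZ_mul_rootU,
    mat_rootX_mul_rootZ_mul_rootU,
    Matrix.mul_apply, Matrix.mul_apply, Fin.sum_univ_four, Fin.sum_univ_four]
  fin_cases i <;> fin_cases j <;> simp [mat_rootYNeg] <;> ext <;> simp <;> ring

/-- Exchanging u and x moves the Whittaker character from the u-coordinate to the x-coordinate,
where the isotropic character lives, and turns y into y⁻. -/
theorem weylY_semiconj (b a : QuadraticAlgebra R δ 0) (e c : R) :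
    SemiconjBy weylY (rootX b * rootZ e * rootU a * rootY c)
      (rootU b * rootZ e * rootX a * rootYNeg c) := by
  have h1 : SemiconjBy weylY (rootX b) (rootU b) := by
    refine mat_injective (Matrix.ext fun i j => ?_)
    rw [mat_mul, mat_mul, Matrix.mul_apply, Matrix.mul_apply, Fin.sum_univ_four, Fin.sum_univ_four]
    fin_cases i <;> fin_cases j <;> simp [mat_rootX, mat_rootU, mat_weylY]
  have h2 : SemiconjBy weylY (rootU a) (rootX a) := by
    refine mat_injective (Matrix.ext fun i j => ?_)
    rw [mat_mul, mat_mul, Matrix.mul_apply, Matrix.mul_apply, Fin.sum_univ_four, Fin.sum_univ_four]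
    fin_cases i <;> fin_cases j <;> simp [mat_rootX, mat_rootU, mat_weylY]
  have h3 : SemiconjBy (weylY : group R δ) (rootZ e) (rootZ e) := by
    refine mat_injective (Matrix.ext fun i j => ?_)
    rw [mat_mul, mat_mul, Matrix.mul_apply, Matrix.mul_apply, Fin.sum_univ_four, Fin.sum_univ_four]
    fin_cases i <;> fin_cases j <;> simp [mat_rootZ, mat_weylY]
  have h4 : SemiconjBy (weylY : group R δ) (rootY c) (rootYNeg c) := by
    refine mat_injective (Matrix.ext fun i j => ?_)
    rw [mat_mul, mat_mul, Matrix.mul_apply, Matrix.mul_apply, Fin.sum_univ_four, Fin.sum_univ_four]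
    fin_cases i <;> fin_cases j <;> simp [mat_rootY, mat_rootYNeg, mat_weylY]
  exact ((h1.mul_right h3).mul_right h2).mul_right h4

theorem torusM_mul_rootU (β β' : QuadraticAlgebra R δ 0) (h : β * β' = 1)
    (b : QuadraticAlgebra R δ 0) : torusM β β' h * rootU b = rootU (β * b) * torusM β β' h := by
  have h0 : star β' * star β = 1 := by rw [mul_comm, ← star_mul', h, star_one]
  refine mat_injective (Matrix.ext fun i j => ?_)
  rw [mat_mul, mat_mul, mat_torusM, Matrix.mul_apply, Matrix.mul_apply, Fin.sum_univ_four,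
    Fin.sum_univ_four]
  fin_cases i <;> fin_cases j <;> simp [mat_rootU]
  linear_combination (-star b) * h0

theorem torusM_mul_rootX (β β' : QuadraticAlgebra R δ 0) (h : β * β' = 1)
    (b : QuadraticAlgebra R δ 0) : torusM β β' h * rootX b = rootX (β * b) * torusM β β' h := by
  have h0 : star β' * star β = 1 := by rw [mul_comm, ← star_mul', h, star_one]
  refine mat_injective (Matrix.ext fun i j => ?_)
  rw [mat_mul, mat_mul, mat_torusM, Matrix.mul_apply, Matrix.mul_apply, Fin.sum_univ_four,
    Fin.sum_univ_four]
  fin_cases i <;> fin_cases j <;> simp [mat_rootX]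
  linear_combination (-star b) * h0

theorem torusM_mul_rootZ (β β' : QuadraticAlgebra R δ 0) (h : β * β' = 1) (e : R) :
    torusM β β' h * rootZ e = rootZ ((β * star β).re * e) * torusM β β' h := by
  have h0 : star β' * star β = 1 := by rw [mul_comm, ← star_mul', h, star_one]
  have h4 : (sqrtMul ((β * star β).re * e) : QuadraticAlgebra R δ 0) =
      β * star β * sqrtMul e := by
    ext <;> simp <;> ring
  generalize (β * star β).re * e = e' at h4
  refine mat_injective (Matrix.ext fun i j => ?_)
  rw [mat_mul, mat_mul, mat_torusM, Matrix.mul_apply, Matrix.mul_apply, Fin.sum_univ_four,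
    Fin.sum_univ_four]
  fin_cases i <;> fin_cases j <;> simp [mat_rootZ]
  rw [h4]
  linear_combination (-β * sqrtMul e) * h0

theorem torusM_mul_rootYNeg (β β' : QuadraticAlgebra R δ 0) (h : β * β' = 1) (c : R) :
    torusM β β' h * rootYNeg c = rootYNeg c * torusM β β' h := by
  refine mat_injective (Matrix.ext fun i j => ?_)
  rw [mat_mul, mat_mul, mat_torusM, Matrix.mul_apply, Matrix.mul_apply, Fin.sum_univ_four,
    Fin.sum_univ_four]
  fin_cases i <;> fin_cases j <;> simp [mat_rootYNeg]

theorem torusM_semiconj (β β' : QuadraticAlgebra R δ 0) (h : β * β' = 1)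
    (b a : QuadraticAlgebra R δ 0) (e c : R) :
    SemiconjBy (torusM β β' h) (rootU b * rootZ e * rootX a * rootYNeg c)
      (rootU (β * b) * rootZ ((β * star β).re * e) * rootX (β * a) * rootYNeg c) :=
  (((show SemiconjBy _ _ _ from torusM_mul_rootU β β' h b).mul_right
    (torusM_mul_rootZ β β' h e)).mul_right (torusM_mul_rootX β β' h a)).mul_right
    (torusM_mul_rootYNeg β β' h c)

theorem mapGroup_eq_of_mat {S : Type*} [CommRing S] (f : R →+* S) (g : group R δ)
    (g' : group S (f δ)) (h : (mat g).map (mapHom f δ) = mat g') : mapGroup f δ g = g' :=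
  mat_injective h

end Roots
end U22

/-! ### Topology of `R[√d]` and of `U_{2,2}(R)` -/

namespace QuadExt
variable {R : Type*} [CommRing R] [TopologicalSpace R] [IsTopologicalRing R] {a b : R}

/-- `R[√d]` is homeomorphic to `R × R`. -/
def homeoProd : QuadraticAlgebra R a b ≃ₜ R × R :=
  (QuadraticAlgebra.equivProd a b).toHomeomorphOfIsInducing ⟨rfl⟩

theorem continuous_iff {X : Type*} [TopologicalSpace X] {f : X → QuadraticAlgebra R a b} :
    Continuous f ↔ Continuous (fun x => (f x).re) ∧ Continuous fun x => (f x).im := by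
  rw [← homeoProd.comp_continuous_iff]
  exact continuous_prodMk

@[fun_prop] theorem continuous_re : Continuous fun z : QuadraticAlgebra R a b => z.re :=
  (continuous_iff.1 continuous_id).1

@[fun_prop] theorem continuous_im : Continuous fun z : QuadraticAlgebra R a b => z.im :=
  (continuous_iff.1 continuous_id).2

instance : IsTopologicalRing (QuadraticAlgebra R a b) where
  continuous_add := continuous_iff.2 ⟨by simp only [QuadraticAlgebra.re_add]; fun_prop,
    by simp only [QuadraticAlgebra.im_add]; fun_prop⟩
  continuous_mul := continuous_iff.2 ⟨by simp only [QuadraticAlgebra.re_mul]; fun_prop,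
    by simp only [QuadraticAlgebra.im_mul]; fun_prop⟩
  continuous_neg := continuous_iff.2 ⟨by simp only [QuadraticAlgebra.re_neg]; fun_prop,
    by simp only [QuadraticAlgebra.im_neg]; fun_prop⟩

instance : ContinuousStar (QuadraticAlgebra R a 0) where
  continuous_star := continuous_iff.2 ⟨by simp; fun_prop, by simp; fun_prop⟩

instance [T2Space R] : T2Space (QuadraticAlgebra R a b) :=
  homeoProd.isEmbedding.t2Space

instance [SecondCountableTopology R] : SecondCountableTopology (QuadraticAlgebra R a b) :=
  homeoProd.secondCountableTopology

instance [LocallyCompactSpace R] : LocallyCompactSpace (QuadraticAlgebra R a b) :=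
  homeoProd.isClosedEmbedding.locallyCompactSpace

end QuadExt

namespace U22
open Matrix QuadExt

section Topology

variable {R : Type*} [CommRing R] [TopologicalSpace R] [IsTopologicalRing R] {δ : R}

/-- For unitary matrices the inverse is a continuous function of the matrix, so the topology of the
unit group is that of the entries. -/
theorem isInducing_mat : Topology.IsInducing (mat : group R δ → _) := by
  let h : Matrix (Fin 4) (Fin 4) (QuadraticAlgebra R δ 0) →
      Matrix (Fin 4) (Fin 4) (QuadraticAlgebra R δ 0) ×
        (Matrix (Fin 4) (Fin 4) (QuadraticAlgebra R δ 0))ᵐᵒᵖ :=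
    fun M => (M, MulOpposite.op (antidiag _ * Mᴴ * antidiag _))
  have hh : Continuous h := by
    refine continuous_id.prodMk (MulOpposite.continuous_op.comp ?_)
    exact (continuous_const.matrix_mul continuous_id.matrix_conjTranspose).matrix_mul
      continuous_const
  have hmat : Continuous (mat : group R δ → _) := Units.continuous_val.comp continuous_subtype_val
  refine Topology.IsInducing.of_comp hmat hh ?_
  have h1 : h ∘ (mat : group R δ → _) = Units.embedProduct _ ∘ Subtype.val := by
    funext g
    exact Prod.ext rfl (congrArg MulOpposite.op (mat_inv g).symm)
  rw [h1]
  exact Units.isEmbedding_embedProduct.isInducing.comp Topology.IsInducing.subtypeVal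

theorem continuous_mat : Continuous (mat : group R δ → _) := isInducing_mat.continuous

theorem continuous_of_mat {X : Type*} [TopologicalSpace X] {f : X → group R δ}
    (h : ∀ i j, Continuous fun x => mat (f x) i j) : Continuous f :=
  isInducing_mat.continuous_iff.2 (continuous_matrix h)

theorem isClosedEmbedding_mat [T2Space R] :
    Topology.IsClosedEmbedding (mat : group R δ → _) := by
  refine ⟨⟨isInducing_mat, mat_injective⟩, ?_⟩
  have h : Set.range (mat : group R δ → _) = {M | Mᴴ * antidiag _ * M = antidiag _} := by
    ext M
    exact ⟨fun ⟨g, hg⟩ => hg ▸ g.2, fun hM => ⟨ofMatrix M hM, rfl⟩⟩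
  rw [h]
  exact isClosed_eq ((continuous_id.matrix_conjTranspose.matrix_mul continuous_const).matrix_mul
    continuous_id) continuous_const

instance [T2Space R] [LocallyCompactSpace R] : LocallyCompactSpace (group R δ) :=
  have : LocallyCompactSpace (Matrix (Fin 4) (Fin 4) (QuadraticAlgebra R δ 0)) :=
    inferInstanceAs (LocallyCompactSpace (Fin 4 → Fin 4 → QuadraticAlgebra R δ 0))
  isClosedEmbedding_mat.locallyCompactSpace

instance [SecondCountableTopology R] : SecondCountableTopology (group R δ) :=
  have : SecondCountableTopology (Matrix (Fin 4) (Fin 4) (QuadraticAlgebra R δ 0)) :=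
    inferInstanceAs (SecondCountableTopology (Fin 4 → Fin 4 → QuadraticAlgebra R δ 0))
  isInducing_mat.secondCountableTopology

theorem isClosed_unipotentRadical [T2Space R] (w : Fin 4 → ℕ)
    (hw : ∀ i j, w i ≤ w j → w j.rev ≤ w i.rev) :
    IsClosed (unipotentRadical R δ w hw : Set (group R δ)) := by
  have h : (unipotentRadical R δ w hw : Set (group R δ)) =
      ⋂ (i) (j) (_ : w i ≤ w j), {g | mat g i j = if i = j then 1 else 0} := by
    ext g
    simp only [Set.mem_iInter]
    rfl
  rw [h]
  exact isClosed_iInter fun i => isClosed_iInter fun j => isClosed_iInter fun _ =>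
    isClosed_eq (continuous_mat.matrix_elem i j) continuous_const

@[fun_prop] theorem continuous_sqrtMul :
    Continuous (sqrtMul : R → QuadraticAlgebra R δ 0) :=
  QuadExt.continuous_iff.2 ⟨continuous_const, continuous_id⟩

@[fun_prop] theorem continuous_rootU :
    Continuous (rootU : QuadraticAlgebra R δ 0 → group R δ) :=
  continuous_of_mat fun i j => by
    fin_cases i <;> fin_cases j <;> simp [mat_rootU] <;> fun_prop

@[fun_prop] theorem continuous_rootX :
    Continuous (rootX : QuadraticAlgebra R δ 0 → group R δ) :=
  continuous_of_mat fun i j => by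
    fin_cases i <;> fin_cases j <;> simp [mat_rootX] <;> fun_prop

@[fun_prop] theorem continuous_rootZ : Continuous (rootZ : R → group R δ) :=
  continuous_of_mat fun i j => by
    fin_cases i <;> fin_cases j <;> simp [mat_rootZ] <;> fun_prop

@[fun_prop] theorem continuous_rootY : Continuous (rootY : R → group R δ) :=
  continuous_of_mat fun i j => by
    fin_cases i <;> fin_cases j <;> simp [mat_rootY] <;> fun_prop

@[fun_prop] theorem continuous_rootYNeg : Continuous (rootYNeg : R → group R δ) :=
  continuous_of_mat fun i j => by
    fin_cases i <;> fin_cases j <;> simp [mat_rootYNeg] <;> fun_prop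

end Topology

/-! ### Base change of root, Weyl and torus elements -/

section Functoriality

variable {R S : Type*} [CommRing R] [CommRing S] (f : R →+* S) (δ : R)

theorem mapHom_sqrtMul (c : R) : mapHom f δ (sqrtMul c) = sqrtMul (f c) := by
  ext <;> simp [mapHom]

theorem mapGroup_rootU (a : QuadraticAlgebra R δ 0) :
    mapGroup f δ (rootU a) = rootU (mapHom f δ a) := by
  refine mapGroup_eq_of_mat f _ _ (Matrix.ext fun i j => ?_)
  fin_cases i <;> fin_cases j <;> simp [mat_rootU, mapHom_star]

theorem mapGroup_rootX (a : QuadraticAlgebra R δ 0) :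
    mapGroup f δ (rootX a) = rootX (mapHom f δ a) := by
  refine mapGroup_eq_of_mat f _ _ (Matrix.ext fun i j => ?_)
  fin_cases i <;> fin_cases j <;> simp [mat_rootX, mapHom_star]

theorem mapGroup_rootZ (e : R) : mapGroup f δ (rootZ e) = rootZ (f e) := by
  refine mapGroup_eq_of_mat f _ _ (Matrix.ext fun i j => ?_)
  fin_cases i <;> fin_cases j <;> simp [mat_rootZ, mapHom_sqrtMul]

theorem mapGroup_rootY (c : R) : mapGroup f δ (rootY c) = rootY (f c) := by
  refine mapGroup_eq_of_mat f _ _ (Matrix.ext fun i j => ?_)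
  fin_cases i <;> fin_cases j <;> simp [mat_rootY, mapHom_sqrtMul]

theorem mapGroup_rootYNeg (c : R) : mapGroup f δ (rootYNeg c) = rootYNeg (f c) := by
  refine mapGroup_eq_of_mat f _ _ (Matrix.ext fun i j => ?_)
  fin_cases i <;> fin_cases j <;> simp [mat_rootYNeg, mapHom_sqrtMul]

theorem mapGroup_weylU : mapGroup f δ weylU = weylU := by
  refine mapGroup_eq_of_mat f _ _ (Matrix.ext fun i j => ?_)
  fin_cases i <;> fin_cases j <;> simp [mat_weylU]

theorem mapGroup_weylY : mapGroup f δ weylY = weylY := by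
  refine mapGroup_eq_of_mat f _ _ (Matrix.ext fun i j => ?_)
  fin_cases i <;> fin_cases j <;> simp [mat_weylY]

theorem mapGroup_torusM (β β' : QuadraticAlgebra R δ 0) (h : β * β' = 1)
    (h' : mapHom f δ β * mapHom f δ β' = 1) :
    mapGroup f δ (torusM β β' h) = torusM (mapHom f δ β) (mapHom f δ β') h' := by
  refine mapGroup_eq_of_mat f _ _ (Matrix.ext fun i j => ?_)
  fin_cases i <;> fin_cases j <;> simp [mat_torusM, mapHom_star]

end Functoriality

end U22

/-! ### Integrals over `Γ \ V` as means -/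

section RightInvariance

variable {V : Type*} [Group V] [TopologicalSpace V] [IsTopologicalGroup V]
  [LocallyCompactSpace V] [SecondCountableTopology V] [MeasurableSpace V] [BorelSpace V]
  {Γ : Subgroup V} [Countable Γ] {μ : Measure V} [μ.IsHaarMeasure] {D : Set V}

/-- If `Γ` has a fundamental domain of measure one, right translates of fundamental domains are
fundamental domains, and right translations preserve the measure. -/
theorem MeasureTheory.IsFundamentalDomain.image_mul_right
    (hD : IsFundamentalDomain Γ D μ) (hμD : μ D = 1) (v₀ : V) :
    IsFundamentalDomain Γ ((fun v => v * v₀) '' D) μ ∧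
    (μ.restrict D).map (fun v => v * v₀) = μ.restrict ((fun v => v * v₀) '' D) := by
  have he : MeasurableEmbedding fun v : V => v * v₀ := measurableEmbedding_mulRight v₀
  have hc := Measure.isMulLeftInvariant_eq_smul (μ.map fun v => v * v₀) μ
  set c := Measure.haarScalarFactor (μ.map fun v => v * v₀) μ
  have hD' : IsFundamentalDomain Γ ((fun v => v * v₀) '' D) μ :=
    hD.image_of_equiv (Equiv.mulRight v₀) (quasiMeasurePreserving_mul_right μ v₀⁻¹)
      (Equiv.refl _) fun γ v => mul_assoc (γ : V) v v₀
  have h1 : μ ((fun v => v * v₀) '' D) = 1 := by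
    rw [← hμD]; exact hD'.measure_eq hD
  have h2 : (μ.map fun v => v * v₀) ((fun v => v * v₀) '' D) = 1 := by
    rw [he.map_apply, Set.preimage_image_eq _ he.injective, hμD]
  -- The right translate of D is again a fundamental domain, hence of measure one; this forces the
  -- modular factor to be 1.
  have hc1 : c = 1 := by
    rw [hc, Measure.smul_apply, h1, ENNReal.smul_def, smul_eq_mul, mul_one] at h2
    exact_mod_cast h2
  have h3 : (μ.map fun v => v * v₀) = μ := by
    rw [hc, hc1, one_smul]
  refine ⟨hD', ?_⟩
  nth_rewrite 2 [← h3]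
  rw [he.restrict_map, Set.preimage_image_eq _ he.injective]

theorem MeasureTheory.IsFundamentalDomain.integrableOn_mul_right {E : Type*}
    [NormedAddCommGroup E] (hD : IsFundamentalDomain Γ D μ)
    (hμD : μ D = 1) {k : V → E} (hinv : ∀ γ ∈ Γ, ∀ v, k (γ * v) = k v) (hk : IntegrableOn k D μ)
    (v₀ : V) : IntegrableOn (fun v => k (v * v₀)) D μ := by
  have he : MeasurableEmbedding fun v : V => v * v₀ := measurableEmbedding_mulRight v₀
  obtain ⟨hD', hm⟩ := hD.image_mul_right hμD v₀
  have h1 : IntegrableOn k ((fun v => v * v₀) '' D) μ :=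
    (hD'.integrableOn_iff hD fun γ v => hinv γ γ.2 v).2 hk
  rw [IntegrableOn, ← hm, he.integrable_map_iff] at h1
  exact h1

theorem MeasureTheory.IsFundamentalDomain.setIntegral_mul_right {E : Type*}
    [NormedAddCommGroup E] [NormedSpace ℝ E] (hD : IsFundamentalDomain Γ D μ)
    (hμD : μ D = 1) {k : V → E} (hinv : ∀ γ ∈ Γ, ∀ v, k (γ * v) = k v) (v₀ : V) :
    ∫ v in D, k (v * v₀) ∂μ = ∫ v in D, k v ∂μ := by
  have he : MeasurableEmbedding fun v : V => v * v₀ := measurableEmbedding_mulRight v₀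
  obtain ⟨hD', hm⟩ := hD.image_mul_right hμD v₀
  rw [← hD'.setIntegral_eq hD fun γ v => hinv γ γ.2 v, ← hm, he.integral_map]

/-- If the averages of the right translates of `k` over some family do not depend on the
base point, they compute the integral of `k` over `Γ \ V`. -/
theorem MeasureTheory.IsFundamentalDomain.setIntegral_eq_of_average {M : Type*}
    [TopologicalSpace M] [SecondCountableTopology M] [MeasurableSpace M] [BorelSpace M]
    {ν : Measure M} [IsProbabilityMeasure ν] (hD : IsFundamentalDomain Γ D μ)
    (hμD : μ D = 1) {k : V → ℂ} (hinv : ∀ γ ∈ Γ, ∀ v, k (γ * v) = k v) (hk : IntegrableOn k D μ)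
    (hkc : Continuous k) {c : M → V} (hc : Continuous c) {I : ℂ}
    (hI : ∀ v, ∫ m, k (v * c m) ∂ν = I) : ∫ v in D, k v ∂μ = I := by
  have hprob : IsProbabilityMeasure (μ.restrict D) :=
    ⟨by rw [Measure.restrict_apply_univ, hμD]⟩
  have hint : Integrable (Function.uncurry fun v m => k (v * c m)) ((μ.restrict D).prod ν) := by
    have hcont : Continuous (Function.uncurry fun v m => k (v * c m)) :=
      hkc.comp (continuous_fst.mul (hc.comp continuous_snd))
    rw [integrable_prod_iff' hcont.aestronglyMeasurable]
    refine ⟨Filter.Eventually.of_forall fun m => hD.integrableOn_mul_right hμD hinv hk (c m), ?_⟩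
    have h1 : ∀ m, ∫ v in D, ‖k (v * c m)‖ ∂μ = ∫ v in D, ‖k v‖ ∂μ := fun m =>
      hD.setIntegral_mul_right hμD (k := fun v => ‖k v‖) (fun γ hγ v => by rw [hinv γ hγ]) (c m)
    simp only [Function.uncurry, h1]
    exact integrable_const _
  -- Integrating over m first gives the constant I; integrating over v first gives the integral of k
  -- for each m, by right invariance.
  have h2 := integral_integral_swap hint
  simp only [hI, hD.setIntegral_mul_right hμD hinv] at h2
  simpa using h2.symm

end RightInvariance

/-! ### Means of invariant functions over root subgroups -/

namespace QuadExt

instance {R : Type*} [TopologicalSpace R] (a b : R) : MeasurableSpace (QuadraticAlgebra R a b) :=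
  borel _

instance {R : Type*} [TopologicalSpace R] (a b : R) : BorelSpace (QuadraticAlgebra R a b) := ⟨rfl⟩

/-- The product measure on `R[√d] = R × R`. -/
def quadMeasure {R : Type*} [TopologicalSpace R] [MeasurableSpace R] (a b : R) (ν : Measure R) :
    Measure (QuadraticAlgebra R a b) :=
  (ν.prod ν).map (QuadraticAlgebra.equivProd a b).symm

end QuadExt

/-- Translation by r multiplies the i-th Fourier coefficient by χ_i(-r), so the difference has zero
coefficients as soon as, for each i, either χ_i(r) = 1 or the coefficient of k vanishes. -/
theorem IsDualFamily.apply_add_eq {M ι : Type*} [AddCommGroup M] [TopologicalSpace M]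
    [IsTopologicalAddGroup M] [AddCommGroup ι] [MeasurableSpace M] [BorelSpace M]
    {Γ : AddSubgroup M} {χ : ι → AddChar M Circle} {ν : Measure M}
    (h : IsDualFamily Γ χ) (hν : IsPeriodMeasure Γ ν)
    (hcpt : ∃ C : Set M, IsCompact C ∧ ∀ x, ∃ γ ∈ Γ, x - γ ∈ C)
    {k : M → ℂ} (hk : Continuous k) (hper : ∀ x, ∀ γ ∈ Γ, k (x + γ) = k x) {r : M}
    (h0 : ∀ i, χ i r = 1 ∨ ∫ x, k x * (χ i x : Circle) ∂ν = 0) (x : M) : k (x + r) = k x := by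
  have hχc : ∀ i, Continuous fun a => ((χ i a : Circle) : ℂ) := fun i =>
    continuous_induced_dom.comp (h.continuous i)
  have hkr : Continuous fun a => k (a + r) := by fun_prop
  have hint : ∀ (k' : M → ℂ) (i : ι), Continuous k' →
      Integrable (fun a => k' a * (χ i a : Circle)) ν :=
    fun k' i hk' => hν.integrable (hk'.mul (hχc i))
  have hshift : ∀ i, ∫ a, k (a + r) * (χ i a : Circle) ∂ν =
      (χ i (-r) : Circle) * ∫ a, k a * (χ i a : Circle) ∂ν := by
    intro i
    have h1 := hν.integral_add (fun a => k a * (χ i a : Circle)) (hk.mul (hχc i))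
      (fun x γ hγ => by rw [hper x γ hγ, AddChar.map_add_eq_mul, h.period i γ hγ, mul_one]) r
    rw [← h1, ← integral_const_mul]
    congr 1; funext a
    rw [AddChar.map_add_eq_mul, AddChar.map_neg_eq_inv, Circle.coe_mul, Circle.coe_inv]
    have h2 : ((χ i r : Circle) : ℂ) ≠ 0 := Circle.coe_ne_zero _
    field_simp
  refine sub_eq_zero.1 (h.eq_zero_of_coeff hν hcpt (k := fun a => k (a + r) - k a) (hkr.sub hk)
    (fun x γ hγ => by rw [add_right_comm, hper _ γ hγ, hper x γ hγ]) (fun i => ?_) x)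
  simp only [sub_mul]
  rw [integral_sub (hint _ i hkr) (hint k i hk), hshift]
  rcases h0 i with h1 | h1
  · rw [AddChar.map_neg_eq_inv, h1]; simp
  · rw [h1]; simp

namespace U22
open Matrix QuadExt

/-- The lattice `F` in `A`. -/
def baseLattice (F A : Type*) [Field F] [CommRing A] [Algebra F A] : AddSubgroup A :=
  (algebraMap F A).toAddMonoidHom.range

/-- The lattice `E` in `A_E`. -/
def quadLattice {F : Type*} (A : Type*) [Field F] [CommRing A] [Algebra F A] (d : F) :
    AddSubgroup (QuadraticAlgebra A (algebraMap F A d) 0) :=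
  (mapHom (algebraMap F A) d).toAddMonoidHom.range

/-- The complex values of a character. -/
def charC {A : Type*} [AddMonoid A] (ψ : AddChar A Circle) (x : A) : ℂ := (ψ x : Circle)

theorem charC_add {A : Type*} [AddMonoid A] (ψ : AddChar A Circle) (x y : A) :
    charC ψ (x + y) = charC ψ x * charC ψ y := by
  simp [charC, AddChar.map_add_eq_mul]

theorem charC_zero {A : Type*} [AddMonoid A] (ψ : AddChar A Circle) : charC ψ 0 = 1 := by
  simp [charC]

theorem charC_mul_neg {A : Type*} [AddGroup A] (ψ : AddChar A Circle) (x : A) :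
    charC ψ x * charC ψ (-x) = 1 := by
  rw [← charC_add, add_neg_cancel, charC_zero]

variable {F A : Type*} [Field F] [CommRing A] [Algebra F A] [TopologicalSpace A]
  [IsTopologicalRing A] [LocallyCompactSpace A] [T2Space A] [SecondCountableTopology A]
  [MeasurableSpace A] [BorelSpace A] {d : F}

theorem isPeriodMeasure_quadMeasure {ν : Measure A} (h : IsPeriodMeasure (baseLattice F A) ν) :
    IsPeriodMeasure (quadLattice A d) (quadMeasure (algebraMap F A d) 0 ν) := by
  let e : A × A ≃+ QuadraticAlgebra A (algebraMap F A d) 0 :=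
    { (QuadraticAlgebra.equivProd (algebraMap F A d) 0).symm with
      map_add' := fun x y => by ext <;> rfl }
  refine (h.prod h).map e
    (QuadExt.homeoProd (a := algebraMap F A d) (b := 0)).symm.continuous ?_
  rintro ⟨_, _⟩ ⟨⟨x, rfl⟩, ⟨y, rfl⟩⟩
  exact ⟨⟨x, y⟩, rfl⟩

/-- A continuous function on `U_{2,2}(A)` that is left invariant under `U_{2,2}(F)`, a character
of `A / F` and an invariant mean on `A / F`. -/
structure IsInvariantDatum (ν : Measure A) (ψ : AddChar A Circle)
    (φ : group A (algebraMap F A d) → ℂ) : Prop where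
  period : IsPeriodMeasure (baseLattice F A) ν
  continuous_char : Continuous ψ
  char_rational : ∀ a : F, ψ (algebraMap F A a) = 1
  continuous : Continuous φ
  left_invariant : ∀ γ ∈ (mapGroup (algebraMap F A) d).range, ∀ g, φ (γ * g) = φ g

/-- The mean of `φ` over the elements `x(b) z(e)` against `ψ(-Re b)`. -/
def heisMean (ν : Measure A) (ψ : AddChar A Circle) (φ : group A (algebraMap F A d) → ℂ)
    (g : group A (algebraMap F A d)) : ℂ :=
  ∫ b, ∫ e, φ (rootX b * rootZ e * g) * charC ψ (-b.re) ∂ν ∂quadMeasure (algebraMap F A d) 0 ν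

/-- The Fourier coefficient of `φ` along `N₁` for the vector `e₂ + α e₋₂`. -/
def besselMean (ν : Measure A) (ψ : AddChar A Circle) (φ : group A (algebraMap F A d) → ℂ)
    (α : QuadraticAlgebra F d 0) (g : group A (algebraMap F A d)) : ℂ :=
  ∫ a, heisMean ν ψ φ (rootU a * g) * charC ψ (-(a * star (mapHom (algebraMap F A) d α)).re)
    ∂quadMeasure (algebraMap F A d) 0 ν

/-- The Fourier coefficient of `φ` along `N₁` for the isotropic vector `e₂`. -/
def isoMean (ν : Measure A) (ψ : AddChar A Circle) (φ : group A (algebraMap F A d) → ℂ)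
    (g : group A (algebraMap F A d)) : ℂ :=
  ∫ a, heisMean ν ψ φ (rootU a * g) ∂quadMeasure (algebraMap F A d) 0 ν

/-- The mean of `heisMean` over the root subgroup `y(c)`. -/
def siegelMean (ν : Measure A) (ψ : AddChar A Circle) (φ : group A (algebraMap F A d) → ℂ)
    (g : group A (algebraMap F A d)) : ℂ :=
  ∫ c, heisMean ν ψ φ (rootY c * g) ∂ν

/-! ### Equivariance of the Heisenberg mean -/

namespace IsInvariantDatum

variable {ν : Measure A} {ψ : AddChar A Circle} {φ : group A (algebraMap F A d) → ℂ}

theorem continuous_charC (h : IsInvariantDatum ν ψ φ) : Continuous (charC ψ) :=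
  continuous_induced_dom.comp h.continuous_char

theorem charC_rational (h : IsInvariantDatum ν ψ φ) (a : F) :
    charC ψ (algebraMap F A a) = 1 := by
  simp [charC, h.char_rational]

theorem quadPeriod (h : IsInvariantDatum ν ψ φ) :
    IsPeriodMeasure (quadLattice A d) (quadMeasure (algebraMap F A d) 0 ν) :=
  isPeriodMeasure_quadMeasure h.period

theorem map_rootX (h : IsInvariantDatum ν ψ φ) (γ : QuadraticAlgebra F d 0)
    (g : group A (algebraMap F A d)) : φ (rootX (mapHom (algebraMap F A) d γ) * g) = φ g :=
  h.left_invariant _ ⟨rootX γ, mapGroup_rootX _ _ _⟩ g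

theorem map_rootU (h : IsInvariantDatum ν ψ φ) (γ : QuadraticAlgebra F d 0)
    (g : group A (algebraMap F A d)) : φ (rootU (mapHom (algebraMap F A) d γ) * g) = φ g :=
  h.left_invariant _ ⟨rootU γ, mapGroup_rootU _ _ _⟩ g

theorem map_rootZ (h : IsInvariantDatum ν ψ φ) (γ : F)
    (g : group A (algebraMap F A d)) : φ (rootZ (algebraMap F A γ) * g) = φ g :=
  h.left_invariant _ ⟨rootZ γ, mapGroup_rootZ _ _ _⟩ g

theorem map_rootY (h : IsInvariantDatum ν ψ φ) (γ : F)
    (g : group A (algebraMap F A d)) : φ (rootY (algebraMap F A γ) * g) = φ g :=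
  h.left_invariant _ ⟨rootY γ, mapGroup_rootY _ _ _⟩ g

theorem map_rootYNeg (h : IsInvariantDatum ν ψ φ) (γ : F)
    (g : group A (algebraMap F A d)) : φ (rootYNeg (algebraMap F A γ) * g) = φ g :=
  h.left_invariant _ ⟨rootYNeg γ, mapGroup_rootYNeg _ _ _⟩ g

theorem map_weylU (h : IsInvariantDatum ν ψ φ)
    (g : group A (algebraMap F A d)) : φ (weylU * g) = φ g :=
  h.left_invariant _ ⟨weylU, mapGroup_weylU _ _⟩ g

/-- The mean over the central root subgroup absorbs translations. -/
theorem integral_rootZ_add (h : IsInvariantDatum ν ψ φ) (p q : group A (algebraMap F A d))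
    (hp : ∀ e, p * rootZ e = rootZ e * p) (w : A) :
    ∫ e, φ (p * rootZ (e + w) * q) ∂ν = ∫ e, φ (p * rootZ e * q) ∂ν := by
  have hφ := h.continuous
  refine h.period.integral_add (fun e => φ (p * rootZ e * q)) (by fun_prop) ?_ w
  rintro x _ ⟨γ, rfl⟩
  have h1 : p * rootZ (x + algebraMap F A γ) * q =
      rootZ (algebraMap F A γ) * (p * rootZ x * q) := by
    rw [add_comm, rootZ_add, ← mul_assoc p, hp]
    simp only [mul_assoc]
  exact (congrArg φ h1).trans (h.map_rootZ γ _)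

theorem continuous_heisMean (h : IsInvariantDatum ν ψ φ) : Continuous (heisMean ν ψ φ) := by
  have hφ := h.continuous
  have hψ := h.continuous_charC
  refine h.quadPeriod.continuous_integral
    (k := fun g b => ∫ e, φ (rootX b * rootZ e * g) * charC ψ (-b.re) ∂ν) ?_
  refine h.period.continuous_integral (X := group A (algebraMap F A d) × _)
    (k := fun p e => φ (rootX p.2 * rootZ e * p.1) * charC ψ (-p.2.re)) ?_
  simp only [Function.uncurry_def]
  fun_prop

theorem heisMean_eq (ν : Measure A) (ψ : AddChar A Circle) (φ : group A (algebraMap F A d) → ℂ)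
    (g : group A (algebraMap F A d)) :
    heisMean ν ψ φ g = ∫ b, (∫ e, φ (rootX b * rootZ e * g) ∂ν) * charC ψ (-b.re)
      ∂quadMeasure (algebraMap F A d) 0 ν := by
  simp only [heisMean, integral_mul_const]

theorem heisMean_rootZ_mul (h : IsInvariantDatum ν ψ φ) (e : A)
    (g : group A (algebraMap F A d)) :
    heisMean ν ψ φ (rootZ e * g) = heisMean ν ψ φ g := by
  rw [heisMean_eq, heisMean_eq]
  congr 1; funext b
  rw [← h.integral_rootZ_add (rootX b) g (rootX_mul_rootZ b) e]
  congr 2; funext e'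
  rw [rootZ_add]
  simp only [mul_assoc]

theorem heisMean_rootX_mul (h : IsInvariantDatum ν ψ φ)
    (b : QuadraticAlgebra A (algebraMap F A d) 0) (g : group A (algebraMap F A d)) :
    heisMean ν ψ φ (rootX b * g) = charC ψ b.re * heisMean ν ψ φ g := by
  have hφ := h.continuous
  have hψ := h.continuous_charC
  let k : QuadraticAlgebra A (algebraMap F A d) 0 → ℂ := fun b' =>
    ∫ e, φ (rootX b' * rootZ e * g) * charC ψ (-b'.re) ∂ν
  have hk : Continuous k := by
    refine h.period.continuous_integral
      (k := fun b' e => φ (rootX b' * rootZ e * g) * charC ψ (-b'.re)) ?_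
    simp only [Function.uncurry_def]
    fun_prop
  have h1 := h.quadPeriod.integral_add k hk (by
    rintro x _ ⟨γ, rfl⟩
    simp only [k]
    congr 1; funext e
    have h2 : rootX (x + mapHom (algebraMap F A) d γ) * rootZ e * g =
        rootX (mapHom (algebraMap F A) d γ) * (rootX x * rootZ e * g) := by
      rw [add_comm, rootX_add]; simp only [mul_assoc]
    have h3 : charC ψ (-(x + mapHom (algebraMap F A) d γ).re) = charC ψ (-x.re) := by
      have h4 : -(x + mapHom (algebraMap F A) d γ).re = -x.re + algebraMap F A (-γ.re) := by
        simp [mapHom, add_comm]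
      rw [h4, charC_add, h.charC_rational, mul_one]
    exact congrArg₂ (· * ·) ((congrArg φ h2).trans (h.map_rootX γ _)) h3) b
  rw [heisMean, heisMean, ← h1, ← integral_const_mul]
  congr 1; funext b'
  simp only [k]
  rw [← integral_const_mul]
  congr 1; funext e
  have h5 : rootX b' * rootZ e * (rootX b * g) = rootX (b' + b) * rootZ e * g := by
    rw [rootX_add, mul_assoc (rootX b') (rootX b), rootX_mul_rootZ b]
    simp only [mul_assoc]
  have h6 : -b'.re = b.re + -(b' + b).re := by simp
  rw [h5, h6, charC_add]
  ring

/-- Moving the rational u(γ) to the left of x(b) costs a central element, absorbed by the mean over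
z. -/
theorem integral_rootZ_map_rootU (h : IsInvariantDatum ν ψ φ) (γ : QuadraticAlgebra F d 0)
    (b : QuadraticAlgebra A (algebraMap F A d) 0) (g : group A (algebraMap F A d)) :
    ∫ e, φ (rootX b * rootZ e * (rootU (mapHom (algebraMap F A) d γ) * g)) ∂ν =
      ∫ e, φ (rootX b * rootZ e * g) ∂ν := by
  set u := rootU (mapHom (algebraMap F A) d γ)
  set w := 2 * (b * star (mapHom (algebraMap F A) d γ)).im with hw
  rw [← h.integral_rootZ_add (rootX b) _ (rootX_mul_rootZ b) w]
  congr 1; funext e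
  have h1 : rootX b * rootZ (e + w) * (u * g) = u * (rootX b * rootZ e * g) := by
    rw [add_comm, rootZ_add, ← mul_assoc, ← mul_assoc (rootX b), mul_assoc _ (rootZ e) u,
      rootZ_mul_rootU, ← mul_assoc, ← rootU_mul_rootX]
    simp only [mul_assoc]
    rfl
  exact (congrArg φ h1).trans (h.map_rootU γ _)

theorem heisMean_map_rootU (h : IsInvariantDatum ν ψ φ) (γ : QuadraticAlgebra F d 0)
    (g : group A (algebraMap F A d)) :
    heisMean ν ψ φ (rootU (mapHom (algebraMap F A) d γ) * g) = heisMean ν ψ φ g := by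
  simp only [heisMean_eq, h.integral_rootZ_map_rootU]

theorem heisMean_map_rootY (h : IsInvariantDatum ν ψ φ) (γ : F)
    (g : group A (algebraMap F A d)) :
    heisMean ν ψ φ (rootY (algebraMap F A γ) * g) = heisMean ν ψ φ g := by
  rw [heisMean_eq, heisMean_eq]
  congr 1; funext b
  congr 2; funext e
  have h1 : rootX b * rootZ e * (rootY (algebraMap F A γ) * g) =
      rootY (algebraMap F A γ) * (rootX b * rootZ e * g) := by
    rw [← mul_assoc, mul_assoc (rootX b), rootZ_mul_rootY, ← mul_assoc, rootX_mul_rootY]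
    simp only [mul_assoc]
  exact (congrArg φ h1).trans (h.map_rootY γ _)

/-- The factor is the value of the character on the commutator x(-a c√d) of y(c) and u(a). -/
theorem heisMean_rootY_mul_rootU (h : IsInvariantDatum ν ψ φ) (c : A)
    (a : QuadraticAlgebra A (algebraMap F A d) 0) (g : group A (algebraMap F A d)) :
    heisMean ν ψ φ (rootY c * (rootU a * g)) =
      charC ψ (-(algebraMap F A d * a.im * c)) * heisMean ν ψ φ (rootU a * (rootY c * g)) := by
  rw [← mul_assoc, rootY_mul_rootU, mul_assoc, mul_assoc, mul_assoc, h.heisMean_rootX_mul,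
    h.heisMean_rootZ_mul]
  congr 2
  simp

/-- The subregular coefficients determine `heisMean` along the root subgroup `u(a)`. -/
theorem heisMean_rootU_ofBase (h : IsInvariantDatum ν ψ φ)
    (hcpt : ∃ C : Set A, IsCompact C ∧ ∀ x, ∃ γ ∈ baseLattice F A, x - γ ∈ C)
    {χ : QuadraticAlgebra F d 0 → AddChar (QuadraticAlgebra A (algebraMap F A d) 0) Circle}
    (hχ : IsDualFamily (quadLattice A d) χ)
    (hχψ : ∀ α a, χ α a = ψ (a * star (mapHom (algebraMap F A) d α)).re)
    (h0 : ∀ α : QuadraticAlgebra F d 0, α.re ≠ 0 → ∀ g, besselMean ν ψ φ α g = 0)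
    (r : A) (g : group A (algebraMap F A d)) :
    heisMean ν ψ φ (rootU (ofBase r) * g) = heisMean ν ψ φ g := by
  have hf := h.continuous_heisMean
  have hper : ∀ g' : group A (algebraMap F A d), ∀ x, ∀ γ ∈ quadLattice A d,
      heisMean ν ψ φ (rootU (x + γ) * g') = heisMean ν ψ φ (rootU x * g') := by
    rintro g' x _ ⟨γ, rfl⟩
    rw [add_comm, rootU_add, mul_assoc]
    exact h.heisMean_map_rootU γ _
  have hcpt' : ∃ C : Set (QuadraticAlgebra A (algebraMap F A d) 0), IsCompact C ∧
      ∀ x, ∃ γ ∈ quadLattice A d, x - γ ∈ C := by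
    obtain ⟨C, hC, hCΓ⟩ := hcpt
    refine ⟨homeoProd.symm '' (C ×ˢ C), (hC.prod hC).image homeoProd.symm.continuous, fun x => ?_⟩
    obtain ⟨_, ⟨γ, rfl⟩, hγ⟩ := hCΓ x.re
    obtain ⟨_, ⟨γ', rfl⟩, hγ'⟩ := hCΓ x.im
    exact ⟨mapHom (algebraMap F A) d ⟨γ, γ'⟩, ⟨_, rfl⟩,
      ⟨(x.re - algebraMap F A γ, x.im - algebraMap F A γ'), ⟨hγ, hγ'⟩, rfl⟩⟩
  have hzero := hχ.apply_add_eq h.quadPeriod hcpt'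
    (k := fun a => heisMean ν ψ φ (rootU a * g)) (hf.comp (by fun_prop)) (hper g)
    (r := ofBase r) (fun α => by
      -- On a base element r the character of α takes the value ψ(r Re α), trivial if Re α = 0. For
      -- the other α the coefficient is the subregular one attached to -α, which vanishes by
      -- assumption.
      by_cases hα : α.re = 0
      · left
        rw [hχψ]
        have h2 : (ofBase r * star (mapHom (algebraMap F A) d α)).re = 0 := by
          simp [mapHom, hα]
        rw [h2, AddChar.map_zero_eq_one]
      · right
        rw [← h0 (-α) (by simpa using hα) g, besselMean]
        congr 1; funext a
        rw [hχψ, charC]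
        congr 4
        simp) 0
  rw [zero_add] at hzero
  rw [hzero]
  have h1 : rootU (0 : QuadraticAlgebra A (algebraMap F A d) 0) = 1 := by
    have h2 := rootU_add (0 : QuadraticAlgebra A (algebraMap F A d) 0) 0
    rw [add_zero] at h2
    exact (mul_eq_left.1 h2.symm)
  rw [h1, one_mul]

end IsInvariantDatum
end U22

theorem IsPeriodMeasure.integral_swap₃ {M A : Type*} [AddCommGroup M] [TopologicalSpace M]
    [IsTopologicalAddGroup M] [MeasurableSpace M] [BorelSpace M] [SecondCountableTopology M]
    [LocallyCompactSpace M] [AddCommGroup A] [TopologicalSpace A] [IsTopologicalAddGroup A]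
    [MeasurableSpace A] [BorelSpace A] [SecondCountableTopology A] [LocallyCompactSpace A]
    {Γ : AddSubgroup M} {Γ' : AddSubgroup A} {νM : Measure M} {ν : Measure A}
    (hM : IsPeriodMeasure Γ νM) (hν : IsPeriodMeasure Γ' ν) {Φ : M → A → A → ℂ}
    (hΦ : Continuous fun p : M × A × A => Φ p.1 p.2.1 p.2.2) :
    ∫ c, ∫ b, ∫ e, Φ b c e ∂ν ∂νM ∂ν = ∫ c, ∫ b, ∫ e, Φ b e c ∂ν ∂νM ∂ν := by
  have c1 : ∀ c, Continuous (Function.uncurry fun b e => Φ b c e) := fun c =>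
    hΦ.comp (f := fun p : M × A => (p.1, c, p.2)) (by fun_prop)
  have c2 : Continuous (Function.uncurry fun c e => ∫ b, Φ b c e ∂νM) := by
    refine hM.continuous_integral (X := A × A) (k := fun p b => Φ b p.1 p.2) ?_
    exact hΦ.comp (f := fun p : (A × A) × M => (p.2, p.1.1, p.1.2)) (by fun_prop)
  have c3 : ∀ e, Continuous (Function.uncurry fun c b => Φ b c e) := fun e =>
    hΦ.comp (f := fun p : A × M => (p.2, p.1, e)) (by fun_prop)
  calc ∫ c, ∫ b, ∫ e, Φ b c e ∂ν ∂νM ∂ν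
      = ∫ c, ∫ e, ∫ b, Φ b c e ∂νM ∂ν ∂ν := by
        congr 1; funext c
        exact hM.integral_swap hν (c1 c)
    _ = ∫ e, ∫ c, ∫ b, Φ b c e ∂νM ∂ν ∂ν := hν.integral_swap hν c2
    _ = ∫ e, ∫ b, ∫ c, Φ b c e ∂ν ∂νM ∂ν := by
        congr 1; funext e
        exact hν.integral_swap hM (c3 e)

/-! ### The Siegel mean, its SL₂-invariance and the isotropic coefficient -/

namespace U22
open Matrix QuadExt

variable {F A : Type*} [Field F] [CommRing A] [Algebra F A] [TopologicalSpace A]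
  [IsTopologicalRing A] [LocallyCompactSpace A] [T2Space A] [SecondCountableTopology A]
  [MeasurableSpace A] [BorelSpace A] {d : F}

namespace IsInvariantDatum

variable {ν : Measure A} {ψ : AddChar A Circle} {φ : group A (algebraMap F A d) → ℂ}

/-- For r in the base ring the cocycle of y(c) and u(r) is trivial, so the invariance passes through
the mean over y. -/
theorem siegelMean_rootU_ofBase (h : IsInvariantDatum ν ψ φ)
    (hreal : ∀ r g, heisMean ν ψ φ (rootU (ofBase r) * g) = heisMean ν ψ φ g) (r : A)
    (g : group A (algebraMap F A d)) :
    siegelMean ν ψ φ (rootU (ofBase r) * g) = siegelMean ν ψ φ g := by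
  rw [siegelMean, siegelMean]
  congr 1; funext c
  rw [h.heisMean_rootY_mul_rootU, hreal]
  simp [charC_zero]

theorem integral_star (h : IsInvariantDatum ν ψ φ)
    {k : QuadraticAlgebra A (algebraMap F A d) 0 → ℂ} (hk : Continuous k)
    (hper : ∀ x, ∀ γ ∈ quadLattice A d, k (x + γ) = k x) :
    ∫ b, k (star b) ∂quadMeasure (algebraMap F A d) 0 ν =
      ∫ b, k b ∂quadMeasure (algebraMap F A d) 0 ν := by
  let σ : QuadraticAlgebra A (algebraMap F A d) 0 →+ QuadraticAlgebra A (algebraMap F A d) 0 :=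
    { toFun := star
      map_zero' := star_zero _
      map_add' := star_add }
  refine h.quadPeriod.integral_comp σ continuous_star star_involutive.surjective ?_ hk hper
  rintro _ ⟨γ, rfl⟩
  exact ⟨star γ, mapHom_star _ _ _⟩

/-- The Weyl element is rational and acts on the Siegel radical by exchanging e and c and
conjugating b. The character is preserved, so only Fubini and invariance of the mean under
conjugation are needed. -/
theorem siegelMean_weylU (h : IsInvariantDatum ν ψ φ) (g : group A (algebraMap F A d)) :
    siegelMean ν ψ φ (weylU * g) = siegelMean ν ψ φ g := by
  have hφ := h.continuous
  have hψ := h.continuous_charC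
  let Φ : QuadraticAlgebra A (algebraMap F A d) 0 → A → A → ℂ := fun b e c =>
    φ (rootX b * rootZ e * rootY c * g) * charC ψ (-b.re)
  have hΦ : Continuous fun p : QuadraticAlgebra A (algebraMap F A d) 0 × A × A =>
      Φ p.1 p.2.1 p.2.2 := by
    simp only [Φ]
    fun_prop
  have hper : ∀ e c x, ∀ γ ∈ quadLattice A d, Φ (x + γ) e c = Φ x e c := by
    rintro e c x _ ⟨γ, rfl⟩
    have h2 : rootX (x + mapHom (algebraMap F A) d γ) * rootZ e * rootY c * g =
        rootX (mapHom (algebraMap F A) d γ) * (rootX x * rootZ e * rootY c * g) := by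
      rw [add_comm, rootX_add]; simp only [mul_assoc]
    have h3 : charC ψ (-(x + mapHom (algebraMap F A) d γ).re) = charC ψ (-x.re) := by
      have h4 : -(x + mapHom (algebraMap F A) d γ).re = -x.re + algebraMap F A (-γ.re) := by
        simp [mapHom, add_comm]
      rw [h4, charC_add, h.charC_rational, mul_one]
    exact congrArg₂ (· * ·) ((congrArg φ h2).trans (h.map_rootX γ _)) h3
  have e1 : siegelMean ν ψ φ (weylU * g) =
      ∫ c, ∫ b, ∫ e, Φ (star b) c e ∂ν ∂quadMeasure (algebraMap F A d) 0 ν ∂ν := by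
    simp only [siegelMean, heisMean, Φ]
    congr 1; funext c
    congr 1; funext b
    congr 1; funext e
    have h1 : rootX b * rootZ e * (rootY c * (weylU * g)) =
        weylU * (rootX (star b) * rootZ c * rootY e * g) := by
      have h2 := congrArg (· * g) (rootX_mul_rootZ_mul_rootY_mul_weylU b e c)
      simpa only [mul_assoc] using h2
    rw [h1, h.map_weylU]
    simp
  have e2 : siegelMean ν ψ φ g =
      ∫ c, ∫ b, ∫ e, Φ b e c ∂ν ∂quadMeasure (algebraMap F A d) 0 ν ∂ν := by
    simp only [siegelMean, heisMean, Φ, mul_assoc]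
  rw [e1, e2, ← h.quadPeriod.integral_swap₃ h.period hΦ]
  congr 1; funext c
  refine h.integral_star (k := fun b => ∫ e, Φ b c e ∂ν) ?_ ?_
  · refine h.period.continuous_integral (k := fun b e => Φ b c e) ?_
    exact hΦ.comp (f := fun p : QuadraticAlgebra A (algebraMap F A d) 0 × A => (p.1, c, p.2))
      (by fun_prop)
  · intro x γ hγ
    simp only [hper _ _ x γ hγ]

theorem siegelMean_rootUNeg (h : IsInvariantDatum ν ψ φ)
    (hreal : ∀ r g, heisMean ν ψ φ (rootU (ofBase r) * g) = heisMean ν ψ φ g) (r : A)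
    (g : group A (algebraMap F A d)) :
    siegelMean ν ψ φ (rootUNeg r * g) = siegelMean ν ψ φ g := by
  have h1 : rootUNeg r * g = weylU * (rootU (ofBase (-r)) * (weylU⁻¹ * g)) := by
    rw [← mul_assoc, weylU_mul_rootU, neg_neg]
    group
  have h2 := h.siegelMean_weylU (weylU⁻¹ * g)
  rw [mul_inv_cancel_left] at h2
  rw [h1, h.siegelMean_weylU, h.siegelMean_rootU_ofBase hreal, ← h2]

/-- Both unipotent one-parameter subgroups of SL₂ fix the Siegel mean for adelic parameters. The
torus they generate does too, although t is in general not rational. -/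
theorem siegelMean_torusT (h : IsInvariantDatum ν ψ φ)
    (hreal : ∀ r g, heisMean ν ψ φ (rootU (ofBase r) * g) = heisMean ν ψ φ g) (T T' : A)
    (hT : T * T' = 1) (g : group A (algebraMap F A d)) :
    siegelMean ν ψ φ (torusT T T' hT * g) = siegelMean ν ψ φ g := by
  rw [torusT_eq]
  simp only [mul_assoc, h.siegelMean_rootU_ofBase hreal, h.siegelMean_rootUNeg hreal]

/-- Only the √d-coordinate of a matters, as the Heisenberg mean does not depend on the other one. -/
theorem isoMean_eq (h : IsInvariantDatum ν ψ φ)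
    (hreal : ∀ r g, heisMean ν ψ φ (rootU (ofBase r) * g) = heisMean ν ψ φ g)
    (g : group A (algebraMap F A d)) :
    isoMean ν ψ φ g = ∫ s, heisMean ν ψ φ (rootU (sqrtMul s) * g) ∂ν := by
  have hf := h.continuous_heisMean
  have hν := h.period
  have hprob := hν.isProb
  have hk : Continuous fun p : A × A =>
      heisMean ν ψ φ (rootU ((QuadraticAlgebra.equivProd (algebraMap F A d) 0).symm p) * g) := by
    have h1 : Continuous (QuadraticAlgebra.equivProd (algebraMap F A d) 0).symm :=
      (QuadExt.homeoProd (a := algebraMap F A d) (b := 0)).symm.continuous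
    fun_prop
  have hm : AEMeasurable (QuadraticAlgebra.equivProd (algebraMap F A d) 0).symm (ν.prod ν) :=
    (QuadExt.homeoProd (a := algebraMap F A d) (b := 0)).symm.continuous.aemeasurable
  rw [isoMean, quadMeasure, integral_map hm
    (Continuous.aestronglyMeasurable (by fun_prop)),
    integral_prod _ ((hν.prod hν).integrable hk)]
  have h2 : ∀ r s : A, heisMean ν ψ φ
      (rootU ((QuadraticAlgebra.equivProd (algebraMap F A d) 0).symm (r, s)) * g) =
      heisMean ν ψ φ (rootU (sqrtMul s) * g) := by
    intro r s
    have h3 : (QuadraticAlgebra.equivProd (algebraMap F A d) 0).symm (r, s) =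
        ofBase r + sqrtMul s := by
      ext <;> simp
    rw [h3, rootU_add, mul_assoc, hreal]
  simp only [h2]
  exact hν.integral_const _

/-- The isotropic coefficient is multiplied by a constant under the torus. -/
theorem exists_isoMean_torusT [Countable (baseLattice F A)] {μ : Measure A} {D : Set A}
    (hD : IsUnitDomain (baseLattice F A) μ D)
    (hdisc : ∃ U : Set A, IsOpen U ∧ 0 ∈ U ∧ ∀ γ ∈ baseLattice F A, γ ∈ U → γ = 0)
    (hcpt : ∃ C : Set A, IsCompact C ∧ ∀ x, ∃ γ ∈ baseLattice F A, x - γ ∈ C)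
    (h : IsInvariantDatum (μ.restrict D) ψ φ)
    (hdual : IsDualFamily (baseLattice F A)
      fun γ : baseLattice F A => (ψ.mulShift (algebraMap F A d)).mulShift (γ : A))
    (hreal : ∀ r g, heisMean (μ.restrict D) ψ φ (rootU (ofBase r) * g) =
      heisMean (μ.restrict D) ψ φ g) (T T' : A) (hT : T * T' = 1) :
    ∃ κ : ℝ, 0 < κ ∧ ∀ g, isoMean (μ.restrict D) ψ φ (torusT T T' hT * g) =
      κ * isoMean (μ.restrict D) ψ φ g := by
  have hf := h.continuous_heisMean
  have hT2 : T * T * (T' * T') = 1 := by linear_combination (T * T' + 1) * hT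
  have hψd : Continuous (ψ.mulShift (algebraMap F A d)) :=
    h.continuous_char.comp (continuous_const_mul _)
  -- The dilation is by T², the root of the torus element on u(s√d); the character is twisted by d
  -- because of the cocycle d Im(a) c.
  obtain ⟨κ, hκ, hκe⟩ := hD.exists_mean_eq hdisc hcpt hψd hdual hT2
  refine ⟨κ, hκ, fun g => ?_⟩
  -- Its mean over c is the Siegel mean at u(s√d)g; its mean over s at c = 0 is the isotropic
  -- coefficient at g.
  let Z : group A (algebraMap F A d) → A → A → ℂ := fun g c s =>
    heisMean (μ.restrict D) ψ φ (rootY c * (rootU (sqrtMul s) * g))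
  have hZ : ∀ g, Continuous (Function.uncurry (Z g)) := fun g => by
    simp only [Z, Function.uncurry_def]
    fun_prop
  have hZc : ∀ g c s, ∀ γ ∈ baseLattice F A, Z g (c + γ) s = Z g c s := by
    rintro g c s _ ⟨γ, rfl⟩
    simp only [Z]
    rw [add_comm, rootY_add, mul_assoc]
    exact h.heisMean_map_rootY γ _
  have hZs : ∀ g c s, ∀ γ ∈ baseLattice F A, Z g c (s + γ) =
      (ψ.mulShift (algebraMap F A d) (-(γ * c)) : Circle) * Z g c s := by
    rintro g c s _ ⟨γ, rfl⟩
    have h1 : (sqrtMul (s + algebraMap F A γ) : QuadraticAlgebra A (algebraMap F A d) 0) =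
        mapHom (algebraMap F A) d (sqrtMul γ) + sqrtMul s := by
      rw [mapHom_sqrtMul]; ext <;> simp [add_comm]
    have h2 := h.heisMean_rootY_mul_rootU c (mapHom (algebraMap F A) d (sqrtMul γ))
      (rootU (sqrtMul s) * g)
    rw [h.heisMean_map_rootU] at h2
    change heisMean (μ.restrict D) ψ φ (rootY c *
      (rootU (sqrtMul (s + algebraMap F A γ)) * g)) =
      (ψ.mulShift (algebraMap F A d) (-(algebraMap F A γ * c)) : Circle) * _
    rw [h1, rootU_add, mul_assoc (rootU _), h2, charC, AddChar.mulShift_apply]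
    congr 4
    simp [mapHom_sqrtMul]
    ring
  have hZ0 : ∀ g s, Z g 0 s = heisMean (μ.restrict D) ψ φ (rootU (sqrtMul s) * g) := by
    intro g s
    have h1 : rootY (0 : A) = (1 : group A (algebraMap F A d)) := by
      have h2 := rootY_add (δ := algebraMap F A d) 0 0
      rw [add_zero] at h2
      exact (mul_eq_left.1 h2.symm)
    simp only [Z, h1, one_mul]
  have h1 := hκe (Z g) (Z (torusT T T' hT * g)) (hZ _) (hZ _) (hZc _) (hZc _) (hZs _) (hZs _)
    (fun s => by
      have h2 : ∀ g s, ∫ c in D, Z g c s ∂μ =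
          siegelMean (μ.restrict D) ψ φ (rootU (sqrtMul s) * g) := fun _ _ => rfl
      rw [h2, h2, ← mul_assoc, ← torusT_mul_rootU, mul_assoc, h.siegelMean_torusT hreal])
  simpa only [hZ0, ← h.isoMean_eq hreal] using h1

end IsInvariantDatum
end U22

/-! ### From the isotropic coefficient to the Whittaker coefficient -/

namespace U22
open Matrix QuadExt

variable {F A : Type*} [Field F] [CommRing A] [Algebra F A] [TopologicalSpace A]
  [IsTopologicalRing A] [LocallyCompactSpace A] [T2Space A] [SecondCountableTopology A]
  [MeasurableSpace A] [BorelSpace A] {d : F}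

/-- The Whittaker coefficient of `φ` for the character with parameters `β` and `α`. -/
def whittakerMean (ν : Measure A) (ψ : AddChar A Circle) (φ : group A (algebraMap F A d) → ℂ)
    (β : QuadraticAlgebra F d 0) (α : F) (g : group A (algebraMap F A d)) : ℂ :=
  ∫ c, ∫ a, ∫ b, ∫ e, φ (rootX b * rootZ e * rootU a * rootY c * g) *
    charC ψ (-((mapHom (algebraMap F A) d β * a).re + algebraMap F A α * c)) ∂ν
      ∂quadMeasure (algebraMap F A d) 0 ν ∂quadMeasure (algebraMap F A d) 0 ν ∂ν

namespace IsInvariantDatum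

variable {ν : Measure A} {ψ : AddChar A Circle} {φ : group A (algebraMap F A d) → ℂ}

theorem continuous_isoMean (h : IsInvariantDatum ν ψ φ) : Continuous (isoMean ν ψ φ) := by
  have hf := h.continuous_heisMean
  refine h.quadPeriod.continuous_integral (k := fun g a => heisMean ν ψ φ (rootU a * g)) ?_
  simp only [Function.uncurry_def]
  fun_prop

/-- With b outermost, translations of a by amounts that depend on b can be absorbed. -/
theorem isoMean_eq_swap (h : IsInvariantDatum ν ψ φ) (g : group A (algebraMap F A d)) :
    isoMean ν ψ φ g = ∫ b, ∫ a, (∫ e, φ (rootX b * rootZ e * (rootU a * g)) ∂ν) *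
      charC ψ (-b.re) ∂quadMeasure (algebraMap F A d) 0 ν ∂quadMeasure (algebraMap F A d) 0 ν := by
  have hφ := h.continuous
  have hψ := h.continuous_charC
  simp only [isoMean, heisMean_eq]
  refine h.quadPeriod.integral_swap h.quadPeriod
    (k := fun a b => (∫ e, φ (rootX b * rootZ e * (rootU a * g)) ∂ν) * charC ψ (-b.re)) ?_
  refine Continuous.mul ?_ (by fun_prop)
  refine h.period.continuous_integral
    (X := QuadraticAlgebra A (algebraMap F A d) 0 × QuadraticAlgebra A (algebraMap F A d) 0)
    (k := fun p e => φ (rootX p.2 * rootZ e * (rootU p.1 * g))) ?_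
  simp only [Function.uncurry_def]
  fun_prop

/-- For fixed b, moving y⁻(γ) to the left shifts a by b γ√d and e by a quantity that depends only on
b. The means over a and e absorb these shifts, and the character sees only b. -/
theorem isoMean_map_rootYNeg (h : IsInvariantDatum ν ψ φ) (γ : F)
    (g : group A (algebraMap F A d)) :
    isoMean ν ψ φ (rootYNeg (algebraMap F A γ) * g) = isoMean ν ψ φ g := by
  have hφ := h.continuous
  rw [h.isoMean_eq_swap, h.isoMean_eq_swap]
  congr 1; funext b
  simp only [integral_mul_const]
  congr 1
  let k : QuadraticAlgebra A (algebraMap F A d) 0 → ℂ := fun a =>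
    ∫ e, φ (rootX b * rootZ e * (rootU a * g)) ∂ν
  have hk : Continuous k := by
    refine h.period.continuous_integral
      (k := fun a e => φ (rootX b * rootZ e * (rootU a * g))) ?_
    simp only [Function.uncurry_def]
    fun_prop
  rw [← h.quadPeriod.integral_add k hk (by
    rintro a _ ⟨γ', rfl⟩
    simp only [k]
    rw [add_comm, rootU_add, mul_assoc]
    exact h.integral_rootZ_map_rootU γ' b _) (b * sqrtMul (algebraMap F A γ))]
  congr 1; funext a
  simp only [k]
  rw [← h.integral_rootZ_add (rootX b) (rootU (a + b * sqrtMul (algebraMap F A γ)) * g)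
    (rootX_mul_rootZ b)
    (-((b * star b).re * algebraMap F A γ))]
  congr 1; funext e
  have h1 : rootX b * rootZ e * (rootU a * (rootYNeg (algebraMap F A γ) * g)) =
      rootYNeg (algebraMap F A γ) * (rootX b * rootZ (e + -((b * star b).re * algebraMap F A γ)) *
        (rootU (a + b * sqrtMul (algebraMap F A γ)) * g)) := by
    have h2 := rootX_mul_rootZ_mul_rootU_mul_rootYNeg b a e (algebraMap F A γ)
    rw [← mul_assoc (rootU a), ← mul_assoc, ← mul_assoc (rootX b * rootZ e), h2, add_comm _ e]
    simp only [mul_assoc (rootYNeg _), mul_assoc (rootX _ * rootZ _)]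
  exact (congrArg φ h1).trans (h.map_rootYNeg γ _)

theorem integral_rootU_mul_rootZ_mul_rootX (h : IsInvariantDatum ν ψ φ)
    (a b : QuadraticAlgebra A (algebraMap F A d) 0) (g : group A (algebraMap F A d)) :
    ∫ e, φ (rootU b * rootZ e * rootX a * g) ∂ν =
      ∫ e, φ (rootX a * rootZ e * (rootU b * g)) ∂ν := by
  rw [← h.integral_rootZ_add (rootX a) (rootU b * g) (rootX_mul_rootZ a) (2 * (a * star b).im)]
  congr 1; funext e
  rw [← rootZ_mul_rootU, mul_assoc, mul_assoc, ← mul_assoc (rootU b), rootU_mul_rootX, rootZ_add,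
    ← mul_assoc (rootX a), rootX_mul_rootZ a e]
  simp only [mul_assoc]

theorem integral_rootZ_map_rootX (h : IsInvariantDatum ν ψ φ) (γ : QuadraticAlgebra F d 0)
    (a : QuadraticAlgebra A (algebraMap F A d) 0) (g : group A (algebraMap F A d)) :
    ∫ e, φ (rootX (a + mapHom (algebraMap F A) d γ) * rootZ e * g) ∂ν =
      ∫ e, φ (rootX a * rootZ e * g) ∂ν := by
  congr 1; funext e
  have h1 : rootX (a + mapHom (algebraMap F A) d γ) * rootZ e * g =
      rootX (mapHom (algebraMap F A) d γ) * (rootX a * rootZ e * g) := by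
    rw [add_comm, rootX_add]; simp only [mul_assoc]
  exact (congrArg φ h1).trans (h.map_rootX γ _)

theorem charC_neg_re_add (h : IsInvariantDatum ν ψ φ) (γ : QuadraticAlgebra F d 0)
    (a : QuadraticAlgebra A (algebraMap F A d) 0) :
    charC ψ (-(a + mapHom (algebraMap F A) d γ).re) = charC ψ (-a.re) := by
  have h4 : -(a + mapHom (algebraMap F A) d γ).re = -a.re + algebraMap F A (-γ.re) := by
    simp [mapHom, add_comm]
  rw [h4, charC_add, h.charC_rational, mul_one]

theorem integral_rootZ_smul (h : IsInvariantDatum ν ψ φ) {n n' : F} (hn : n * n' = 1)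
    (p q : group A (algebraMap F A d)) (hp : ∀ e, p * rootZ e = rootZ e * p) :
    ∫ e, φ (p * rootZ (algebraMap F A n * e) * q) ∂ν = ∫ e, φ (p * rootZ e * q) ∂ν := by
  have hφ := h.continuous
  have hn' : algebraMap F A n * algebraMap F A n' = 1 := by rw [← map_mul, hn, map_one]
  refine h.period.integral_comp (AddMonoidHom.mulLeft (algebraMap F A n))
    (continuous_const_mul _) (fun x => ⟨algebraMap F A n' * x, ?_⟩) ?_
    (k := fun e => φ (p * rootZ e * q)) (by fun_prop) ?_
  · rw [AddMonoidHom.coe_mulLeft]; linear_combination x * hn'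
  · rintro _ ⟨γ, rfl⟩
    exact ⟨n * γ, map_mul (algebraMap F A) _ _⟩
  · rintro e _ ⟨γ, rfl⟩
    have h1 : p * rootZ (e + algebraMap F A γ) * q =
        rootZ (algebraMap F A γ) * (p * rootZ e * q) := by
      rw [add_comm, rootZ_add, ← mul_assoc p, hp]
      simp only [mul_assoc]
    exact (congrArg φ h1).trans (h.map_rootZ γ _)

/-- Multiplication by an element of `E^×` preserves means over `A_E / E`. -/
theorem integral_mul_left (h : IsInvariantDatum ν ψ φ) {β β' : QuadraticAlgebra F d 0}
    (hβ : β * β' = 1) {k : QuadraticAlgebra A (algebraMap F A d) 0 → ℂ} (hk : Continuous k)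
    (hper : ∀ x γ, k (x + mapHom (algebraMap F A) d γ) = k x) :
    ∫ b, k (mapHom (algebraMap F A) d β * b) ∂quadMeasure (algebraMap F A d) 0 ν =
      ∫ b, k b ∂quadMeasure (algebraMap F A d) 0 ν := by
  have hβu : mapHom (algebraMap F A) d β * mapHom (algebraMap F A) d β' = 1 := by
    rw [← map_mul, hβ, map_one]
  refine h.quadPeriod.integral_comp (AddMonoidHom.mulLeft (mapHom (algebraMap F A) d β))
    (continuous_const_mul _) (fun x => ⟨mapHom (algebraMap F A) d β' * x, ?_⟩) ?_ hk ?_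
  · rw [AddMonoidHom.coe_mulLeft]; linear_combination x * hβu
  · rintro _ ⟨γ, rfl⟩
    exact ⟨β * γ, map_mul (mapHom (algebraMap F A) d) β γ⟩
  · rintro x _ ⟨γ, rfl⟩
    exact hper x γ

/-- The isotropic coefficient computed with the roles of `x` and `u` interchanged by an element
of `U_{2,2}(F)`. -/
theorem integral_eq_isoMean (h : IsInvariantDatum ν ψ φ) {β β' : QuadraticAlgebra F d 0}
    (hβ : β * β' = 1) (g : group A (algebraMap F A d)) :
    ∫ a, ∫ b, ∫ e, φ (rootU (mapHom (algebraMap F A) d β * b) *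
        rootZ ((mapHom (algebraMap F A) d β * star (mapHom (algebraMap F A) d β)).re * e) *
        rootX (mapHom (algebraMap F A) d β * a) * g) *
      charC ψ (-(mapHom (algebraMap F A) d β * a).re) ∂ν
      ∂quadMeasure (algebraMap F A d) 0 ν ∂quadMeasure (algebraMap F A d) 0 ν =
      isoMean ν ψ φ g := by
  have hφ := h.continuous
  have hψ := h.continuous_charC
  have hn : (mapHom (algebraMap F A) d β * star (mapHom (algebraMap F A) d β)).re =
      algebraMap F A (β * star β).re := by
    rw [← mapHom_star, ← map_mul]; rfl
  have hnu : (β * star β).re * (β' * star β').re = 1 := by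
    have h1 := congrArg QuadraticAlgebra.re hβ
    have h2 := congrArg QuadraticAlgebra.im hβ
    simp [QuadraticAlgebra.re_one, QuadraticAlgebra.im_one] at h1 h2 ⊢
    linear_combination (β.re * β'.re + d * β.im * β'.im + 1) * h1 -
      d * (β.re * β'.im + β.im * β'.re) * h2
  let K : QuadraticAlgebra A (algebraMap F A d) 0 → QuadraticAlgebra A (algebraMap F A d) 0 → ℂ :=
    fun b a => ∫ e, φ (rootX a * rootZ e * (rootU b * g)) ∂ν
  have hK : Continuous (Function.uncurry K) := by
    refine h.period.continuous_integral
      (X := QuadraticAlgebra A (algebraMap F A d) 0 × QuadraticAlgebra A (algebraMap F A d) 0)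
      (k := fun p e => φ (rootX p.2 * rootZ e * (rootU p.1 * g))) ?_
    simp only [Function.uncurry_def]
    fun_prop
  have hKb : ∀ a b γ, K (b + mapHom (algebraMap F A) d γ) a = K b a := by
    intro a b γ
    simp only [K]
    rw [add_comm b, rootU_add, mul_assoc, h.integral_rootZ_map_rootU]
  have hKa : ∀ b a γ, K b (a + mapHom (algebraMap F A) d γ) = K b a := fun b a γ =>
    h.integral_rootZ_map_rootX γ a _
  have s1 : ∀ a b, ∫ e, φ (rootU b * rootZ
      ((mapHom (algebraMap F A) d β * star (mapHom (algebraMap F A) d β)).re * e) *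
        rootX a * g) ∂ν = K b a := by
    intro a b
    have h1 := h.integral_rootZ_smul hnu (rootU b) (rootX a * g)
      (fun e => (rootZ_mul_rootU e b).symm)
    simp only [← mul_assoc] at h1
    rw [hn, h1, h.integral_rootU_mul_rootZ_mul_rootX]
  have s4 : ∀ a, ∫ b, K (mapHom (algebraMap F A) d β * b) a ∂quadMeasure (algebraMap F A d) 0 ν =
      ∫ b, K b a ∂quadMeasure (algebraMap F A d) 0 ν := fun a =>
    h.integral_mul_left hβ (k := fun b => K b a)
      (hK.comp (f := fun b => (b, a)) (by fun_prop)) (hKb a)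
  have hKi : Continuous fun a => ∫ b, K b a ∂quadMeasure (algebraMap F A d) 0 ν :=
    h.quadPeriod.continuous_integral (k := fun a b => K b a)
      (hK.comp (f := fun p : _ × _ => (p.2, p.1)) (by fun_prop))
  have s5 := h.integral_mul_left hβ
      (k := fun a => (∫ b, K b a ∂quadMeasure (algebraMap F A d) 0 ν) * charC ψ (-a.re))
      (hKi.mul (by fun_prop)) (fun a γ => by
    refine congrArg₂ (· * ·) ?_ (h.charC_neg_re_add γ a)
    congr 1; funext b
    exact hKa b a γ)
  have s6 : isoMean ν ψ φ g = ∫ a, (∫ b, K b a ∂quadMeasure (algebraMap F A d) 0 ν) *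
      charC ψ (-a.re) ∂quadMeasure (algebraMap F A d) 0 ν := by
    rw [h.isoMean_eq_swap]
    congr 1; funext a
    exact integral_mul_const _ _
  rw [s6, ← s5]
  congr 1; funext a
  rw [← s4, ← integral_mul_const]
  congr 1; funext b
  rw [← s1, integral_mul_const]

/-- The element γ₀ of the rational group carries u(a) to x(βa) and y(c) to y⁻(c), so the character
Re(βa) becomes that of the isotropic coefficient. The factor ψ(-αc) is left over. -/
theorem whittakerMean_eq (h : IsInvariantDatum ν ψ φ) {β β' : QuadraticAlgebra F d 0}
    (hβ : β * β' = 1) (α : F) (g : group A (algebraMap F A d)) :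
    ∃ g', whittakerMean ν ψ φ β α g =
      ∫ c, charC ψ (-(algebraMap F A α * c)) * isoMean ν ψ φ (rootYNeg c * g') ∂ν := by
  set β₁ := mapHom (algebraMap F A) d β with hβ₁
  have hβu : β₁ * mapHom (algebraMap F A) d β' = 1 := by rw [hβ₁, ← map_mul, hβ, map_one]
  let γ₀ : group A (algebraMap F A d) := torusM β₁ (mapHom (algebraMap F A) d β') hβu * weylY
  have hγ₀ : ∀ g, φ (γ₀ * g) = φ g := h.left_invariant γ₀
    ⟨torusM β β' hβ * weylY, by rw [map_mul, mapGroup_torusM _ _ _ _ _ hβu, mapGroup_weylY]⟩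
  refine ⟨γ₀ * g, ?_⟩
  rw [whittakerMean]
  congr 1; funext c
  rw [← h.integral_eq_isoMean hβ, ← integral_const_mul]
  congr 1; funext a
  rw [← integral_const_mul]
  congr 1; funext b
  rw [← integral_const_mul]
  congr 1; funext e
  have h1 : γ₀ * (rootX b * rootZ e * rootU a * rootY c * g) =
      rootU (β₁ * b) * rootZ ((β₁ * star β₁).re * e) * rootX (β₁ * a) *
        (rootYNeg c * (γ₀ * g)) := by
    have h2 := congrArg (· * g) ((torusM_semiconj β₁ _ hβu b a e c).mul_left
      (weylY_semiconj b a e c)).eq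
    simpa only [mul_assoc, γ₀] using h2
  rw [← hγ₀, h1, neg_add, charC_add]
  ring

/-- If the isotropic coefficient is invariant under a translate that is not trivial for the
Whittaker character, the Whittaker coefficient vanishes. -/
theorem whittakerMean_eq_zero (h : IsInvariantDatum ν ψ φ) {β β' : QuadraticAlgebra F d 0}
    (hβ : β * β' = 1) (α : F) {T T' : A} (hT : T * T' = 1) {κ : ℝ}
    (htorus : ∀ g, isoMean ν ψ φ (torusT T T' hT * g) = κ * isoMean ν ψ φ g) (γ : F)
    (hγ : ψ (algebraMap F A α * (T * T * algebraMap F A γ)) ≠ 1)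
    (g : group A (algebraMap F A d)) : whittakerMean ν ψ φ β α g = 0 := by
  have hi := h.continuous_isoMean
  have hψ := h.continuous_charC
  obtain ⟨g', hg'⟩ := h.whittakerMean_eq hβ α g
  rw [hg']
  -- Conjugating the rational y⁻(γ) by the torus element gives y⁻(T²γ); the constant κ cancels.
  have hinv : ∀ g, isoMean ν ψ φ (rootYNeg (T * T * algebraMap F A γ) * g) = isoMean ν ψ φ g := by
    intro g
    have h1 : rootYNeg (T * T * algebraMap F A γ) * g =
        torusT T T' hT * (rootYNeg (algebraMap F A γ) * ((torusT T T' hT)⁻¹ * g)) := by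
      rw [← mul_assoc (torusT T T' hT), torusT_mul_rootYNeg, mul_assoc (rootYNeg _),
        mul_inv_cancel_left]
    have h2 : g = torusT T T' hT * ((torusT T T' hT)⁻¹ * g) := (mul_inv_cancel_left _ _).symm
    rw [h1, htorus, h.isoMean_map_rootYNeg]
    conv_rhs => rw [h2, htorus]
  let k : A → ℂ := fun c => charC ψ (-(algebraMap F A α * c)) * isoMean ν ψ φ (rootYNeg c * g')
  have hk : Continuous k := by simp only [k]; fun_prop
  have h1 := h.period.integral_add k hk (by
    rintro c _ ⟨γ', rfl⟩
    simp only [k]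
    rw [add_comm, rootYNeg_add, mul_assoc]
    refine congrArg₂ (· * ·) ?_ (h.isoMean_map_rootYNeg γ' _)
    have h4 : -(algebraMap F A α * (algebraMap F A γ' + c)) =
        algebraMap F A (-(α * γ')) + -(algebraMap F A α * c) := by
      simp; ring
    refine (congrArg (charC ψ) h4).trans ?_
    rw [charC_add, h.charC_rational, one_mul]) (T * T * algebraMap F A γ)
  have h2 : ∀ c, k (c + T * T * algebraMap F A γ) =
      charC ψ (-(algebraMap F A α * (T * T * algebraMap F A γ))) * k c := by
    intro c
    simp only [k]
    rw [add_comm c, rootYNeg_add, mul_assoc (rootYNeg _), hinv, mul_add, neg_add, charC_add,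
      mul_assoc (charC ψ _)]
  simp only [h2, integral_const_mul] at h1
  by_contra hne
  have h3 := mul_right_cancel₀ hne (h1.trans (one_mul _).symm)
  have h4 := charC_mul_neg ψ (algebraMap F A α * (T * T * algebraMap F A γ))
  rw [h3, mul_one] at h4
  exact hγ (Circle.ext h4)

end IsInvariantDatum
end U22

/-! ### Computing periods by averages -/

section HasPeriod

variable {G : Type*} [Group G] [TopologicalSpace G] [IsTopologicalGroup G] [LocallyCompactSpace G]
  [SecondCountableTopology G] {Γ V : Subgroup G} [Countable Γ] {f : G → ℂ}
  {M : Type*} [TopologicalSpace M] [SecondCountableTopology M] [MeasurableSpace M] [BorelSpace M]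
  {ν : Measure M} [IsProbabilityMeasure ν] {c : M → G} {I : ℂ}

/-- Integrals over `Γ \ V` can be computed by means of right translates along a family for which
these means do not depend on the base point. -/
theorem HasPeriod.of_average {f₀ : G → ℂ} {c₀ : ℂ} (h : HasPeriod Γ V f₀ c₀)
    (hV : IsClosed (V : Set G)) (hf : Continuous f) (hf₀ : ∀ v ∈ V, ‖f v‖ = ‖f₀ v‖)
    (hinv : ∀ γ ∈ Γ, γ ∈ V → ∀ v ∈ V, f (γ * v) = f v) (hc : Continuous c) (hcV : ∀ m, c m ∈ V)
    (hI : ∀ v ∈ V, ∫ m, f (v * c m) ∂ν = I) : HasPeriod Γ V f I := by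
  let _ : MeasurableSpace V := borel V
  have : BorelSpace V := ⟨rfl⟩
  have : LocallyCompactSpace V := hV.isClosedEmbedding_subtypeVal.locallyCompactSpace
  have : Countable (Γ.subgroupOf V) :=
    (show Function.Injective fun γ : Γ.subgroupOf V => (⟨γ.1.1, γ.2⟩ : Γ) from
      fun x y h => Subtype.ext (Subtype.ext
        (show x.1.1 = y.1.1 from congrArg (fun t : Γ => t.1) h))).countable
  have : SecondCountableTopology V :=
    TopologicalSpace.Subtype.secondCountableTopology (V : Set G)
  obtain ⟨μ, D, hμ, hD, hμD, hint, -⟩ := h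
  have hfV : Continuous fun v : V => f v := hf.comp continuous_subtype_val
  -- Integrability is inherited from f₀, since the two functions have the same absolute value on V.
  have hint' : IntegrableOn (fun v : V => f v) D μ :=
    hint.congr' hfV.aestronglyMeasurable (Filter.Eventually.of_forall fun v => (hf₀ v v.2).symm)
  exact ⟨μ, D, hμ, hD, hμD, hint', hD.setIntegral_eq_of_average hμD (k := fun v : V => f v)
    (fun γ hγ v => hinv γ hγ γ.2 v v.2) hint' hfV (hc.subtype_mk hcV) fun v => hI v v.2⟩

theorem HasPeriod.eq_average {c₀ : ℂ} (h : HasPeriod Γ V f c₀)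
    (hV : IsClosed (V : Set G)) (hf : Continuous f)
    (hinv : ∀ γ ∈ Γ, γ ∈ V → ∀ v ∈ V, f (γ * v) = f v) (hc : Continuous c) (hcV : ∀ m, c m ∈ V)
    (hI : ∀ v ∈ V, ∫ m, f (v * c m) ∂ν = I) : c₀ = I := by
  let _ : MeasurableSpace V := borel V
  have : BorelSpace V := ⟨rfl⟩
  have : LocallyCompactSpace V := hV.isClosedEmbedding_subtypeVal.locallyCompactSpace
  have : Countable (Γ.subgroupOf V) :=
    (show Function.Injective fun γ : Γ.subgroupOf V => (⟨γ.1.1, γ.2⟩ : Γ) from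
      fun x y h => Subtype.ext (Subtype.ext
        (show x.1.1 = y.1.1 from congrArg (fun t : Γ => t.1) h))).countable
  have : SecondCountableTopology V :=
    TopologicalSpace.Subtype.secondCountableTopology (V : Set G)
  obtain ⟨μ, D, hμ, hD, hμD, hint, rfl⟩ := h
  exact hD.setIntegral_eq_of_average hμD (k := fun v : V => f v)
    (fun γ hγ v => hinv γ hγ γ.2 v v.2) hint (hf.comp continuous_subtype_val)
    (hc.subtype_mk hcV) fun v => hI v v.2

end HasPeriod

/-! ### Coordinates on the unipotent groups -/

namespace U22
open Matrix QuadExt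

section Coordinates

variable {R : Type*} [CommRing R] {δ : R}

theorem rootX_mul_rootZ_mul_rootU_mem_N1 (b a : QuadraticAlgebra R δ 0) (e : R) :
    rootX b * rootZ e * rootU a ∈ N1 R δ := by
  intro i j hij
  rw [mat_rootX_mul_rootZ_mul_rootU]
  fin_cases i <;> fin_cases j <;> simp at hij ⊢

theorem rootX_mul_rootZ_mul_rootU_mul_rootY_mem_N0 (b a : QuadraticAlgebra R δ 0) (e c : R) :
    rootX b * rootZ e * rootU a * rootY c ∈ N0 R δ := by
  intro i j hij
  rw [mat_rootX_mul_rootZ_mul_rootU_mul_rootY]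
  fin_cases i <;> fin_cases j <;> simp at hij ⊢

/-- The unitarity relations between rows. -/
theorem sum_mat_mul_star (g : group R δ) (i j : Fin 4) :
    ∑ k, mat g i k * star (mat g j.rev k.rev) = if i = j then 1 else 0 := by
  have h : mat g * mat g⁻¹ = 1 := by rw [← mat_mul, mul_inv_cancel, mat_one]
  have h2 := congrFun (congrFun h i) j
  rw [Matrix.mul_apply, Matrix.one_apply] at h2
  simpa only [mat_inv_apply] using h2

theorem eq_sqrtMul_of_add_star_eq_zero (h2 : ∀ x : R, 2 * x = 0 → x = 0)
    {t : QuadraticAlgebra R δ 0} (h : t + star t = 0) : t = sqrtMul t.im := by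
  have h3 := congrArg QuadraticAlgebra.re h
  ext
  · refine h2 _ ?_
    rw [two_mul]
    simpa using h3
  · rfl

/-- The unitarity relations express the remaining entries through those at (0, 1), (0, 2), (0, 3)
and (1, 2). They also give t + star t = 0 for two quantities t, which then lie in R√δ because 2 is
not a zero divisor. -/
theorem exists_eq_of_mem_N0 (h2 : ∀ x : R, 2 * x = 0 → x = 0) {v : group R δ} (hv : v ∈ N0 R δ) :
    ∃ b a e c, v = rootX b * rootZ e * rootU a * rootY c := by
  have e00 : mat v 0 0 = 1 := hv 0 0 (by decide)
  have e11 : mat v 1 1 = 1 := hv 1 1 (by decide)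
  have e22 : mat v 2 2 = 1 := hv 2 2 (by decide)
  have e33 : mat v 3 3 = 1 := hv 3 3 (by decide)
  have e10 : mat v 1 0 = 0 := hv 1 0 (by decide)
  have e20 : mat v 2 0 = 0 := hv 2 0 (by decide)
  have e30 : mat v 3 0 = 0 := hv 3 0 (by decide)
  have e21 : mat v 2 1 = 0 := hv 2 1 (by decide)
  have e31 : mat v 3 1 = 0 := hv 3 1 (by decide)
  have e32 : mat v 3 2 = 0 := hv 3 2 (by decide)
  have r12 := sum_mat_mul_star v 1 2
  have r02 := sum_mat_mul_star v 0 2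
  have r01 := sum_mat_mul_star v 0 1
  have r03 := sum_mat_mul_star v 0 3
  have f0 : (0 : Fin 4).rev = 3 := rfl
  have f1 : (1 : Fin 4).rev = 2 := rfl
  have f2 : (2 : Fin 4).rev = 1 := rfl
  have f3 : (3 : Fin 4).rev = 0 := rfl
  simp only [Fin.sum_univ_four, f0, f1, f2, f3, e00, e11, e22, e10, e20, e21,
    star_zero, star_one, mul_zero, zero_mul, one_mul, mul_one, zero_add, add_zero] at r12 r02 r01 r03
  rw [if_neg (by decide)] at r12 r02 r01 r03
  have hc : mat v 1 2 = sqrtMul (mat v 1 2).im :=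
    eq_sqrtMul_of_add_star_eq_zero h2 ((add_comm _ _).trans r12)
  have hcs : star (mat v 1 2) = -mat v 1 2 := by
    rw [hc]; ext <;> simp
  have h23 : mat v 2 3 = -star (mat v 0 1) := by
    have h3 := congrArg star r01
    simp only [star_add, star_star, star_zero] at h3
    linear_combination h3
  have h13 : mat v 1 3 = -star (mat v 0 2 - mat v 0 1 * mat v 1 2) := by
    have h3 := congrArg star r02
    rw [hcs] at h3
    simp only [star_add, star_star, star_zero, star_mul', star_neg, star_sub] at h3 ⊢
    linear_combination h3
  have h03 : mat v 0 3 = sqrtMul (mat v 0 3 + (mat v 0 2 - mat v 0 1 * mat v 1 2) *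
      star (mat v 0 1)).im - (mat v 0 2 - mat v 0 1 * mat v 1 2) * star (mat v 0 1) := by
    have h3 : (mat v 0 3 + (mat v 0 2 - mat v 0 1 * mat v 1 2) * star (mat v 0 1)) +
        star (mat v 0 3 + (mat v 0 2 - mat v 0 1 * mat v 1 2) * star (mat v 0 1)) = 0 := by
      simp only [star_add, star_star, star_mul', star_sub, hcs]
      linear_combination r03
    linear_combination eq_sqrtMul_of_add_star_eq_zero h2 h3
  refine ⟨mat v 0 2 - mat v 0 1 * mat v 1 2, mat v 0 1, (mat v 0 3 +
    (mat v 0 2 - mat v 0 1 * mat v 1 2) * star (mat v 0 1)).im, (mat v 1 2).im,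
    mat_injective (Matrix.ext fun i j => ?_)⟩
  rw [mat_rootX_mul_rootZ_mul_rootU_mul_rootY, ← hc, ← h13, ← h23, ← h03, sub_add_cancel]
  fin_cases i <;> fin_cases j <;> simp [e00, e11, e22, e33, e10, e20, e30, e21, e31, e32]

theorem N1_le_N0 : N1 R δ ≤ N0 R δ := by
  intro g hg i j hij
  refine hg i j ?_
  revert hij
  fin_cases i <;> fin_cases j <;> simp

theorem exists_eq_of_mem_N1 (h2 : ∀ x : R, 2 * x = 0 → x = 0) {v : group R δ} (hv : v ∈ N1 R δ) :
    ∃ b a e, v = rootX b * rootZ e * rootU a := by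
  obtain ⟨b, a, e, c, rfl⟩ := exists_eq_of_mem_N0 h2 (N1_le_N0 hv)
  refine ⟨b, a, e, ?_⟩
  have h1 := hv 1 2 (by decide)
  rw [mat_rootX_mul_rootZ_mul_rootU_mul_rootY] at h1
  have h3 : c = 0 := by simpa using congrArg QuadraticAlgebra.im h1
  have h4 := rootY_add (δ := δ) 0 0
  rw [add_zero] at h4
  rw [h3, mul_eq_left.1 h4.symm, mul_one]

end Coordinates

end U22

/-! ### Periods along N₁ and N₀ as iterated means -/

namespace U22
open Matrix QuadExt

variable {F A : Type*} [Field F] [CommRing A] [Algebra F A] [TopologicalSpace A]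
  [IsTopologicalRing A] [LocallyCompactSpace A] [T2Space A] [SecondCountableTopology A]
  [MeasurableSpace A] [BorelSpace A] {d : F}

/-- `k` is continuous and its restriction to `S` is left invariant under the rational points. -/
structure IsInvariantOn (S : Subgroup (group A (algebraMap F A d)))
    (k : group A (algebraMap F A d) → ℂ) : Prop where
  continuous : Continuous k
  left_invariant : ∀ γ ∈ (mapGroup (algebraMap F A) d).range, γ ∈ S → ∀ n ∈ S, k (γ * n) = k n

/-- The mean of `k` over `N₁`, translated by `q`. -/
def unipMean (ν : Measure A) (k : group A (algebraMap F A d) → ℂ)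
    (q : group A (algebraMap F A d)) : ℂ :=
  ∫ a, ∫ b, ∫ e, k (rootX b * rootZ e * rootU a * q) ∂ν
    ∂quadMeasure (algebraMap F A d) 0 ν ∂quadMeasure (algebraMap F A d) 0 ν

theorem rootX_mem_N1 (b : QuadraticAlgebra A (algebraMap F A d) 0) :
    rootX b ∈ N1 A (algebraMap F A d) := by
  intro i j hij
  rw [mat_rootX]
  fin_cases i <;> fin_cases j <;> simp at hij ⊢

theorem rootU_mem_N1 (b : QuadraticAlgebra A (algebraMap F A d) 0) :
    rootU b ∈ N1 A (algebraMap F A d) := by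
  intro i j hij
  rw [mat_rootU]
  fin_cases i <;> fin_cases j <;> simp at hij ⊢

theorem rootZ_mem_N1 (e : A) : rootZ e ∈ N1 A (algebraMap F A d) := by
  intro i j hij
  rw [mat_rootZ]
  fin_cases i <;> fin_cases j <;> simp at hij ⊢

theorem rootY_mem_N0 (c : A) : rootY c ∈ N0 A (algebraMap F A d) := by
  intro i j hij
  rw [mat_rootY]
  fin_cases i <;> fin_cases j <;> simp at hij ⊢

theorem rootU_mul_rootX_mul_rootZ_mul_rootU (b a a' : QuadraticAlgebra A (algebraMap F A d) 0)
    (e : A) : rootU a' * (rootX b * rootZ e * rootU a) =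
      rootX b * rootZ (e + 2 * (b * star a').im) * rootU (a + a') := by
  rw [← mul_assoc, ← mul_assoc, rootU_mul_rootX, mul_assoc _ (rootU a') (rootZ e),
    ← rootZ_mul_rootU, add_comm a, rootU_add, add_comm e, rootZ_add]
  simp only [mul_assoc]

theorem rootX_mul_rootZ_mul_rootU_mul (b b' a a' : QuadraticAlgebra A (algebraMap F A d) 0)
    (e e' : A) : (rootX b' * rootZ e' * rootU a') * (rootX b * rootZ e * rootU a) =
      rootX (b + b') * rootZ (e + (e' + 2 * (b * star a').im)) * rootU (a + a') := by
  rw [mul_assoc _ (rootU a'), rootU_mul_rootX_mul_rootZ_mul_rootU, add_left_comm, rootZ_add e',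
    add_comm b, rootX_add, mul_assoc (rootX b') (rootX b), ← mul_assoc (rootX b) (rootZ e'),
    rootX_mul_rootZ b e']
  simp only [mul_assoc]

theorem rootY_mul_rootX_mul_rootZ_mul_rootU (b a : QuadraticAlgebra A (algebraMap F A d) 0)
    (e c : A) : rootY c * (rootX b * rootZ e * rootU a) =
      rootX (b + -(a * sqrtMul c)) * rootZ (e + -((a * star a).re * c)) * rootU a * rootY c := by
  rw [← mul_assoc, ← mul_assoc, ← rootX_mul_rootY, mul_assoc (rootX b) (rootY c),
    ← rootZ_mul_rootY, mul_assoc, mul_assoc (rootZ e), rootY_mul_rootU, rootX_add, rootZ_add,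
    mul_assoc (rootX b) (rootX _), ← mul_assoc (rootX (-(a * sqrtMul c))) (rootZ e),
    rootX_mul_rootZ _ e]
  simp only [mul_assoc]

namespace IsInvariantOn

variable {ν : Measure A} {S : Subgroup (group A (algebraMap F A d))}
  {k : group A (algebraMap F A d) → ℂ}

theorem integral_rootZ_add (hk : IsInvariantOn S k) (hS : N1 A (algebraMap F A d) ≤ S)
    (hν : IsPeriodMeasure (baseLattice F A) ν) {p q : group A (algebraMap F A d)}
    (hp : ∀ e, p * rootZ e = rootZ e * p) (hpS : p ∈ S) (hqS : q ∈ S) (w : A) :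
    ∫ e, k (p * rootZ (e + w) * q) ∂ν = ∫ e, k (p * rootZ e * q) ∂ν := by
  have hc := hk.continuous
  refine hν.integral_add (fun e => k (p * rootZ e * q)) (by fun_prop) ?_ w
  rintro x _ ⟨γ, rfl⟩
  have h1 : p * rootZ (x + algebraMap F A γ) * q =
      rootZ (algebraMap F A γ) * (p * rootZ x * q) := by
    rw [add_comm, rootZ_add, ← mul_assoc p, hp]
    simp only [mul_assoc]
  exact (congrArg k h1).trans (hk.left_invariant _ ⟨rootZ γ, mapGroup_rootZ _ _ _⟩
    (hS (rootZ_mem_N1 _)) _ (mul_mem (mul_mem hpS (hS (rootZ_mem_N1 _))) hqS))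

/-- Multiplication in N₁ is triangular in the coordinates: the shift of e may depend on a and b,
that of b on a. The shifts are removed from the innermost integral outwards. -/
theorem unipMean_shift (hk : IsInvariantOn S k) (hS : N1 A (algebraMap F A d) ≤ S)
    (hν : IsPeriodMeasure (baseLattice F A) ν) {q : group A (algebraMap F A d)} (hq : q ∈ S)
    (e₁ : QuadraticAlgebra A (algebraMap F A d) 0 → QuadraticAlgebra A (algebraMap F A d) 0 → A)
    (b₁ : QuadraticAlgebra A (algebraMap F A d) 0 → QuadraticAlgebra A (algebraMap F A d) 0)
    (a₁ : QuadraticAlgebra A (algebraMap F A d) 0) :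
    ∫ a, ∫ b, ∫ e, k (rootX (b + b₁ a) * rootZ (e + e₁ a b) * rootU (a + a₁) * q) ∂ν
      ∂quadMeasure (algebraMap F A d) 0 ν ∂quadMeasure (algebraMap F A d) 0 ν =
      unipMean ν k q := by
  have hc := hk.continuous
  have hQ := isPeriodMeasure_quadMeasure (d := d) hν
  let K : QuadraticAlgebra A (algebraMap F A d) 0 → QuadraticAlgebra A (algebraMap F A d) 0 → ℂ :=
    fun a b => ∫ e, k (rootX b * rootZ e * (rootU a * q)) ∂ν
  have hK : Continuous (Function.uncurry K) := by
    refine hν.continuous_integral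
      (X := QuadraticAlgebra A (algebraMap F A d) 0 × QuadraticAlgebra A (algebraMap F A d) 0)
      (k := fun p e => k (rootX p.2 * rootZ e * (rootU p.1 * q))) ?_
    simp only [Function.uncurry_def]
    fun_prop
  have hUq : ∀ a, rootU a * q ∈ S := fun a => mul_mem (hS (rootU_mem_N1 a)) hq
  have hKe : ∀ a b w, ∫ e, k (rootX b * rootZ (e + w) * rootU a * q) ∂ν = K a b := by
    intro a b w
    simp only [mul_assoc _ (rootU a)]
    exact hk.integral_rootZ_add hS hν (rootX_mul_rootZ b) (hS (rootX_mem_N1 b)) (hUq a) w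
  have hKb : ∀ a b, ∀ γ ∈ quadLattice A d, K a (b + γ) = K a b := by
    rintro a b _ ⟨γ, rfl⟩
    simp only [K]
    congr 1; funext e
    have h1 : rootX (b + mapHom (algebraMap F A) d γ) * rootZ e * (rootU a * q) =
        rootX (mapHom (algebraMap F A) d γ) * (rootX b * rootZ e * (rootU a * q)) := by
      rw [add_comm, rootX_add]; simp only [mul_assoc]
    exact (congrArg k h1).trans (hk.left_invariant _ ⟨rootX γ, mapGroup_rootX _ _ _⟩
      (hS (rootX_mem_N1 _)) _ (mul_mem (mul_mem (hS (rootX_mem_N1 _)) (hS (rootZ_mem_N1 _)))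
        (hUq a)))
  have hKa : ∀ a b, ∀ γ ∈ quadLattice A d, K (a + γ) b = K a b := by
    rintro a b _ ⟨γ, rfl⟩
    rw [← hKe _ b (2 * (b * star (mapHom (algebraMap F A) d γ)).im)]
    simp only [K]
    congr 1; funext e
    have h1 : rootX b * rootZ (e + 2 * (b * star (mapHom (algebraMap F A) d γ)).im) *
        rootU (a + mapHom (algebraMap F A) d γ) * q =
        rootU (mapHom (algebraMap F A) d γ) * (rootX b * rootZ e * (rootU a * q)) := by
      rw [← rootU_mul_rootX_mul_rootZ_mul_rootU]
      simp only [mul_assoc]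
    exact (congrArg k h1).trans (hk.left_invariant _ ⟨rootU γ, mapGroup_rootU _ _ _⟩
      (hS (rootU_mem_N1 _)) _ (mul_mem (mul_mem (hS (rootX_mem_N1 _)) (hS (rootZ_mem_N1 _)))
        (hUq a)))
  have s1 : ∀ a, ∫ b, K (a + a₁) (b + b₁ a) ∂quadMeasure (algebraMap F A d) 0 ν =
      ∫ b, K (a + a₁) b ∂quadMeasure (algebraMap F A d) 0 ν := fun a =>
    hQ.integral_add (fun b => K (a + a₁) b)
      (hK.comp (f := fun b => (a + a₁, b)) (by fun_prop)) (hKb _) _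
  have s2 := hQ.integral_add (fun a => ∫ b, K a b ∂quadMeasure (algebraMap F A d) 0 ν)
    (hQ.continuous_integral hK) (fun a γ hγ => by simp only [hKa a _ γ hγ]) a₁
  simp only [hKe, s1]
  rw [s2]
  simp only [K, unipMean, mul_assoc]

theorem continuous_unipMean (hk : IsInvariantOn S k) (hν : IsPeriodMeasure (baseLattice F A) ν) :
    Continuous (unipMean ν k) := by
  have hc := hk.continuous
  have hQ := isPeriodMeasure_quadMeasure (d := d) hν
  refine hQ.continuous_integral (k := fun q a => ∫ b, ∫ e, k (rootX b * rootZ e * rootU a * q) ∂ν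
    ∂quadMeasure (algebraMap F A d) 0 ν) ?_
  refine hQ.continuous_integral
    (X := group A (algebraMap F A d) × QuadraticAlgebra A (algebraMap F A d) 0)
    (k := fun p b => ∫ e, k (rootX b * rootZ e * rootU p.2 * p.1) ∂ν) ?_
  refine hν.continuous_integral
    (X := (group A (algebraMap F A d) × QuadraticAlgebra A (algebraMap F A d) 0) ×
      QuadraticAlgebra A (algebraMap F A d) 0)
    (k := fun p e => k (rootX p.2 * rootZ e * rootU p.1.2 * p.1.1)) ?_
  simp only [Function.uncurry_def]
  fun_prop

/-- Moving the rational y(γ) to the left shifts b and e by amounts that depend only on a, so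
`unipMean_shift` absorbs them. -/
theorem unipMean_map_rootY (hk : IsInvariantOn (N0 A (algebraMap F A d)) k)
    (hν : IsPeriodMeasure (baseLattice F A) ν) (c : A) (γ : F) :
    unipMean ν k (rootY (c + algebraMap F A γ)) = unipMean ν k (rootY c) := by
  rw [← hk.unipMean_shift N1_le_N0 hν (rootY_mem_N0 (c + algebraMap F A γ))
    (fun a _ => -((a * star a).re * algebraMap F A γ))
    (fun a => -(a * sqrtMul (algebraMap F A γ))) 0, unipMean]
  congr 1; funext a
  congr 1; funext b
  congr 1; funext e
  have h1 : rootX (b + -(a * sqrtMul (algebraMap F A γ))) *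
      rootZ (e + -((a * star a).re * algebraMap F A γ)) * rootU (a + 0) *
        rootY (c + algebraMap F A γ) =
      rootY (algebraMap F A γ) * (rootX b * rootZ e * rootU a * rootY c) := by
    rw [add_zero, add_comm c, rootY_add, ← mul_assoc, ← rootY_mul_rootX_mul_rootZ_mul_rootU,
      mul_assoc]
  exact (congrArg k h1).trans (hk.left_invariant _ ⟨rootY γ, mapGroup_rootY _ _ _⟩
    (rootY_mem_N0 _) _ (rootX_mul_rootZ_mul_rootU_mul_rootY_mem_N0 _ _ _ _))

theorem integral_N1 (hk : IsInvariantOn (N1 A (algebraMap F A d)) k)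
    (hν : IsPeriodMeasure (baseLattice F A) ν) (h2 : ∀ x : A, 2 * x = 0 → x = 0)
    {v : group A (algebraMap F A d)} (hv : v ∈ N1 A (algebraMap F A d)) :
    ∫ m : QuadraticAlgebra A (algebraMap F A d) 0 × QuadraticAlgebra A (algebraMap F A d) 0 × A,
      k (v * (rootX m.2.1 * rootZ m.2.2 * rootU m.1)) ∂(quadMeasure (algebraMap F A d) 0 ν).prod
        ((quadMeasure (algebraMap F A d) 0 ν).prod ν) = unipMean ν k 1 := by
  have hc := hk.continuous
  have hQ := isPeriodMeasure_quadMeasure (d := d) hν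
  have := hQ.isProb
  have := hν.isProb
  obtain ⟨b₀, a₀, e₀, rfl⟩ := exists_eq_of_mem_N1 h2 hv
  rw [integral_prod _ ((hQ.prod (hQ.prod hν)).integrable (by fun_prop)),
    ← hk.unipMean_shift le_rfl hν (one_mem _) (fun _ b => e₀ + 2 * (b * star a₀).im)
      (fun _ => b₀) a₀]
  congr 1; funext a
  rw [integral_prod _ ((hQ.prod hν).integrable (by fun_prop))]
  simp only [rootX_mul_rootZ_mul_rootU_mul, mul_one]

/-- Left multiplication by v shifts c by a constant and then the coordinates of N₁ triangularly. The
shifts come from moving y(c₀) past N₁ and multiplying there. -/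
theorem integral_N0 (hk : IsInvariantOn (N0 A (algebraMap F A d)) k)
    (hν : IsPeriodMeasure (baseLattice F A) ν) (h2 : ∀ x : A, 2 * x = 0 → x = 0)
    {v : group A (algebraMap F A d)} (hv : v ∈ N0 A (algebraMap F A d)) :
    ∫ m : A × QuadraticAlgebra A (algebraMap F A d) 0 ×
        QuadraticAlgebra A (algebraMap F A d) 0 × A,
      k (v * (rootX m.2.2.1 * rootZ m.2.2.2 * rootU m.2.1 * rootY m.1))
        ∂ν.prod ((quadMeasure (algebraMap F A d) 0 ν).prod
        ((quadMeasure (algebraMap F A d) 0 ν).prod ν)) = ∫ c, unipMean ν k (rootY c) ∂ν := by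
  have hc := hk.continuous
  have hQ := isPeriodMeasure_quadMeasure (d := d) hν
  have := hQ.isProb
  have := hν.isProb
  obtain ⟨b₀, a₀, e₀, c₀, rfl⟩ := exists_eq_of_mem_N0 h2 hv
  have hcont := (hk.continuous_unipMean hν).comp (continuous_rootY (R := A) (δ := algebraMap F A d))
  rw [← hν.integral_add (fun c => unipMean ν k (rootY c)) hcont
    (by rintro c _ ⟨γ, rfl⟩; exact hk.unipMean_map_rootY hν c γ) c₀,
    integral_prod _ ((hν.prod (hQ.prod (hQ.prod hν))).integrable (by fun_prop))]
  congr 1; funext c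
  rw [integral_prod _ ((hQ.prod (hQ.prod hν)).integrable (by fun_prop)),
    ← hk.unipMean_shift N1_le_N0 hν (rootY_mem_N0 (c + c₀))
      (fun a b => -((a * star a).re * c₀) +
        (e₀ + 2 * ((b + -(a * sqrtMul c₀)) * star a₀).im))
      (fun a => -(a * sqrtMul c₀) + b₀) a₀]
  congr 1; funext a
  rw [integral_prod _ ((hQ.prod hν).integrable (by fun_prop))]
  congr 1; funext b
  congr 1; funext e
  congr 1
  rw [mul_assoc (rootX b₀ * rootZ e₀ * rootU a₀), ← mul_assoc (rootY c₀),
    rootY_mul_rootX_mul_rootZ_mul_rootU, mul_assoc _ (rootY c₀), ← mul_assoc (rootX b₀ * _ * _),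
    rootX_mul_rootZ_mul_rootU_mul, add_comm c, rootY_add, add_assoc b, add_assoc e]

end IsInvariantOn

end U22

/-! ### Adelic Fourier coefficients as iterated means -/

namespace U22
open Matrix QuadExt

section Entries

variable {R : Type*} [CommRing R] {δ : R}

theorem mat_mul_zero_one {m n : group R δ} (hm : m ∈ N0 R δ) (hn : n ∈ N0 R δ) :
    mat (m * n) 0 1 = mat m 0 1 + mat n 0 1 := by
  rw [mat_mul, Matrix.mul_apply, Fin.sum_univ_four, hm 0 0 (by decide), hn 1 1 (by decide),
    hn 2 1 (by decide), hn 3 1 (by decide)]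
  simp [add_comm]

theorem mat_mul_one_two {m n : group R δ} (hm : m ∈ N0 R δ) (hn : n ∈ N0 R δ) :
    mat (m * n) 1 2 = mat m 1 2 + mat n 1 2 := by
  rw [mat_mul, Matrix.mul_apply, Fin.sum_univ_four, hm 1 0 (by decide), hm 1 1 (by decide),
    hn 2 2 (by decide), hn 3 2 (by decide)]
  simp [add_comm]

theorem mat_mul_zero_two {m n : group R δ} (hm : m ∈ N1 R δ) (hn : n ∈ N1 R δ) :
    mat (m * n) 0 2 = mat m 0 2 + mat n 0 2 := by
  rw [mat_mul, Matrix.mul_apply, Fin.sum_univ_four, hm 0 0 (by decide), hn 1 2 (by decide),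
    hn 2 2 (by decide), hn 3 2 (by decide)]
  simp [add_comm]

theorem mat_mapGroup {S : Type*} [CommRing S] (f : R →+* S) (g : group R δ) (i j : Fin 4) :
    mat (mapGroup f δ g) i j = mapHom f δ (mat g i j) := rfl

instance [Countable R] : Countable (group R δ) := by
  have h1 : Function.Injective (QuadraticAlgebra.equivProd δ (0 : R)) := Equiv.injective _
  have := h1.countable
  exact (show Function.Injective fun g : group R δ => fun i j => mat g i j from
    fun _ _ h => mat_injective h).countable

end Entries

variable {F A : Type*} [Field F] [CommRing A] [Algebra F A] [TopologicalSpace A]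
  [IsTopologicalRing A] [LocallyCompactSpace A] [T2Space A] [SecondCountableTopology A]
  [MeasurableSpace A] [BorelSpace A] {d : F}

theorem norm_charC (ψ : AddChar A Circle) (x : A) : ‖charC ψ x‖ = 1 := Circle.norm_coe _

theorem charC_inv (ψ : AddChar A Circle) (x : A) : (charC ψ x)⁻¹ = charC ψ (-x) :=
  inv_eq_of_mul_eq_one_right (charC_mul_neg ψ x)

theorem two_mul_eq_zero [CharZero F] (x : A) (hx : 2 * x = 0) : x = 0 := by
  have h1 : algebraMap F A (1 / 2) * 2 = 1 := by
    rw [← map_ofNat (algebraMap F A) 2, ← map_mul]; norm_num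
  linear_combination (-x) * h1 + algebraMap F A (1 / 2) * hx

namespace IsInvariantDatum

variable {ν : Measure A} {ψ : AddChar A Circle} {φ : group A (algebraMap F A d) → ℂ}

/-- The period in `hg` supplies the Haar measure, the fundamental domain and the integrability of φ;
twisting by a unitary character preserves the latter. The value is then an average over coordinates
of N₁. -/
theorem hasPeriod_besselMean [CharZero F] [Countable F] (h : IsInvariantDatum ν ψ φ)
    (α : QuadraticAlgebra F d 0) (g : group A (algebraMap F A d))
    (hg : HasPeriod (mapGroup (algebraMap F A) d).range (N1 A _) (fun n => φ (n * g)) 0) :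
    HasPeriod (mapGroup (algebraMap F A) d).range (N1 A _) (fun n => φ (n * g) *
      (charC ψ (mat n 0 1 * star (mapHom (algebraMap F A) d α) + mat n 0 2).re)⁻¹)
      (besselMean ν ψ φ α g) := by
  have hφ := h.continuous
  have hψ := h.continuous_charC
  have hm : ∀ i j, Continuous fun n : group A (algebraMap F A d) => mat n i j := fun i j =>
    continuous_mat.matrix_elem i j
  have hm1 := hm 0 1
  have hm2 := hm 0 2
  have hQ := h.quadPeriod
  have := hQ.isProb
  have := h.period.isProb
  have : Countable (mapGroup (algebraMap F A) d).range :=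
    (MonoidHom.rangeRestrict_surjective _).countable
  simp only [charC_inv]
  have hk : IsInvariantOn (N1 A (algebraMap F A d)) fun n => φ (n * g) *
      charC ψ (-(mat n 0 1 * star (mapHom (algebraMap F A) d α) + mat n 0 2).re) := by
    refine ⟨by fun_prop, ?_⟩
    rintro _ ⟨γ, rfl⟩ hγ n hn
    rw [mul_assoc, h.left_invariant _ ⟨γ, rfl⟩, mat_mul_zero_one (N1_le_N0 hγ) (N1_le_N0 hn),
      mat_mul_zero_two hγ hn, mat_mapGroup, mat_mapGroup]
    congr 1
    have h1 : -((mapHom (algebraMap F A) d (mat γ 0 1) + mat n 0 1) *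
        star (mapHom (algebraMap F A) d α) + (mapHom (algebraMap F A) d (mat γ 0 2) +
          mat n 0 2)).re = algebraMap F A (-(mat γ 0 1 * star α + mat γ 0 2).re) +
        -(mat n 0 1 * star (mapHom (algebraMap F A) d α) + mat n 0 2).re := by
      simp [mapHom]; ring
    rw [h1, charC_add, h.charC_rational, one_mul]
  refine hg.of_average (isClosed_unipotentRadical _ _) hk.continuous
    (fun v _ => by rw [norm_mul, norm_charC, mul_one]) hk.left_invariant
    (c := fun m : QuadraticAlgebra A (algebraMap F A d) 0 ×
      QuadraticAlgebra A (algebraMap F A d) 0 × A => rootX m.2.1 * rootZ m.2.2 * rootU m.1)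
    (by fun_prop) (fun _ => rootX_mul_rootZ_mul_rootU_mem_N1 _ _ _) fun v hv =>
      (hk.integral_N1 h.period (two_mul_eq_zero (F := F)) hv).trans ?_
  rw [unipMean, besselMean]
  congr 1; funext a
  rw [heisMean, ← integral_mul_const]
  congr 1; funext b
  rw [← integral_mul_const]
  congr 1; funext e
  rw [mul_one, mat_rootX_mul_rootZ_mul_rootU, mul_assoc _ (rootU a) g, mul_assoc (φ _),
    ← charC_add, ← neg_add, ← QuadraticAlgebra.re_add, add_comm b]
  rfl

theorem eq_whittakerMean [CharZero F] [Countable F] (h : IsInvariantDatum ν ψ φ)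
    (β : QuadraticAlgebra F d 0) (α : F) (g : group A (algebraMap F A d)) {c₀ : ℂ}
    (hg : HasPeriod (mapGroup (algebraMap F A) d).range (N0 A _) (fun n => φ (n * g) *
      (charC ψ ((mapHom (algebraMap F A) d β * mat n 0 1).re +
        algebraMap F A α * (mat n 1 2).im))⁻¹) c₀) :
    c₀ = whittakerMean ν ψ φ β α g := by
  have hφ := h.continuous
  have hψ := h.continuous_charC
  have hm : ∀ i j, Continuous fun n : group A (algebraMap F A d) => mat n i j := fun i j =>
    continuous_mat.matrix_elem i j
  have hm1 := hm 0 1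
  have hm2 := hm 1 2
  have hQ := h.quadPeriod
  have := hQ.isProb
  have := h.period.isProb
  have : Countable (mapGroup (algebraMap F A) d).range :=
    (MonoidHom.rangeRestrict_surjective _).countable
  simp only [charC_inv] at hg
  have hk : IsInvariantOn (N0 A (algebraMap F A d)) fun n => φ (n * g) *
      charC ψ (-((mapHom (algebraMap F A) d β * mat n 0 1).re +
        algebraMap F A α * (mat n 1 2).im)) := by
    refine ⟨by fun_prop, ?_⟩
    rintro _ ⟨γ, rfl⟩ hγ n hn
    rw [mul_assoc, h.left_invariant _ ⟨γ, rfl⟩, mat_mul_zero_one hγ hn,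
      mat_mul_one_two hγ hn, mat_mapGroup, mat_mapGroup]
    congr 1
    have h1 : -((mapHom (algebraMap F A) d β * (mapHom (algebraMap F A) d (mat γ 0 1) +
        mat n 0 1)).re + algebraMap F A α * (mapHom (algebraMap F A) d (mat γ 1 2) +
          mat n 1 2).im) = algebraMap F A (-((β * mat γ 0 1).re + α * (mat γ 1 2).im)) +
        -((mapHom (algebraMap F A) d β * mat n 0 1).re + algebraMap F A α * (mat n 1 2).im) := by
      simp [mapHom]; ring
    rw [h1, charC_add, h.charC_rational, one_mul]
  refine hg.eq_average (isClosed_unipotentRadical _ _) hk.continuous hk.left_invariant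
    (c := fun m : A × QuadraticAlgebra A (algebraMap F A d) 0 ×
      QuadraticAlgebra A (algebraMap F A d) 0 × A =>
      rootX m.2.2.1 * rootZ m.2.2.2 * rootU m.2.1 * rootY m.1)
    (by fun_prop) (fun _ => rootX_mul_rootZ_mul_rootU_mul_rootY_mem_N0 _ _ _ _) fun v hv =>
      (hk.integral_N0 h.period (two_mul_eq_zero (F := F)) hv).trans ?_
  simp only [unipMean, whittakerMean, mat_rootX_mul_rootZ_mul_rootU_mul_rootY]
  rfl

end IsInvariantDatum

/-! ### Self-duality and the vanishing argument -/

/-- The character `a ↦ ψ(½ tr(a ᾱ))` of `A_E / E`. -/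
def quadChar (ψ : AddChar A Circle) (d : F) (α : QuadraticAlgebra F d 0) :
    AddChar (QuadraticAlgebra A (algebraMap F A d) 0) Circle where
  toFun a := ψ (a * star (mapHom (algebraMap F A) d α)).re
  map_zero_eq_one' := by simp
  map_add_eq_mul' a b := by
    rw [add_mul, QuadraticAlgebra.re_add, AddChar.map_add_eq_mul]

theorem quadChar_apply (ψ : AddChar A Circle) (α : QuadraticAlgebra F d 0)
    (a : QuadraticAlgebra A (algebraMap F A d) 0) :
    quadChar ψ d α a = ψ (a * star (mapHom (algebraMap F A) d α)).re := rfl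

/-- Testing on α ∈ F and α ∈ F√d reduces both separation and faithfulness to the two coordinates,
where they are the self-duality of F and strong approximation for ψ. -/
theorem isDualFamily_quadChar [Infinite F] (hF : IsGlobalField F A) {ψ : AddChar A Circle}
    (hψ : Continuous ψ) (hψF : ∀ a : F, ψ (algebraMap F A a) = 1) (hne : ψ ≠ 1) (hd : d ≠ 0) :
    IsDualFamily (quadLattice A d) (quadChar ψ d) where
  continuous α := hψ.comp (by fun_prop)
  map_add α β x := by
    simp only [quadChar_apply]
    rw [← AddChar.map_add_eq_mul, map_add, star_add, mul_add, QuadraticAlgebra.re_add]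
  period := by
    rintro α _ ⟨γ, rfl⟩
    rw [quadChar_apply, ← mapHom_star]
    have h1 : ((mapHom (algebraMap F A) d).toAddMonoidHom γ * mapHom (algebraMap F A) d (star α)) =
      mapHom (algebraMap F A) d (γ * star α) :=
      (map_mul (mapHom (algebraMap F A) d) γ (star α)).symm
    rw [h1]
    exact hψF _
  separates x hx := by
    obtain ⟨p, hp⟩ := hF.exists_eq_algebraMap ψ hψ hψF hne (x := x.re) fun a => by
      have h1 := hx ⟨a, 0⟩
      rw [quadChar_apply] at h1
      simpa [mapHom] using h1
    obtain ⟨q, hq⟩ := hF.exists_eq_algebraMap ψ hψ hψF hne (x := x.im) fun a => by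
      -- The sign undoes the conjugation and the division by d undoes the square of √d, so that the
      -- pairing is with the √d-coordinate of x times a.
      have h1 := hx ⟨0, -(a / d)⟩
      rw [quadChar_apply] at h1
      have h2 : (x * star (mapHom (algebraMap F A) d ⟨0, -(a / d)⟩)).re =
          x.im * algebraMap F A a := by
        have h3 : algebraMap F A a = algebraMap F A d * algebraMap F A (a / d) := by
          rw [← map_mul, mul_div_cancel₀ _ hd]
        rw [h3]
        simp [mapHom]
        ring
      rwa [h2] at h1
    exact ⟨⟨p, q⟩, QuadraticAlgebra.ext hp hq⟩
  faithful α hα := by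
    have hinj : Function.Injective (algebraMap F A) := by
      have : Nontrivial A := ⟨1, 0, fun h0 => hne (by
        ext1 z
        rw [← mul_one z, h0, mul_zero, AddChar.map_zero_eq_one]; rfl)⟩
      exact (algebraMap F A).injective
    have h1 : algebraMap F A α.re = 0 := hF.eq_zero_of_forall_mul ψ hψ hψF hne fun y => by
      have h2 := hα ⟨y, 0⟩
      rw [quadChar_apply] at h2
      have h3 : ((⟨y, 0⟩ : QuadraticAlgebra A (algebraMap F A d) 0) *
          star (mapHom (algebraMap F A) d α)).re = algebraMap F A α.re * y := by
        simp [mapHom, mul_comm]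
      rwa [h3] at h2
    have h4 : algebraMap F A (-(d * α.im)) = 0 :=
      hF.eq_zero_of_forall_mul ψ hψ hψF hne fun y => by
      have h2 := hα ⟨0, y⟩
      rw [quadChar_apply] at h2
      have h3 : ((⟨0, y⟩ : QuadraticAlgebra A (algebraMap F A d) 0) *
          star (mapHom (algebraMap F A) d α)).re = algebraMap F A (-(d * α.im)) * y := by
        simp [mapHom]; ring
      rwa [h3] at h2
    rw [map_eq_zero_iff _ hinj] at h1 h4
    ext
    · exact h1
    · simpa [hd] using h4

theorem isDualFamily_baseLattice [Infinite F] (hF : IsGlobalField F A) {ψ : AddChar A Circle}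
    (hψ : Continuous ψ) (hψF : ∀ a : F, ψ (algebraMap F A a) = 1) (hne : ψ ≠ 1) (hd : d ≠ 0) :
    IsDualFamily (baseLattice F A)
      fun γ : baseLattice F A => (ψ.mulShift (algebraMap F A d)).mulShift (γ : A) where
  continuous γ := hψ.comp ((continuous_const_mul _).comp (continuous_const_mul _))
  map_add γ γ' x := by
    simp only [AddChar.mulShift_apply]
    rw [← AddChar.map_add_eq_mul, AddSubgroup.coe_add, add_mul, mul_add]
  period := by
    rintro ⟨_, γ, rfl⟩ _ ⟨γ', rfl⟩
    have h1 := hψF (d * (γ * γ'))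
    rw [map_mul (algebraMap F A), map_mul (algebraMap F A)] at h1
    exact h1
  separates x hx := by
    obtain ⟨q, hq⟩ := hF.exists_eq_algebraMap ψ hψ hψF hne (x := x) fun a => by
      have h1 := hx ⟨algebraMap F A (a / d), a / d, rfl⟩
      simp only [AddChar.mulShift_apply] at h1
      have h3 : algebraMap F A a = algebraMap F A d * algebraMap F A (a / d) := by
        rw [← map_mul, mul_div_cancel₀ _ hd]
      rw [h3, mul_comm x, mul_assoc]
      exact h1
    exact ⟨q, hq⟩
  faithful := by
    rintro ⟨_, γ, rfl⟩ hγ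
    have h4 : algebraMap F A (d * γ) = 0 :=
      hF.eq_zero_of_forall_mul ψ hψ hψF hne fun y => by
        rw [map_mul (algebraMap F A), mul_assoc]
        exact hγ y
    have h5 : algebraMap F A d⁻¹ * algebraMap F A (d * γ) = algebraMap F A γ := by
      rw [← map_mul, inv_mul_cancel_left₀ hd]
    exact Subtype.ext (h5.symm.trans (by rw [h4, mul_zero]; rfl))

/-- If all subregular coefficients of `φ` vanish, then so do its Whittaker coefficients. -/
theorem IsInvariantDatum.whittakerMean_eq_zero_of_besselMean [Infinite F] [Countable F]
    (hF : IsGlobalField F A) {ψ : AddChar A Circle} (hne : ψ ≠ 1) (hd : d ≠ 0) {μ : Measure A}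
    {D : Set A} (hD : IsUnitDomain (baseLattice F A) μ D)
    {φ : group A (algebraMap F A d) → ℂ} (h : IsInvariantDatum (μ.restrict D) ψ φ)
    (h0 : ∀ α : QuadraticAlgebra F d 0, α.re ≠ 0 → ∀ g, besselMean (μ.restrict D) ψ φ α g = 0)
    {T T' : A} (hT : T * T' = 1) (hTF : ∀ q : F, algebraMap F A q ≠ T * T)
    {β β' : QuadraticAlgebra F d 0} (hβ : β * β' = 1) {α : F} (hα : α ≠ 0)
    (g : group A (algebraMap F A d)) : whittakerMean (μ.restrict D) ψ φ β α g = 0 := by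
  have : Countable (baseLattice F A) :=
    (show Function.Surjective fun a : F => (⟨algebraMap F A a, a, rfl⟩ : baseLattice F A) from by
      rintro ⟨_, a, rfl⟩; exact ⟨a, rfl⟩).countable
  have hdisc : ∃ U : Set A, IsOpen U ∧ 0 ∈ U ∧ ∀ γ ∈ baseLattice F A, γ ∈ U → γ = 0 := by
    obtain ⟨U, hU, hU0, hUF⟩ := hF.discrete
    refine ⟨U, hU, hU0, ?_⟩
    rintro _ ⟨a, rfl⟩ ha
    rw [hUF a ha, _root_.map_zero]
  have hcpt : ∃ C : Set A, IsCompact C ∧ ∀ x, ∃ γ ∈ baseLattice F A, x - γ ∈ C := by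
    obtain ⟨C, hC, hCF⟩ := hF.cocompact
    refine ⟨C, hC, fun x => ?_⟩
    obtain ⟨a, ha⟩ := hCF x
    exact ⟨_, ⟨a, rfl⟩, ha⟩
  have hreal := h.heisMean_rootU_ofBase hcpt
    (isDualFamily_quadChar hF h.continuous_char h.char_rational hne hd) (fun _ _ => rfl) h0
  obtain ⟨κ, -, hκg⟩ := exists_isoMean_torusT hD hdisc hcpt h
    (isDualFamily_baseLattice hF h.continuous_char h.char_rational hne hd) hreal T T' hT
  -- Otherwise αT² annihilates F under ψ, hence lies in F, and so does T².
  obtain ⟨γ, hγ⟩ : ∃ γ : F, ψ (algebraMap F A α * (T * T * algebraMap F A γ)) ≠ 1 := by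
    by_contra! hcon
    obtain ⟨q, hq⟩ := hF.exists_eq_algebraMap ψ h.continuous_char h.char_rational hne
      (x := algebraMap F A α * (T * T)) fun a => by rw [mul_assoc]; exact hcon a
    refine hTF (α⁻¹ * q) ?_
    rw [map_mul, hq, ← mul_assoc, ← map_mul, inv_mul_cancel₀ hα, map_one, one_mul]
  exact h.whittakerMean_eq_zero hβ α hT hκg γ hγ g

end U22

/-! ### Choice of the idele and conclusion -/

namespace U22
open Matrix QuadExt

theorem exists_mul_eq_one_of_not_isSquare {F : Type*} [Field F] {d : F} (hd : ¬ IsSquare d)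
    {β : QuadraticAlgebra F d 0} (hβ : β ≠ 0) : ∃ β', β * β' = 1 := by
  have hN : β.re * β.re - d * β.im * β.im ≠ 0 := by
    intro h0
    by_cases him : β.im = 0
    · refine hβ (QuadraticAlgebra.ext ?_ him)
      simpa [him] using h0
    · refine hd ⟨β.re / β.im, ?_⟩
      field_simp
      linear_combination -h0
  have hn := mul_inv_cancel₀ hN
  refine ⟨⟨β.re * (β.re * β.re - d * β.im * β.im)⁻¹, -β.im * (β.re * β.re - d * β.im * β.im)⁻¹⟩,
    QuadraticAlgebra.ext ?_ ?_⟩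
  · simp only [QuadraticAlgebra.re_mul, QuadraticAlgebra.re_one]
    linear_combination hn
  · simp only [QuadraticAlgebra.im_mul, QuadraticAlgebra.im_one]
    ring

instance nontrivial_finiteAdeleRing (F : Type*) [Field F] [NumberField F] : Nontrivial 𝔸ᶠ[F] := by
  obtain ⟨P, hP, hP'⟩ := Ring.not_isField_iff_exists_prime.1 (RingOfIntegers.not_isField F)
  let v : IsDedekindDomain.HeightOneSpectrum (𝓞 F) := ⟨P, hP', hP⟩
  exact ⟨0, 1, fun h => zero_ne_one (congrArg (fun x : 𝔸ᶠ[F] => x v) h)⟩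

/-- The idele with infinite component `2` and finite component `1`. -/
theorem exists_unit_sq_notMem (F : Type*) [Field F] [NumberField F] :
    ∃ T T' : 𝔸[F], T * T' = 1 ∧ ∀ q : F, algebraMap F 𝔸[F] q ≠ T * T := by
  refine ⟨((2 : F∞), (1 : 𝔸ᶠ[F])), (algebraMap F F∞ (1 / 2), (1 : 𝔸ᶠ[F])),
    Prod.ext ?_ (one_mul _), fun q hq => ?_⟩
  · change 2 * algebraMap F F∞ (1 / 2) = 1
    rw [← map_ofNat (algebraMap F F∞) 2, ← map_mul]
    norm_num
  -- The infinite component would give q = 4 and the finite one q = 1.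
  · have h1 : algebraMap F F∞ q = 2 * 2 := congrArg Prod.fst hq
    have h2 : algebraMap F 𝔸ᶠ[F] q = 1 * 1 := congrArg Prod.snd hq
    have h3 : q = 2 * 2 := (algebraMap F F∞).injective (by rw [h1, map_mul, map_ofNat])
    have h4 : q = 1 := (algebraMap F 𝔸ᶠ[F]).injective (by rw [h2, map_one, one_mul])
    rw [h4] at h3
    norm_num at h3

end U22

theorem proposition5p2 (F : Type*) [Field F] [NumberField F] (d : F) (hd : ¬ IsSquare d)
    (ψ : AddChar (AdeleRing (RingOfIntegers F) F) Circle) (hψ_cont : Continuous ψ)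
    (hψ_rational : ∀ a : F, ψ (algebraMap F (AdeleRing (RingOfIntegers F) F) a) = 1)
    (hψ_nontrivial : ψ ≠ 1)
    (K : Subgroup (U22.Adelic F d)) (hK : U22.IsMaximalCompact F d K)
    (π : Submodule ℂ (U22.Adelic F d → ℂ)) (hπ : U22.IsIrreducibleCuspidal K π)
    (hgeneric : U22.IsGeneric ψ π) :
    U22.HasSubregularCoefficient ψ π := by
  let _ : MeasurableSpace 𝔸[F] := borel _
  have : BorelSpace 𝔸[F] := ⟨rfl⟩
  have : Countable F := (Module.finBasis ℚ F).equivFun.injective.countable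
  have hF := isGlobalField_adeleRing F
  have hd0 : d ≠ 0 := fun h => hd (h ▸ IsSquare.zero)
  have hcount : Countable (U22.baseLattice F 𝔸[F]) :=
    (AddMonoidHom.rangeRestrict_surjective (algebraMap F 𝔸[F]).toAddMonoidHom).countable
  obtain ⟨μ, D, hD⟩ : ∃ (μ : Measure 𝔸[F]) (D : Set 𝔸[F]),
      IsUnitDomain (U22.baseLattice F 𝔸[F]) μ D := by
    refine exists_isUnitDomain ?_ ?_
    · obtain ⟨U, hU, hU0, hUF⟩ := hF.discrete
      refine ⟨U, hU, hU0, ?_⟩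
      rintro _ ⟨a, rfl⟩ ha
      rw [hUF a ha, map_zero]
    · obtain ⟨C, hC, hCF⟩ := hF.cocompact
      refine ⟨C, hC, fun x => ?_⟩
      obtain ⟨a, ha⟩ := hCF x
      exact ⟨_, ⟨a, rfl⟩, ha⟩
  obtain ⟨β, α, hβ, hα, φ, hφ, g, c, hc, hper⟩ := hgeneric
  obtain ⟨β', hββ'⟩ := U22.exists_mul_eq_one_of_not_isSquare hd hβ
  obtain ⟨T, T', hT, hTF⟩ := U22.exists_unit_sq_notMem F
  have haut := hπ.automorphic φ hφ
  have h : U22.IsInvariantDatum (μ.restrict D) ψ φ :=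
    ⟨hD.isPeriodMeasure, hψ_cont, hψ_rational, (haut.smooth []).1, haut.left_invariant⟩
  -- If no subregular coefficient were nonzero, the same form φ would have zero Whittaker
  -- coefficients.
  by_contra hcon
  refine hc ((h.eq_whittakerMean β α g hper).trans
    (h.whittakerMean_eq_zero_of_besselMean hF hψ_nontrivial hd0 hD (fun α' hα' g' => ?_)
      hT hTF hββ' hα g))
  by_contra hne
  refine hcon ⟨α', fun h0 => hα' ?_, φ, hφ, g', _, hne, ?_⟩
  · have h1 := congrArg QuadraticAlgebra.re h0
    simpa [U22.middleForm, ← two_mul] using h1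
  -- Cuspidality along N₁ supplies the integrability needed for the twisted period to exist.
  · have h2 := h.hasPeriod_besselMean α' g' ((hπ.cuspidal φ hφ g').2.1)
    have h3 : ∀ n : U22.Adelic F d, U22.besselCharacter ψ (1, α') n =
        U22.charC ψ (U22.mat n 0 1 * star (U22.toAdele α') + U22.mat n 0 2).re := by
      intro n
      simp [U22.besselCharacter, U22.middleForm, QuadExt.halfTrace, U22.charC]
    simp only [h3]
    exact h2

end
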